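/- **Construction.** For $n = 2^k$, $k \ge 0$, let $H(n)$ be the Hadamard matrix defined by $H(1) = (1)$ and $H(2n) = \begin{pmatrix} H(n) & H(n) \\ H(n) & -H(n)\end{pmatrix}$. For $i\in\{1,\dots,n\}$ let $\tau_i = (\tau_i^1,\dots,\tau_i^n)$ be the permutation of $\{1,\dots,n\}$ defined recursively as follows: for $n=1$, $\tau_1 = (1)$; given $\tau_1,\dots,\tau_n$ for $n$, the permutations for $2n$ are, for $1 \le i \le n$, $$\widetilde\tau_i = (\tau_i^1,\dots,\tau_i^n,\ \tau_i^1+n,\dots,\tau_i^n+n),$$ $$\widetilde\tau_{n+i} = (\tau_i^1,\tau_i^2+n,\tau_i^3,\tau_i^4+n,\dots,\ \tau_i^1+n,\tau_i^2,\tau_i^3+n,\tau_i^4,\dots),$$ that is, in $\widetilde\tau_{n+i}$ the number $n$ is added to the even positions of a first copy of $\tau_i$ and to the odd positions of a second copy. Let $n = 2^k$ with $k \ge 1$. The abstract simplicial complex $\mathrm{HMT}(n)$ has the vertices $0$; $v_j^1, v_j^2$ for $1 \le j \le n$; $w_j^1, w_j^2$ for $2 \le j \le n$; and $c_i$ for $1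 \le i \le n$. Put $x_{ij}^a = v_j^a$ if $H(n)_{ij} = 1$ and $x_{ij}^a = w_j^a$ if $H(n)_{ij} = -1$ (the first column of $H(n)$ has only entries $1$). The faces of $\mathrm{HMT}(n)$ are the nonempty subsets of the following triangles: * for all $i, p \in \{1,\dots,n\}$, with $j = \tau_i^p$ and $j' = \tau_i^{p+1}$ (where $\tau_i^{n+1} = \tau_i^1$), the triangles $\{0, x_{ij}^2, x_{ij'}^1\}$, $\{c_i, x_{ij}^1, x_{ij}^2\}$ and $\{c_i, x_{ij}^2, x_{ij'}^1\}$; * for all $j \in \{2,\dots,n\}$, the triangles $\{0, v_j^1, w_j^2\}$, $\{v_j^1, v_j^2, w_j^2\}$, $\{v_j^2, w_j^1, w_j^2\}$ and $\{0, v_j^2, w_j^1\}$. **Theorem.** For every $n = 2^k$ with $k \ge 1$, the simplicial complex $\mathrm{HMT}(n)$ is $2$-dimensional and $\mathbb{Q}$-acyclic, it has the face vector $(f_0,f_1,f_2) = (5n-1,\ 3n^2+9n-6,\ 3n^2+4n-4)$, and its integral simplicial homology is $H_0 \cong \mathbb{Z}$, $H_1 = T$, $H_d = 0$ for $d \ge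 2$, where $T$ is the torsion subgroup of $H_1$ and $$T \cong (\mathbb{Z}/2)^{\binom{k}{1}} \times (\mathbb{Z}/4)^{\binom{k}{2}} \times \cdots \times (\mathbb{Z}/2^k)^{\binom{k}{k}}, \qquad |T| = n^{n/2}.$$ In particular $\log_2 |T| = \Theta(n \log n)$, that is, $|T| = 2^{\Theta(n\log n)}$, for $n = 2^k \to \infty$. Moreover, there is an algorithm (a program for a word RAM with addition, truncated subtraction, multiplication, division and remainder, indirect addressing, every instruction and every test of a condition at unit cost, and words of $O(\log n)$ bits) that, on input $n = 2^k$, $k \ge 1$, outputs the list of the facets of $\mathrm{HMT}(n)$ (with vertices encoded as natural numbers), each exactly once, as triples of vertices, with running time $\Theta(n^2)$. -/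

import Mathlib

open Asymptotics Filter

/-! ### Simplicial complexes: dimension, face numbers, simplicial homology -/

namespace PreAbstractSimplicialComplex

variable {V : Type*}

/-- `K` has dimension `d`: every face has at most `d + 1` vertices, and some face has exactly
`d + 1` vertices. -/
def HasDimension (K : PreAbstractSimplicialComplex V) (d : ℕ) : Prop :=
  (∀ s ∈ K.faces, s.card ≤ d + 1) ∧ ∃ s ∈ K.faces, s.card = d + 1

/-- The entry `f_d` of the face vector: the number of faces of dimension `d`. -/
noncomputable def faceNumber (K : PreAbstractSimplicialComplex V) (d : ℕ) : ℕ :=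
  {s : Finset V | s ∈ K.faces ∧ s.card = d + 1}.ncard

/-- The faces of dimension `d`. -/
abbrev Simplex (K : PreAbstractSimplicialComplex V) (d : ℕ) : Type _ :=
  {s : Finset V // s ∈ K.faces ∧ s.card = d + 1}

/-- The simplicial `d`-chains with coefficients in `R`. A face stands for the simplex oriented by
the increasing order of its vertices. -/
abbrev Chain (R : Type*) [CommRing R] (K : PreAbstractSimplicialComplex V) (d : ℕ) : Type _ :=
  K.Simplex d →₀ R

variable [LinearOrder V]

/-- The face of a simplex that is opposite to one of its vertices. -/
def Simplex.opposite {K : PreAbstractSimplicialComplex V} {d : ℕ} (s : K.Simplex (d + 1))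
    (v : V) (hv : v ∈ s.1) : K.Simplex d :=
  ⟨s.1.erase v, by
    have hc : (s.1.erase v).card = d + 1 := by
      rw [Finset.card_erase_of_mem hv, s.2.2]; rfl
    refine ⟨(K.isRelLowerSet_faces s.2.1).2 (Finset.erase_subset v s.1) ?_, hc⟩
    exact Finset.card_pos.mp (by omega)⟩

/-- The simplicial boundary map `∂ [v₀, …, v_{d+1}] = ∑ i, (-1)^i [v₀, …, v̂_i, …, v_{d+1}]` for
`v₀ < ⋯ < v_{d+1}`; the position `i` of a vertex `v` is the number of smaller vertices. -/
noncomputable def boundary (R : Type*) [CommRing R] (K : PreAbstractSimplicialComplex V) (d : ℕ) :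
    K.Chain R (d + 1) →ₗ[R] K.Chain R d :=
  Finsupp.linearCombination R fun s : K.Simplex (d + 1) =>
    ∑ v : {v // v ∈ s.1},
      Finsupp.single (s.opposite v.1 v.2) ((-1 : R) ^ (s.1.filter (· < v.1)).card)

/-- The simplicial cycles: all chains in degree `0`, the kernel of the boundary map otherwise. -/
noncomputable def cycles (R : Type*) [CommRing R] (K : PreAbstractSimplicialComplex V) :
    (d : ℕ) → Submodule R (K.Chain R d)
  | 0 => ⊤
  | d + 1 => LinearMap.ker (K.boundary R d)

/-- The boundary of a boundary vanishes: boundaries are cycles. -/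
theorem range_boundary_le_cycles (R : Type*) [CommRing R] (K : PreAbstractSimplicialComplex V)
    (d : ℕ) : LinearMap.range (K.boundary R d) ≤ K.cycles R d := by
  cases d with
  | zero => exact le_top
  | succ d =>
    rw [LinearMap.range_le_iff_comap, Submodule.eq_top_iff']
    intro z
    change K.boundary R d (K.boundary R (d + 1) z) = 0
    suffices h : (K.boundary R d).comp (K.boundary R (d + 1)) = 0 from LinearMap.congr_fun h z
    refine Finsupp.lhom_ext' fun s => LinearMap.ext_ring ?_
    simp only [boundary, LinearMap.comp_apply, Finsupp.lsingle_apply,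
      Finsupp.linearCombination_single, one_smul, map_sum, LinearMap.zero_apply, Finset.smul_sum,
      Finsupp.smul_single, smul_eq_mul]
    rw [← Fintype.sum_sigma']
    refine Finset.sum_involution
      (fun p _ => ⟨⟨p.2.1, Finset.mem_of_mem_erase p.2.2⟩,
        ⟨p.1.1, Finset.mem_erase.mpr ⟨(Finset.ne_of_mem_erase p.2.2).symm, p.1.2⟩⟩⟩)
      ?_ ?_ (fun _ _ => Finset.mem_univ _) (fun _ _ => rfl)
    · rintro ⟨⟨a, ha⟩, ⟨b, hb⟩⟩ -
      have hbs : b ∈ s.1 := Finset.mem_of_mem_erase hb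
      have key : ∀ a b : V, a ∈ s.1 → a < b →
          (-1 : R) ^ (s.1.filter (· < a)).card * (-1) ^ ((s.1.erase a).filter (· < b)).card +
            (-1) ^ (s.1.filter (· < b)).card * (-1) ^ ((s.1.erase b).filter (· < a)).card = 0 := by
        intro a b ha hab
        have e1 : (s.1.erase b).filter (· < a) = s.1.filter (· < a) := by
          ext c
          simp only [Finset.mem_filter, Finset.mem_erase]
          exact ⟨fun h => ⟨h.1.2, h.2⟩, fun h => ⟨⟨(h.2.trans hab).ne, h.1⟩, h.2⟩⟩
        have e2 : (s.1.filter (· < b)).card = ((s.1.erase a).filter (· < b)).card + 1 := by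
          rw [show (s.1.erase a).filter (· < b) = (s.1.filter (· < b)).erase a by
            ext c; simp only [Finset.mem_filter, Finset.mem_erase, and_assoc], Finset.card_erase_add_one]
          exact Finset.mem_filter.mpr ⟨ha, hab⟩
        rw [e1, e2, pow_succ]
        ring
      have hop : (s.opposite b hbs).opposite a
          (Finset.mem_erase.mpr ⟨(Finset.ne_of_mem_erase hb).symm, ha⟩) =
          (s.opposite a ha).opposite b hb :=
        Subtype.ext (Finset.erase_right_comm (a := b) (b := a) (s := s.1))
      dsimp only
      rw [hop, ← Finsupp.single_add, Finsupp.single_eq_zero]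
      rcases lt_or_gt_of_ne (Finset.ne_of_mem_erase hb) with h | h
      · rw [add_comm]
        exact key b a hbs h
      · exact key a b ha h
    · rintro ⟨⟨a, ha⟩, ⟨b, hb⟩⟩ - - h
      have h1 := congrArg (fun p => p.1.1) h
      exact Finset.ne_of_mem_erase hb h1

/-- The quotient of a submodule `Z` by a submodule `B`, where `B ≤ Z`. -/
abbrev Subquotient {R M : Type*} [CommRing R] [AddCommGroup M] [Module R M]
    (Z B : Submodule R M) : Type _ :=
  Z ⧸ B.submoduleOf Z

/-- The `d`-th (unreduced) simplicial homology with coefficients in `R`: cycles modulo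
boundaries. -/
def Homology (R : Type*) [CommRing R] (K : PreAbstractSimplicialComplex V) (d : ℕ) : Type _ :=
  Subquotient (K.cycles R d) (LinearMap.range (K.boundary R d))

noncomputable instance (R : Type*) [CommRing R] (K : PreAbstractSimplicialComplex V) (d : ℕ) :
    AddCommGroup (K.Homology R d) :=
  inferInstanceAs
    (AddCommGroup (Subquotient (K.cycles R d) (LinearMap.range (K.boundary R d))))

noncomputable instance (R : Type*) [CommRing R] (K : PreAbstractSimplicialComplex V) (d : ℕ) :
    Module R (K.Homology R d) :=
  inferInstanceAs
    (Module R (Subquotient (K.cycles R d) (LinearMap.range (K.boundary R d))))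

/-- `K` is `ℚ`-acyclic: it has the rational homology of a point. -/
def IsRationallyAcyclic (K : PreAbstractSimplicialComplex V) : Prop :=
  Nonempty (K.Homology ℚ 0 ≃ₗ[ℚ] ℚ) ∧ ∀ d, 1 ≤ d → Subsingleton (K.Homology ℚ d)

end PreAbstractSimplicialComplex

/-! ### The complexes `HMT(n)`, `n = 2 ^ k`

Rows, columns and positions are numbered `0, …, n - 1`. -/

namespace HMT

/-- The entries of the Hadamard matrices `H(1) = (1)`,
`H(2n) = (H(n), H(n); H(n), -H(n))`, for `n = 2 ^ k`. -/
def hadamard : ℕ → ℕ → ℕ → ℤ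
  | 0, _, _ => 1
  | k + 1, i, j =>
    (if 2 ^ k ≤ i ∧ 2 ^ k ≤ j then -1 else 1) * hadamard k (i % 2 ^ k) (j % 2 ^ k)

/-- `tau k i p` is the column in position `p` of the ordering `τ_i` of the columns of `H(2 ^ k)`.
For `n = 2 ^ k`, the first `n` orderings for `H(2n)` are
`(τ_i^0, …, τ_i^{n-1}; τ_i^0 + n, …, τ_i^{n-1} + n)`, and the last `n` are
`(τ_i^0, τ_i^1 + n, τ_i^2, τ_i^3 + n, …; τ_i^0 + n, τ_i^1, τ_i^2 + n, τ_i^3, …)`. -/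
def tau : ℕ → ℕ → ℕ → ℕ
  | 0, _, _ => 0
  | k + 1, i, p =>
    tau k (i % 2 ^ k) (p % 2 ^ k) +
      if i < 2 ^ k ∨ Even (p % 2 ^ k) then (if p < 2 ^ k then 0 else 2 ^ k)
      else (if p < 2 ^ k then 2 ^ k else 0)

/-- The vertices are natural numbers. The base vertex is `0`; the positive cycle of column `j` is
`0 — v j 0 — v j 1 — 0`. -/
def v (j a : ℕ) : ℕ := 1 + 2 * j + a

/-- The negative cycle of column `j` is `0 — w k j 0 — w k j 1 — 0`. -/
def w (k j a : ℕ) : ℕ := 1 + 2 * 2 ^ k + 2 * j + a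

/-- The centre of the disc of row `i`. -/
def c (k i : ℕ) : ℕ := 1 + 4 * 2 ^ k + i

/-- The vertices of the cycle of column `j` that the disc of row `i` uses: the positive cycle if
`H_{ij} = 1`, the negative one if `H_{ij} = -1`. -/
def x (k i j a : ℕ) : ℕ := if hadamard k i j = 1 then v j a else w k j a

/-- The `3n` triangles of the disc of row `i`: for every two cyclically consecutive cycles along
the boundary, one triangle that shields off the base vertex, and two triangles at the centre. -/
def discTriangles (k i : ℕ) : Set (Finset ℕ) :=
  {t | ∃ p < 2 ^ k,
    t = {0, x k i (tau k i p) 1, x k i (tau k i ((p + 1) % 2 ^ k)) 0} ∨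
    t = {c k i, x k i (tau k i p) 0, x k i (tau k i p) 1} ∨
    t = {c k i, x k i (tau k i p) 1, x k i (tau k i ((p + 1) % 2 ^ k)) 0}}

/-- The four triangles of the digon between the two cycles of column `j`. -/
def digonTriangles (k j : ℕ) : Set (Finset ℕ) :=
  {{0, v j 0, w k j 1}, {v j 0, v j 1, w k j 1}, {v j 1, w k j 0, w k j 1}, {0, v j 1, w k j 0}}

/-- All triangles of `HMT(2 ^ k)`. The digon of column `0`, whose negative cycle no disc uses, is
left out. -/
def triangles (k : ℕ) : Set (Finset ℕ) :=
  {t | (∃ i < 2 ^ k, t ∈ discTriangles k i) ∨ ∃ j, 1 ≤ j ∧ j < 2 ^ k ∧ t ∈ digonTriangles k j}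

/-- The simplicial complex `HMT(2 ^ k)` with these triangles. -/
def complex (k : ℕ) : PreAbstractSimplicialComplex ℕ where
  faces := {s | s.Nonempty ∧ ∃ t ∈ triangles k, s ⊆ t}
  isRelLowerSet_faces := by
    rintro s ⟨hs, t, ht, hst⟩
    exact ⟨hs, fun u hu hne => ⟨hne, t, ht, fun a ha => hst (hu ha)⟩⟩

end HMT

/-! ### Algorithms: structured programs for a word RAM -/

namespace WordRAM

/-- The arithmetic operations on words. -/
inductive Op where
  | add | sub | mul | div | mod

/-- Subtraction is truncated at `0`, division is rounded down. -/
def Op.eval : Op → ℕ → ℕ → ℕ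
  | .add, a, b => a + b
  | .sub, a, b => a - b
  | .mul, a, b => a * b
  | .div, a, b => a / b
  | .mod, a, b => a % b

/-- Programs. The numbers `x`, `y`, `z` name registers. -/
inductive Program where
  /-- `x := a` for a constant `a` -/
  | const (x a : ℕ)
  /-- `x := y op z` -/
  | arith (x : ℕ) (op : Op) (y z : ℕ)
  /-- `x := mem[y]` -/
  | load (x y : ℕ)
  /-- `mem[x] := y` -/
  | store (x y : ℕ)
  /-- append the content of `x` to the output -/
  | write (x : ℕ)
  /-- first `P`, then `Q` -/
  | seq (P Q : Program)
  /-- `P` if the content of `x` is not `0`, else `Q` -/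
  | ite (x : ℕ) (P Q : Program)
  /-- repeat `P` as long as the content of `x` is not `0` -/
  | loop (x : ℕ) (P : Program)

/-- A configuration: registers, memory, and the output written so far. -/
structure State where
  reg : ℕ → ℕ
  mem : ℕ → ℕ
  out : List ℕ

/-- `x := a` -/
def State.setReg (s : State) (x a : ℕ) : State := { s with reg := Function.update s.reg x a }

/-- `mem[x] := a` -/
def State.setMem (s : State) (x a : ℕ) : State := { s with mem := Function.update s.mem x a }

/-- Execution with word bound `B`: `Exec B P s t s'` says that `P`, started in the configuration
`s`, halts after exactly `t` steps in the configuration `s'`, where every elementary instruction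
and every test of a condition is one step, and no number larger than `B` is ever computed (an
instruction that would produce one cannot be executed). -/
inductive Exec (B : ℕ) : Program → State → ℕ → State → Prop where
  | const (x a : ℕ) (s : State) (h : a ≤ B) : Exec B (.const x a) s 1 (s.setReg x a)
  | arith (x : ℕ) (op : Op) (y z : ℕ) (s : State) (h : op.eval (s.reg y) (s.reg z) ≤ B) :
      Exec B (.arith x op y z) s 1 (s.setReg x (op.eval (s.reg y) (s.reg z)))
  | load (x y : ℕ) (s : State) : Exec B (.load x y) s 1 (s.setReg x (s.mem (s.reg y)))
  | store (x y : ℕ) (s : State) : Exec B (.store x y) s 1 (s.setMem (s.reg x) (s.reg y))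
  | write (x : ℕ) (s : State) : Exec B (.write x) s 1 { s with out := s.out ++ [s.reg x] }
  | seq {P Q : Program} {s s' s'' : State} {t t' : ℕ} (h : Exec B P s t s')
      (h' : Exec B Q s' t' s'') : Exec B (.seq P Q) s (t + t') s''
  | ite_true {x : ℕ} {P Q : Program} {s s' : State} {t : ℕ} (hx : s.reg x ≠ 0)
      (h : Exec B P s t s') : Exec B (.ite x P Q) s (t + 1) s'
  | ite_false {x : ℕ} {P Q : Program} {s s' : State} {t : ℕ} (hx : s.reg x = 0)
      (h : Exec B Q s t s') : Exec B (.ite x P Q) s (t + 1) s'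
  | loop_step {x : ℕ} {P : Program} {s s' s'' : State} {t t' : ℕ} (hx : s.reg x ≠ 0)
      (h : Exec B P s t s') (h' : Exec B (.loop x P) s' t' s'') :
      Exec B (.loop x P) s (t + t' + 1) s''
  | loop_stop {x : ℕ} {P : Program} {s : State} (hx : s.reg x = 0) : Exec B (.loop x P) s 1 s

/-- The initial configuration: the input is in register `0`, all other registers and the memory
are `0`, nothing has been written. -/
def initial (n : ℕ) : State where
  reg := fun x => if x = 0 then n else 0
  mem := fun _ => 0
  out := []

/-- On input `n`, with words bounded by `B`, the program `P` halts after exactly `t` steps with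
output `out`. -/
def Computes (B : ℕ) (P : Program) (n t : ℕ) (out : List ℕ) : Prop :=
  ∃ s : State, Exec B P (initial n) t s ∧ s.out = out

end WordRAM

/-- The sequence of numbers `out` lists the facets (maximal faces) of a complex `K`, each of them
exactly once, as a triple of vertices. -/
def ListsFacets (out : List ℕ) (K : PreAbstractSimplicialComplex ℕ) : Prop :=
  ∃ L : List (ℕ × ℕ × ℕ), out = L.flatMap (fun t => [t.1, t.2.1, t.2.2]) ∧
    (L.map fun t => ({t.1, t.2.1, t.2.2} : Finset ℕ)).Nodup ∧
    ∀ s : Finset ℕ, s ∈ L.map (fun t => ({t.1, t.2.1, t.2.2} : Finset ℕ)) ↔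
      Maximal (· ∈ K.faces) s

/-!
The complex consists of cycles of length three through the base vertex, a positive and a negative
one for each column of the Hadamard matrix `H(n)` (but no negative one for the first column), of a
digon between the two cycles of each further column, and of a disc for each row `i`. The boundary
of this disc runs through one cycle of each column, the positive or the negative one according to
the signs of the row, in the order `τ_i`.

*Homology.* Modulo boundaries, every edge is a detour through the base vertex completed by
positive cycles `g_j`. The digons turn the negative cycle of column `j` into `-g_j`, and the disc
of row `i` gives the relation `∑ j, H_{ij} g_j = 0`. So `H_1` is the cokernel of `H(n)`, with
coefficients in any commutative ring. Formally, every oriented edge is labelled by a vector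
(`label`) that says which positive cycles complete the detour (`IsReduced`,
`isReduced_of_mem_faces`), and the labels of the boundaries are spanned by the rows of `H(n)`
(`map_labelMap_range_boundary`); these facts give `nonempty_homology_one`.

*Cokernel.* Rows and columns correspond to sets of binary digits, with `H_{IJ} = (-1) ^ |I ∩ J|`.
The binomial theorem for `(-2 + 1) ^ |I ∩ J|` gives `H = Z D Zᵀ` with the unimodular incidence
matrix `Z` of the inclusion of sets and the diagonal matrix `D` with entries `(-2) ^ |S|`
(`hadamard_eq_sum`). Hence the cokernel is the product of the groups `ℤ / 2 ^ |S|` over all sets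
`S` of digits (`nonempty_coker_hadamard`); over `ℚ` it vanishes.

*Face vector.* The ordering `τ_i` fixes the even positions and adds, without carry, the digits of
`i` other than the lowest on the odd positions (`tau_eq`). So two consecutive signed columns
determine the row and the position (`eq_of_consecutive`), different discs share no edge or
triangle outside the cycles, and faces can be counted. Since the Euler characteristic is `1`, the
rational `H_2` vanishes (`ker_boundary_one_rat`). It consists of the cycles, as there are no faces
of dimension `3`, so there are no integral cycles in degree `2` either (`ker_boundary_one_int`).

*Algorithm.* The sums without carry of binary numbers, which give the orderings, and the signs of
`H(n)` are tabulated by recursion on `i / 2` and `j / 2` (`tableEntry_eq`). All loops have bodies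
without branches and at most `n ^ 2` passes; conversely, the output has more than `n ^ 2` numbers.
-/

/-! ### Binary digits of the Hadamard matrices and of the orderings -/

namespace HMT

theorem hadamard_eq_one_or (k i j : ℕ) : hadamard k i j = 1 ∨ hadamard k i j = -1 := by
  induction k generalizing i j with
  | zero => exact Or.inl rfl
  | succ k ih =>
    rw [hadamard]
    rcases ih (i % 2 ^ k) (j % 2 ^ k) with h | h <;> rw [h] <;> split_ifs <;> simp

theorem hadamard_zero_right (k i : ℕ) : hadamard k i 0 = 1 := by
  induction k generalizing i with
  | zero => rfl
  | succ k ih => simp [hadamard, ih]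

theorem hadamard_zero_left (k j : ℕ) : hadamard k 0 j = 1 := by
  induction k generalizing j with
  | zero => rfl
  | succ k ih => simp [hadamard, ih]

theorem two_pow_le_iff_testBit {k i : ℕ} (hi : i < 2 ^ (k + 1)) :
    2 ^ k ≤ i ↔ i.testBit k = true := by
  rw [Nat.testBit_eq_decide_div_mod_eq, decide_eq_true_iff]
  have hpos : 0 < 2 ^ k := by positivity
  have h2 : i / 2 ^ k < 2 := by rw [Nat.div_lt_iff_lt_mul hpos]; rw [pow_succ] at hi; omega
  rw [Nat.mod_eq_of_lt h2, ← Nat.one_le_div_iff hpos]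
  omega

/-- `H(2 ^ k)` is a Kronecker power: its entries are products over the common binary digits of the
row and the column. -/
theorem hadamard_eq_prod {k i j : ℕ} (hi : i < 2 ^ k) (hj : j < 2 ^ k) :
    hadamard k i j = ∏ b : Fin k, if i.testBit b ∧ j.testBit b then (-1 : ℤ) else 1 := by
  induction k generalizing i j with
  | zero => rfl
  | succ k ih =>
    have hpos : 0 < 2 ^ k := by positivity
    rw [hadamard, Fin.prod_univ_castSucc, ih (Nat.mod_lt _ hpos) (Nat.mod_lt _ hpos), mul_comm]
    simp only [two_pow_le_iff_testBit hi, two_pow_le_iff_testBit hj, Nat.testBit_mod_two_pow,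
      Fin.val_castSucc, Fin.is_lt, decide_true, Bool.true_and, Fin.val_last]

/-- Splitting off the lowest binary digits, the recursion by which the algorithm tabulates the
Hadamard matrix. -/
theorem hadamard_eq_div_two {k i j : ℕ} (hi : i < 2 ^ k) (hj : j < 2 ^ k) :
    hadamard k i j =
      (if i % 2 = 1 ∧ j % 2 = 1 then -1 else 1) * hadamard k (i / 2) (j / 2) := by
  cases k with
  | zero =>
    obtain rfl : i = 0 := by omega
    simp [hadamard]
  | succ k =>
    have hi' : i / 2 < 2 ^ k := by rw [pow_succ] at hi; omega
    have hk : (i / 2).testBit k = false := Nat.testBit_lt_two_pow hi'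
    rw [hadamard_eq_prod hi hj, hadamard_eq_prod (by omega) (by omega), Fin.prod_univ_succ,
      Fin.prod_univ_castSucc]
    simp [Nat.testBit_succ, hk, Nat.testBit_zero]

theorem xor_eq_mod_add {m a b : ℕ} (ha : a < 2 ^ (m + 1)) (hb : b < 2 ^ (m + 1)) :
    a ^^^ b = ((a % 2 ^ m) ^^^ (b % 2 ^ m)) +
      if (2 ^ m ≤ a ↔ 2 ^ m ≤ b) then 0 else 2 ^ m := by
  have hlt : a ^^^ b < 2 ^ (m + 1) := Nat.xor_lt_two_pow ha hb
  rw [← Nat.xor_mod_two_pow]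
  simp only [two_pow_le_iff_testBit ha, two_pow_le_iff_testBit hb]
  have h := two_pow_le_iff_testBit hlt
  rw [Nat.testBit_xor] at h
  have hpos : 0 < 2 ^ m := by positivity
  rw [pow_succ] at hlt
  by_cases hc : 2 ^ m ≤ a ^^^ b
  · have h1 : (a ^^^ b) % 2 ^ m = (a ^^^ b) - 2 ^ m := by
      rw [Nat.mod_eq_sub_mod hc, Nat.mod_eq_of_lt (by omega)]
    rw [h1]
    have h2 := h.mp hc
    rw [if_neg (by revert h2; cases a.testBit m <;> cases b.testBit m <;> simp)]
    omega
  · rw [Nat.mod_eq_of_lt (by omega)]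
    have h2 := mt h.mpr hc
    rw [if_pos (by revert h2; cases a.testBit m <;> cases b.testBit m <;> simp)]
    omega

/-- The orderings in closed form: `τ_i` fixes the even positions, and on odd positions it adds the
binary digits of `i` except the lowest one. -/
theorem tau_eq {k i p : ℕ} (hi : i < 2 ^ k) (hp : p < 2 ^ k) :
    tau k i p = if p % 2 = 0 then p else 2 * ((p / 2) ^^^ (i / 2)) + 1 := by
  induction k generalizing i p with
  | zero =>
    obtain rfl : p = 0 := by omega
    rfl
  | succ k ih =>
    have hpos : 0 < 2 ^ k := by positivity
    rw [tau, ih (Nat.mod_lt _ hpos) (Nat.mod_lt _ hpos)]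
    cases k with
    | zero =>
      have hi2 : i / 2 = 0 := by omega
      have hp2 : p / 2 = 0 := by omega
      have : p = 0 ∨ p = 1 := by omega
      rcases this with rfl | rfl <;> simp [hi2]
    | succ m =>
      have e : 2 ^ (m + 1) = 2 * 2 ^ m := by ring
      have hp2 : p % 2 ^ (m + 1) % 2 = p % 2 := Nat.mod_mod_of_dvd _ ⟨2 ^ m, e⟩
      have hdiv : ∀ q : ℕ, q % 2 ^ (m + 1) / 2 = q / 2 % 2 ^ m := fun q => by
        rw [e, Nat.mod_mul_right_div_self]
      have hmod : ∀ q : ℕ, q < 2 ^ (m + 1 + 1) →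
          q % 2 ^ (m + 1) = if q < 2 ^ (m + 1) then q else q - 2 ^ (m + 1) := fun q hq => by
        split_ifs with h
        · exact Nat.mod_eq_of_lt h
        · rw [Nat.mod_eq_sub_mod (by omega), Nat.mod_eq_of_lt (by rw [pow_succ] at hq; omega)]
      simp only [Nat.even_iff, hp2]
      rcases Nat.mod_two_eq_zero_or_one p with h | h
      · rw [h]
        have := hmod p hp
        simp only [if_true, or_true]
        split_ifs at this ⊢ <;> omega
      · rw [h, hdiv, hdiv]
        rw [pow_succ] at hi hp
        rw [xor_eq_mod_add (m := m) (a := p / 2) (b := i / 2) (by omega) (by omega)]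
        have h1 : 2 ^ m ≤ p / 2 ↔ ¬ p < 2 ^ (m + 1) := by omega
        have h2 : 2 ^ m ≤ i / 2 ↔ ¬ i < 2 ^ (m + 1) := by omega
        rw [if_neg one_ne_zero, if_neg one_ne_zero]
        simp only [h1, h2, one_ne_zero, or_false]
        by_cases h3 : p < 2 ^ (m + 1) <;> by_cases h4 : i < 2 ^ (m + 1) <;> simp [h3, h4] <;> omega

theorem tau_lt {k i p : ℕ} (hi : i < 2 ^ k) (hp : p < 2 ^ k) : tau k i p < 2 ^ k := by
  rw [tau_eq hi hp]
  cases k with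
  | zero => split_ifs <;> omega
  | succ m =>
    rw [pow_succ] at hi hp ⊢
    have : (p / 2) ^^^ (i / 2) < 2 ^ m := Nat.xor_lt_two_pow (by omega) (by omega)
    split_ifs <;> omega

theorem tau_mod_two {k i p : ℕ} (hi : i < 2 ^ k) (hp : p < 2 ^ k) : tau k i p % 2 = p % 2 := by
  rw [tau_eq hi hp]
  split_ifs <;> omega

/-- Every ordering `τ_i` is an involution. In particular it is its own inverse: column `j` is in
position `τ_i^j`. -/
theorem tau_tau {k i p : ℕ} (hi : i < 2 ^ k) (hp : p < 2 ^ k) : tau k i (tau k i p) = p := by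
  rw [tau_eq hi (tau_lt hi hp), tau_mod_two hi hp, tau_eq hi hp]
  split_ifs with h
  · rfl
  · rw [show (2 * (p / 2 ^^^ i / 2) + 1) / 2 = p / 2 ^^^ i / 2 by omega, Nat.xor_assoc,
      Nat.xor_self, Nat.xor_zero]
    omega

theorem tau_zero (k i : ℕ) : tau k i 0 = 0 := by
  induction k generalizing i with
  | zero => rfl
  | succ k ih => simp [tau, ih]

theorem tau_inj {k i p q : ℕ} (hi : i < 2 ^ k) (hp : p < 2 ^ k) (hq : q < 2 ^ k)
    (h : tau k i p = tau k i q) : p = q := by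
  rw [← tau_tau hi hp, h, tau_tau hi hq]

/-- The number of the cycle of column `j` that row `i` uses, where `0, …, n - 1` are the positive
cycles and `n, …, 2n - 1` the negative ones. -/
def cycleIndex (k i j : ℕ) : ℕ := if hadamard k i j = 1 then j else 2 ^ k + j

theorem x_eq (k i j a : ℕ) : x k i j a = 1 + 2 * cycleIndex k i j + a := by
  unfold x cycleIndex v w
  split_ifs <;> ring

theorem cycleIndex_eq_or (k i j : ℕ) :
    cycleIndex k i j = j ∨ (cycleIndex k i j = 2 ^ k + j ∧ j ≠ 0) := by
  unfold cycleIndex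
  split_ifs with h
  · exact Or.inl rfl
  · refine Or.inr ⟨rfl, ?_⟩
    rintro rfl
    exact h (hadamard_zero_right k i)

theorem eq_of_cycleIndex_eq {k i i' j j' : ℕ} (hj : j < 2 ^ k) (hj' : j' < 2 ^ k)
    (h : cycleIndex k i j = cycleIndex k i' j') :
    j = j' ∧ hadamard k i j = hadamard k i' j' := by
  unfold cycleIndex at h
  have h1 := hadamard_eq_one_or k i j
  have h2 := hadamard_eq_one_or k i' j'
  split_ifs at h <;> constructor <;> omega

/-- In an odd column, the entry determines the parity of the row once the other digits of the row
are known. -/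
theorem eq_of_hadamard_eq {k i i' j : ℕ} (hi : i < 2 ^ k) (hi' : i' < 2 ^ k) (hj : j < 2 ^ k)
    (hodd : j % 2 = 1) (h2 : i / 2 = i' / 2) (h : hadamard k i j = hadamard k i' j) : i = i' := by
  rw [hadamard_eq_div_two hi hj, hadamard_eq_div_two hi' hj, h2] at h
  have h1 := hadamard_eq_one_or k (i' / 2) (j / 2)
  have h3 : hadamard k (i' / 2) (j / 2) ≠ 0 := by omega
  have h4 := mul_right_cancel₀ h3 h
  rcases Nat.mod_two_eq_zero_or_one i with h5 | h5 <;>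
    rcases Nat.mod_two_eq_zero_or_one i' with h6 | h6 <;> simp [h5, h6, hodd] at h4 <;> omega

theorem div_two_eq_of_tau_eq {k i i' p : ℕ} (hi : i < 2 ^ k) (hi' : i' < 2 ^ k) (hp : p < 2 ^ k)
    (hodd : p % 2 = 1) (h : tau k i p = tau k i' p) : i / 2 = i' / 2 := by
  rw [tau_eq hi hp, tau_eq hi' hp, if_neg (by omega), if_neg (by omega)] at h
  exact Nat.xor_right_injective (x := p / 2) (by simpa using h)

/-- The reason for the choice of the orderings: no two discs have two consecutive signed columns in
common. Of two consecutive positions one is even, and its column is the position; the column of the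
odd position then determines all digits of the row but the lowest, and the sign in that odd column
determines the lowest. -/
theorem eq_of_consecutive {k i i' p p' : ℕ} (hk : 1 ≤ k) (hi : i < 2 ^ k) (hi' : i' < 2 ^ k)
    (hp : p < 2 ^ k) (hp' : p' < 2 ^ k)
    (h1 : cycleIndex k i (tau k i p) = cycleIndex k i' (tau k i' p'))
    (h2 : cycleIndex k i (tau k i ((p + 1) % 2 ^ k)) =
      cycleIndex k i' (tau k i' ((p' + 1) % 2 ^ k))) : i = i' ∧ p = p' := by
  have hpos : 0 < 2 ^ k := by positivity
  have hs : (p + 1) % 2 ^ k < 2 ^ k := Nat.mod_lt _ hpos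
  have hs' : (p' + 1) % 2 ^ k < 2 ^ k := Nat.mod_lt _ hpos
  obtain ⟨e1, f1⟩ := eq_of_cycleIndex_eq (tau_lt hi hp) (tau_lt hi' hp') h1
  obtain ⟨e2, f2⟩ := eq_of_cycleIndex_eq (tau_lt hi hs) (tau_lt hi' hs') h2
  have hpar : p % 2 = p' % 2 := by rw [← tau_mod_two hi hp, e1, tau_mod_two hi' hp']
  have hdvd : 2 ∣ 2 ^ k := dvd_pow_self 2 (by omega)
  have hmod : ∀ q, q < 2 ^ k → (q + 1) % 2 ^ k = if q + 1 = 2 ^ k then 0 else q + 1 := by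
    intro q hq
    split_ifs with h
    · rw [h, Nat.mod_self]
    · exact Nat.mod_eq_of_lt (by omega)
  have hm := hmod p hp
  have hm' := hmod p' hp'
  rcases Nat.mod_two_eq_zero_or_one p with h | h
  · have hpp : p = p' := by
      rw [tau_eq hi hp, tau_eq hi' hp', if_pos h, if_pos (by omega)] at e1
      exact e1
    subst hpp
    have hodd : (p + 1) % 2 ^ k % 2 = 1 := by split_ifs at hm <;> omega
    refine ⟨eq_of_hadamard_eq hi hi' (tau_lt hi hs) ?_ (div_two_eq_of_tau_eq hi hi' hs hodd e2) ?_,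
      rfl⟩
    · rw [tau_mod_two hi hs, hodd]
    · rw [f2, e2]
  · have hpp : p = p' := by
      rw [tau_eq hi hs, tau_eq hi' hs', if_pos (by split_ifs at hm <;> omega),
        if_pos (by split_ifs at hm' <;> omega)] at e2
      split_ifs at hm hm' <;> omega
    subst hpp
    refine ⟨eq_of_hadamard_eq hi hi' (tau_lt hi hp) ?_ (div_two_eq_of_tau_eq hi hi' hp h e1) ?_,
      rfl⟩
    · rw [tau_mod_two hi hp, h]
    · rw [f1, e1]

end HMT

/-! ### Oriented edges and triangles; homology in degrees `0` and `1` from an edge labelling -/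

namespace PreAbstractSimplicialComplex

variable {V : Type*} {R : Type*} [CommRing R]
  {K : PreAbstractSimplicialComplex V} {M : Type*} [AddCommGroup M] [Module R M]

open Classical in
/-- The chain of a single `d`-face, oriented by the order of the vertices; it is `0` if `t` is not a
`d`-face. -/
noncomputable def faceChain (R : Type*) [CommRing R] (K : PreAbstractSimplicialComplex V) (d : ℕ)
    (t : Finset V) : K.Chain R d :=
  if h : t ∈ K.faces ∧ t.card = d + 1 then Finsupp.single ⟨t, h⟩ 1 else 0

theorem faceChain_val {d : ℕ} (s : K.Simplex d) :
    faceChain R K d s.1 = Finsupp.single s 1 := by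
  rw [faceChain, dif_pos s.2]

theorem nonempty_of_mem_faces {s : Finset V} (hs : s ∈ K.faces) : s.Nonempty :=
  (K.isRelLowerSet_faces hs).1

theorem singleton_mem_faces {s : Finset V} (hs : s ∈ K.faces) {a : V} (ha : a ∈ s) :
    {a} ∈ K.faces :=
  (K.isRelLowerSet_faces hs).2 (Finset.singleton_subset_iff.mpr ha) (Finset.singleton_nonempty a)

theorem chain_mem_of_faceChain_mem {d : ℕ} (N : Submodule R (K.Chain R d))
    (h : ∀ t ∈ K.faces, t.card = d + 1 → faceChain R K d t ∈ N) (z : K.Chain R d) : z ∈ N := by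
  induction z using Finsupp.induction_linear with
  | zero => exact N.zero_mem
  | add y z hy hz => exact N.add_mem hy hz
  | single s r =>
    rw [← mul_one r, ← smul_eq_mul, ← Finsupp.smul_single, ← faceChain_val]
    exact N.smul_mem r (h _ s.2.1 s.2.2)

variable [LinearOrder V]

theorem boundary_faceChain {d : ℕ} {t : Finset V} (ht : t ∈ K.faces) (hc : t.card = d + 1 + 1) :
    K.boundary R d (faceChain R K (d + 1) t) =
      ∑ u ∈ t, (-1 : R) ^ (t.filter (· < u)).card • faceChain R K d (t.erase u) := by
  rw [faceChain_val ⟨t, ht, hc⟩, boundary, Finsupp.linearCombination_single, one_smul,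
    ← Finset.sum_coe_sort t]
  refine Finset.sum_congr rfl fun u _ => ?_
  have := faceChain_val (R := R) (Simplex.opposite ⟨t, ht, hc⟩ u.1 u.2)
  simp only [Simplex.opposite] at this
  rw [this, Finsupp.smul_single, smul_eq_mul, mul_one]
  rfl

/-- The chain of the edge from `a` to `b`. -/
noncomputable def edge (R : Type*) [CommRing R] (K : PreAbstractSimplicialComplex V) (a b : V) :
    K.Chain R 1 :=
  if a < b then faceChain R K 1 {a, b} else if b < a then -faceChain R K 1 {a, b} else 0

theorem edge_swap (a b : V) : edge R K b a = -edge R K a b := by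
  unfold edge
  rw [Finset.pair_comm b a]
  rcases lt_trichotomy a b with h | h | h
  · rw [if_neg h.not_gt, if_pos h, if_pos h]
  · subst h; simp
  · rw [if_pos h, if_neg h.not_gt, if_pos h, neg_neg]

theorem faceChain_pair_eq {a b : V} (h : a ≠ b) :
    faceChain R K 1 {a, b} = edge R K a b ∨ faceChain R K 1 {a, b} = -edge R K a b := by
  unfold edge
  rcases lt_or_gt_of_ne h with h | h
  · rw [if_pos h]; exact Or.inl rfl
  · rw [if_neg h.not_gt, if_pos h, neg_neg]; exact Or.inr rfl

theorem boundary_edge {a b : V} (hab : a ≠ b) (h : {a, b} ∈ K.faces) :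
    K.boundary R 0 (edge R K a b) = faceChain R K 0 {b} - faceChain R K 0 {a} := by
  wlog hlt : a < b generalizing a b
  · rw [← neg_inj, ← map_neg, ← edge_swap, this hab.symm (by rwa [Finset.pair_comm])
      (lt_of_le_of_ne (not_lt.mp hlt) hab.symm), neg_sub]
  have e1 : ({a, b} : Finset V).filter (· < a) = ∅ := by
    simp [Finset.filter_insert, Finset.filter_singleton, hlt.not_gt]
  have e2 : ({a, b} : Finset V).filter (· < b) = {a} := by
    simp [Finset.filter_insert, Finset.filter_singleton, hlt]
  have e3 : ({a, b} : Finset V).erase a = {b} := by simp [hab]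
  have e4 : ({a, b} : Finset V).erase b = {a} := by
    rw [Finset.pair_comm]; simp [hab.symm]
  rw [edge, if_pos hlt, boundary_faceChain h (Finset.card_pair hab), Finset.sum_pair hab, e1, e2,
    e3, e4]
  simp [sub_eq_add_neg]

/-- The boundary cycle `a → b → c → a`. -/
noncomputable def triangleCycle (R : Type*) [CommRing R] (K : PreAbstractSimplicialComplex V)
    (a b c : V) : K.Chain R 1 :=
  edge R K a b + edge R K b c + edge R K c a

theorem triangleCycle_rotate (a b c : V) : triangleCycle R K b c a = triangleCycle R K a b c := by
  unfold triangleCycle; abel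

theorem triangleCycle_swap (a b c : V) : triangleCycle R K b a c = -triangleCycle R K a b c := by
  unfold triangleCycle
  rw [edge_swap a b, edge_swap c a, edge_swap b c]; abel

theorem boundary_faceChain_triple_of_lt {a b c : V} (hab : a < b) (hbc : b < c)
    (h : {a, b, c} ∈ K.faces) :
    K.boundary R 1 (faceChain R K 2 {a, b, c}) = triangleCycle R K a b c := by
  have hac := hab.trans hbc
  have e1 : ({a, b, c} : Finset V).filter (· < a) = ∅ := by
    simp [Finset.filter_insert, Finset.filter_singleton, hab.not_gt, hac.not_gt]
  have e2 : ({a, b, c} : Finset V).filter (· < b) = {a} := by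
    simp [Finset.filter_insert, Finset.filter_singleton, hab, hbc.not_gt]
  have e3 : ({a, b, c} : Finset V).filter (· < c) = {a, b} := by
    simp [Finset.filter_insert, Finset.filter_singleton, hac, hbc]
  have e4 : ({a, b, c} : Finset V).erase a = {b, c} := by
    rw [Finset.erase_insert]; simp [hab.ne, hac.ne]
  have e5 : ({a, b, c} : Finset V).erase b = {a, c} := by
    rw [Finset.insert_comm, Finset.erase_insert]; simp [hab.ne', hbc.ne]
  have e6 : ({a, b, c} : Finset V).erase c = {a, b} := by
    rw [show ({a, b, c} : Finset V) = {c, a, b} by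
      rw [Finset.insert_comm c a, Finset.pair_comm c b], Finset.erase_insert]
    simp [hac.ne', hbc.ne']
  rw [boundary_faceChain h (by rw [Finset.card_eq_three]; exact ⟨a, b, c, hab.ne, hac.ne, hbc.ne,
    rfl⟩), Finset.sum_insert (by simp [hab.ne, hac.ne]), Finset.sum_pair hbc.ne, e1, e2, e3, e4, e5,
    e6, Finset.card_empty, Finset.card_singleton, Finset.card_pair hab.ne, triangleCycle,
    edge_swap a c, edge, edge, edge, if_pos hab, if_pos hbc, if_pos hac]
  simp only [pow_zero, one_smul, pow_one, neg_smul, even_two, Even.neg_pow, one_pow]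
  abel

theorem boundary_faceChain_triple {a b c : V} (hab : a ≠ b) (hac : a ≠ c) (hbc : b ≠ c)
    (h : {a, b, c} ∈ K.faces) :
    K.boundary R 1 (faceChain R K 2 {a, b, c}) = triangleCycle R K a b c ∨
      K.boundary R 1 (faceChain R K 2 {a, b, c}) = -triangleCycle R K a b c := by
  have s1 : ({a, b, c} : Finset V) = {b, c, a} := by ext; simp; tauto
  have s2 : ({a, b, c} : Finset V) = {c, a, b} := by ext; simp; tauto
  have s3 : ({a, b, c} : Finset V) = {b, a, c} := by ext; simp; tauto
  have s4 : ({a, b, c} : Finset V) = {a, c, b} := by ext; simp; tauto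
  have s5 : ({a, b, c} : Finset V) = {c, b, a} := by ext; simp; tauto
  rcases lt_or_gt_of_ne hab with h1 | h1 <;> rcases lt_or_gt_of_ne hac with h2 | h2 <;>
    rcases lt_or_gt_of_ne hbc with h3 | h3
  · exact Or.inl (boundary_faceChain_triple_of_lt h1 h3 h)
  · right
    rw [s4, boundary_faceChain_triple_of_lt h2 h3 (s4 ▸ h), ← triangleCycle_swap,
      triangleCycle_rotate b a c]
  · exact absurd (h1.trans h3) h2.not_gt
  · left
    rw [s2, boundary_faceChain_triple_of_lt h2 h1 (s2 ▸ h), ← triangleCycle_rotate c a b]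
  · right
    rw [s3, boundary_faceChain_triple_of_lt h1 h2 (s3 ▸ h), triangleCycle_swap]
  · exact absurd (h3.trans h1) h2.not_gt
  · left
    rw [s1, boundary_faceChain_triple_of_lt h3 h2 (s1 ▸ h), triangleCycle_rotate]
  · right
    rw [s5, boundary_faceChain_triple_of_lt h3 h1 (s5 ▸ h), ← triangleCycle_swap,
      ← triangleCycle_rotate c b a]

theorem triangleCycle_mem_range {a b c : V} (hab : a ≠ b) (hac : a ≠ c) (hbc : b ≠ c)
    (h : {a, b, c} ∈ K.faces) : triangleCycle R K a b c ∈ LinearMap.range (K.boundary R 1) := by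
  rcases boundary_faceChain_triple (R := R) hab hac hbc h with h1 | h1
  · exact ⟨_, h1⟩
  · exact ⟨-faceChain R K 2 {a, b, c}, by rw [map_neg, h1, neg_neg]⟩

/-- The linear extension to `1`-chains of a labelling of the oriented edges. -/
noncomputable def labelMap (K : PreAbstractSimplicialComplex V) (l : V → V → M) :
    K.Chain R 1 →ₗ[R] M :=
  Finsupp.linearCombination R fun s : K.Simplex 1 =>
    l (s.1.min' (nonempty_of_mem_faces s.2.1)) (s.1.max' (nonempty_of_mem_faces s.2.1))

theorem labelMap_edge {l : V → V → M} (hl : ∀ a b, l b a = -l a b) {a b : V} (hab : a ≠ b)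
    (h : {a, b} ∈ K.faces) : labelMap K l (edge R K a b) = l a b := by
  wlog hlt : a < b generalizing a b
  · rw [← neg_inj, ← map_neg, ← edge_swap, this hab.symm (by rwa [Finset.pair_comm])
      (lt_of_le_of_ne (not_lt.mp hlt) hab.symm), hl]
  have e := faceChain_val (R := R) (⟨{a, b}, h, Finset.card_pair hab⟩ : K.Simplex 1)
  dsimp only at e
  rw [edge, if_pos hlt, e, labelMap, Finsupp.linearCombination_single, one_smul]
  congr 1
  · exact le_antisymm (Finset.min'_le _ _ (by simp)) (by simp [hlt.le])
  · exact le_antisymm (by simp [hlt.le]) (Finset.le_max' _ _ (by simp))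

/-- The linear extension to `0`-chains of a labelling of the vertices. -/
noncomputable def vertexMap (K : PreAbstractSimplicialComplex V) (f : V → M) :
    K.Chain R 0 →ₗ[R] M :=
  Finsupp.linearCombination R fun s : K.Simplex 0 => f (s.1.min' (nonempty_of_mem_faces s.2.1))

theorem vertexMap_faceChain (f : V → M) {a : V} (h : {a} ∈ K.faces) :
    vertexMap K f (faceChain R K 0 {a}) = f a := by
  have e := faceChain_val (R := R) (⟨{a}, h, Finset.card_singleton a⟩ : K.Simplex 0)
  dsimp only at e
  rw [e, vertexMap, Finsupp.linearCombination_single, one_smul, Finset.min'_singleton]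

/-- Chains that join every vertex to a base vertex `o` make `H_0` free of rank one. -/
theorem nonempty_homology_zero_equiv (o : V) (ho : {o} ∈ K.faces) (path : V → K.Chain R 1)
    (hpath : ∀ a, {a} ∈ K.faces →
      K.boundary R 0 (path a) = faceChain R K 0 {a} - faceChain R K 0 {o}) :
    Nonempty (K.Homology R 0 ≃ₗ[R] R) := by
  let ε : K.cycles R 0 →ₗ[R] R := (vertexMap K fun _ => (1 : R)).comp (K.cycles R 0).subtype
  have hsurj : Function.Surjective ε := fun r =>
    ⟨⟨r • faceChain R K 0 {o}, Submodule.mem_top⟩, by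
      simp [ε, vertexMap_faceChain _ ho]⟩
  have hker : (LinearMap.range (K.boundary R 0)).submoduleOf (K.cycles R 0) =
      LinearMap.ker ε := by
    ext ⟨z, hz⟩
    rw [LinearMap.mem_ker]
    change z ∈ LinearMap.range (K.boundary R 0) ↔ vertexMap K (fun _ => (1 : R)) z = 0
    constructor
    · rintro ⟨y, rfl⟩
      have := chain_mem_of_faceChain_mem (LinearMap.ker ((vertexMap K fun _ => (1 : R)).comp
        (K.boundary R 0))) ?_ y
      · exact this
      · intro t ht hc
        obtain ⟨a, b, hab, rfl⟩ := Finset.card_eq_two.mp hc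
        have hz : vertexMap K (fun _ => (1 : R)) (K.boundary R 0 (edge R K a b)) = 0 := by
          rw [boundary_edge hab ht, map_sub,
            vertexMap_faceChain _ (singleton_mem_faces ht (by simp)),
            vertexMap_faceChain _ (singleton_mem_faces ht (by simp)), sub_self]
        rw [LinearMap.mem_ker, LinearMap.comp_apply]
        rcases faceChain_pair_eq (R := R) (K := K) hab with h | h <;> rw [h]
        · exact hz
        · rw [map_neg, map_neg, hz, neg_zero]
    · intro h
      -- The vertex `a` goes to `a - o`, the boundary of `path a`; a chain with sum `0` is fixed.
      let T : K.Chain R 0 →ₗ[R] K.Chain R 0 := LinearMap.id -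
        (LinearMap.toSpanSingleton R _ (faceChain R K 0 {o})).comp (vertexMap K fun _ => (1 : R))
      have := chain_mem_of_faceChain_mem ((LinearMap.range (K.boundary R 0)).comap T) ?_ z
      · simpa [T, h] using this
      · intro t ht hc
        obtain ⟨a, rfl⟩ := Finset.card_eq_one.mp hc
        refine ⟨path a, ?_⟩
        rw [hpath a ht]
        simp [T, vertexMap_faceChain _ ht]
  exact ⟨(Submodule.quotEquivOfEq _ _ hker).trans (ε.quotKerEquivOfSurjective hsurj)⟩

/-- Let `path a` be a chain for every vertex `a` (in the applications from a base vertex to `a`).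
Suppose that `G` realizes the elements of a module `M` by `1`-cycles, that a labelling `l` of the
oriented edges by elements of `M` extends to a left inverse of `G`, and that every edge from `a` to
`b` is homologous to `path b - path a + G (l a b)`. Then `H_1` is the quotient of `M` by the labels
of the boundaries. -/
theorem nonempty_homology_one_equiv (path : V → K.Chain R 1)
    (l : V → V → M) (hl : ∀ a b, l b a = -l a b) (G : M →ₗ[R] K.Chain R 1)
    (hG : ∀ m, K.boundary R 0 (G m) = 0) (hlG : ∀ m, labelMap K l (G m) = m)
    (hedge : ∀ a b, a ≠ b → {a, b} ∈ K.faces →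
      edge R K a b - (path b - path a) - G (l a b) ∈ LinearMap.range (K.boundary R 1)) :
    Nonempty (K.Homology R 1 ≃ₗ[R]
      M ⧸ (LinearMap.range (K.boundary R 1)).map (labelMap K l)) := by
  set B := LinearMap.range (K.boundary R 1)
  let h : K.Chain R 0 →ₗ[R] K.Chain R 1 := vertexMap K path
  -- `T` extends the chains in `hedge` linearly; on a cycle `z` it is `z - G (labelMap K l z)`.
  let T : K.Chain R 1 →ₗ[R] K.Chain R 1 :=
    LinearMap.id - h.comp (K.boundary R 0) - G.comp (labelMap K l)
  have hT : ∀ z, T z ∈ B := by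
    refine chain_mem_of_faceChain_mem (B.comap T) fun t ht hc => ?_
    obtain ⟨a, b, hab, rfl⟩ := Finset.card_eq_two.mp hc
    have key : T (edge R K a b) ∈ B := by
      have e : T (edge R K a b) = edge R K a b - (path b - path a) - G (l a b) := by
        simp only [T, LinearMap.sub_apply, LinearMap.id_apply, LinearMap.comp_apply,
          boundary_edge hab ht, labelMap_edge hl hab ht, map_sub, h]
        rw [vertexMap_faceChain _ (singleton_mem_faces ht (by simp)),
          vertexMap_faceChain _ (singleton_mem_faces ht (by simp))]
      rw [e]
      exact hedge a b hab ht
    rw [Submodule.mem_comap]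
    rcases faceChain_pair_eq (R := R) (K := K) hab with h | h <;> rw [h]
    · exact key
    · rw [map_neg]; exact B.neg_mem key
  have hcyc : ∀ z ∈ K.cycles R 1, z - G (labelMap K l z) ∈ B := by
    intro z hz
    have hz0 : K.boundary R 0 z = 0 := hz
    simpa [T, hz0] using hT z
  let q : K.cycles R 1 →ₗ[R] M ⧸ B.map (labelMap K l) :=
    ((B.map (labelMap K l)).mkQ.comp (labelMap K l)).comp (K.cycles R 1).subtype
  have hsurj : Function.Surjective q := by
    intro m
    obtain ⟨m, rfl⟩ := Submodule.mkQ_surjective _ m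
    exact ⟨⟨G m, hG m⟩, by simp [q, hlG]⟩
  have hker : B.submoduleOf (K.cycles R 1) = LinearMap.ker q := by
    ext ⟨z, hz⟩
    rw [LinearMap.mem_ker]
    change z ∈ B ↔ (B.map (labelMap K l)).mkQ (labelMap K l z) = 0
    rw [Submodule.mkQ_apply, Submodule.Quotient.mk_eq_zero]
    constructor
    · exact fun h => ⟨z, h, rfl⟩
    · rintro ⟨y, hy, hyz⟩
      have h1 := hcyc z hz
      rw [← hyz] at h1
      have h2 := hcyc y (K.range_boundary_le_cycles R 1 hy)
      have h3 := B.sub_mem hy h2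
      rw [sub_sub_cancel] at h3
      simpa using B.add_mem h1 h3
  exact ⟨(Submodule.quotEquivOfEq _ _ hker).trans (q.quotKerEquivOfSurjective hsurj)⟩

end PreAbstractSimplicialComplex

/-! ### The faces of `HMT(n)` -/

namespace HMT

theorem w_eq (k j a : ℕ) : w k j a = v (2 ^ k + j) a := by unfold w v; ring

theorem x_eq_v (k i j a : ℕ) : x k i j a = v (cycleIndex k i j) a := by
  rw [x_eq, v]

theorem cycleIndex_lt {k j : ℕ} (i : ℕ) (hj : j < 2 ^ k) : cycleIndex k i j < 2 * 2 ^ k := by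
  rcases cycleIndex_eq_or k i j with h | h <;> omega

theorem cycleIndex_ne (k i : ℕ) {j : ℕ} (hj : j < 2 ^ k) : cycleIndex k i j ≠ 2 ^ k := by
  rcases cycleIndex_eq_or k i j with h | h <;> omega

theorem cycleIndex_mod {k j : ℕ} (i : ℕ) (hj : j < 2 ^ k) : cycleIndex k i j % 2 ^ k = j := by
  rcases cycleIndex_eq_or k i j with h | h
  · rw [h, Nat.mod_eq_of_lt hj]
  · rw [h.1, Nat.add_mod_left, Nat.mod_eq_of_lt hj]

theorem cycleIndex_zero_left (k j : ℕ) : cycleIndex k 0 j = j := by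
  rw [cycleIndex, if_pos (hadamard_zero_left k j)]

theorem cycleIndex_zero_right (k i : ℕ) : cycleIndex k i 0 = 0 := by
  rw [cycleIndex, if_pos (hadamard_zero_right k i)]

/-- Membership in the set of triangles, with all cycles numbered as in `cycleIndex`. -/
theorem mem_triangles_iff {k : ℕ} {t : Finset ℕ} : t ∈ triangles k ↔
    (∃ i < 2 ^ k, ∃ p < 2 ^ k,
      t = {0, v (cycleIndex k i (tau k i p)) 1,
        v (cycleIndex k i (tau k i ((p + 1) % 2 ^ k))) 0} ∨
      t = {c k i, v (cycleIndex k i (tau k i p)) 0, v (cycleIndex k i (tau k i p)) 1} ∨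
      t = {c k i, v (cycleIndex k i (tau k i p)) 1,
        v (cycleIndex k i (tau k i ((p + 1) % 2 ^ k))) 0}) ∨
    ∃ j, 1 ≤ j ∧ j < 2 ^ k ∧
      (t = {0, v j 0, v (2 ^ k + j) 1} ∨ t = {v j 0, v j 1, v (2 ^ k + j) 1} ∨
        t = {v j 1, v (2 ^ k + j) 0, v (2 ^ k + j) 1} ∨ t = {0, v j 1, v (2 ^ k + j) 0}) := by
  simp only [triangles, discTriangles, digonTriangles, Set.mem_ofPred_eq, Set.mem_insert_iff,
    Set.mem_singleton_iff, x_eq_v, w_eq]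

theorem mem_faces_of_subset {k : ℕ} {s t : Finset ℕ} (ht : t ∈ triangles k) (hs : s.Nonempty)
    (h : s ⊆ t) : s ∈ (complex k).faces := ⟨hs, t, ht, h⟩

theorem rim_mem {k i p : ℕ} (hi : i < 2 ^ k) (hp : p < 2 ^ k) :
    {0, v (cycleIndex k i (tau k i p)) 1, v (cycleIndex k i (tau k i ((p + 1) % 2 ^ k))) 0} ∈
      triangles k :=
  mem_triangles_iff.mpr (Or.inl ⟨i, hi, p, hp, Or.inl rfl⟩)

theorem spoke_mem {k i p : ℕ} (hi : i < 2 ^ k) (hp : p < 2 ^ k) :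
    {c k i, v (cycleIndex k i (tau k i p)) 0, v (cycleIndex k i (tau k i p)) 1} ∈
      triangles k :=
  mem_triangles_iff.mpr (Or.inl ⟨i, hi, p, hp, Or.inr (Or.inl rfl)⟩)

theorem spoke_mem' {k i p : ℕ} (hi : i < 2 ^ k) (hp : p < 2 ^ k) :
    {c k i, v (cycleIndex k i (tau k i p)) 1, v (cycleIndex k i (tau k i ((p + 1) % 2 ^ k))) 0} ∈
      triangles k :=
  mem_triangles_iff.mpr (Or.inl ⟨i, hi, p, hp, Or.inr (Or.inr rfl)⟩)

theorem digon_mem {k j : ℕ} (h1 : 1 ≤ j) (hj : j < 2 ^ k) :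
    {0, v j 0, v (2 ^ k + j) 1} ∈ triangles k ∧ {v j 0, v j 1, v (2 ^ k + j) 1} ∈ triangles k ∧
      {v j 1, v (2 ^ k + j) 0, v (2 ^ k + j) 1} ∈ triangles k ∧
        {0, v j 1, v (2 ^ k + j) 0} ∈ triangles k :=
  ⟨mem_triangles_iff.mpr (Or.inr ⟨j, h1, hj, by tauto⟩),
    mem_triangles_iff.mpr (Or.inr ⟨j, h1, hj, by tauto⟩),
    mem_triangles_iff.mpr (Or.inr ⟨j, h1, hj, by tauto⟩),
    mem_triangles_iff.mpr (Or.inr ⟨j, h1, hj, by tauto⟩)⟩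

/-- The three edges of every cycle are faces, except for the unused negative cycle of column `0`,
which has the number `2 ^ k`. -/
theorem cycle_edges_mem {k u : ℕ} (hu : u < 2 * 2 ^ k) (hn : u ≠ 2 ^ k) :
    {0, v u 0} ∈ (complex k).faces ∧ {0, v u 1} ∈ (complex k).faces ∧
      {v u 0, v u 1} ∈ (complex k).faces := by
  have hpos : 0 < 2 ^ k := by positivity
  by_cases h : u < 2 ^ k
  · have e : tau k 0 (tau k 0 u) = u := tau_tau hpos h
    have h3 := spoke_mem (k := k) (i := 0) hpos (tau_lt hpos h)
    rw [e, cycleIndex_zero_left] at h3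
    have h2 := rim_mem (k := k) (i := 0) hpos (tau_lt hpos h)
    rw [e, cycleIndex_zero_left] at h2
    refine ⟨?_, mem_faces_of_subset h2 (by simp) (by simp [Finset.insert_subset_iff]),
      mem_faces_of_subset h3 (by simp) (by simp)⟩
    rcases Nat.eq_zero_or_pos u with rfl | h0
    · have h1 := rim_mem (k := k) (i := 0) (p := 2 ^ k - 1) hpos (by omega)
      rw [Nat.sub_add_cancel hpos, Nat.mod_self, tau_zero, cycleIndex_zero_right] at h1
      exact mem_faces_of_subset h1 (by simp) (by simp [Finset.insert_subset_iff])
    · exact mem_faces_of_subset (digon_mem h0 h).1 (by simp) (by simp [Finset.insert_subset_iff])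
  · obtain ⟨j, rfl⟩ := Nat.exists_eq_add_of_le (not_lt.mp h)
    obtain ⟨d1, d2, d3, d4⟩ := digon_mem (k := k) (j := j) (by omega) (by omega)
    exact ⟨mem_faces_of_subset d4 (by simp) (by simp [Finset.insert_subset_iff]),
      mem_faces_of_subset d1 (by simp) (by simp [Finset.insert_subset_iff]),
      mem_faces_of_subset d3 (by simp) (by simp)⟩

theorem spoke_zero_mem {k i : ℕ} (hi : i < 2 ^ k) : {v 0 0, c k i} ∈ (complex k).faces := by
  have h := spoke_mem (k := k) (i := i) (p := 0) hi (by positivity)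
  rw [tau_zero, cycleIndex_zero_right] at h
  exact mem_faces_of_subset h (by simp) (by simp [Finset.insert_subset_iff])

theorem card_le_of_mem_triangles {k : ℕ} {t : Finset ℕ} (ht : t ∈ triangles k) : t.card ≤ 3 := by
  rcases mem_triangles_iff.mp ht with
    ⟨i, -, p, -, rfl | rfl | rfl⟩ | ⟨j, -, -, rfl | rfl | rfl | rfl⟩ <;>
  exact Finset.card_le_three

theorem mem_triangles_of_card {k : ℕ} {t : Finset ℕ} (ht : t ∈ (complex k).faces)
    (hc : t.card = 3) : t ∈ triangles k := by
  obtain ⟨-, t', ht', h⟩ := ht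
  rwa [Finset.eq_of_subset_of_card_le h (by rw [hc]; exact card_le_of_mem_triangles ht')]

theorem succ_mod_eq {n p : ℕ} (hp : p < n) :
    (p + 1) % n = if p + 1 = n then 0 else p + 1 := by
  split_ifs with h
  · rw [h, Nat.mod_self]
  · exact Nat.mod_eq_of_lt (by omega)

theorem cycleIndex_ne_succ {k i p : ℕ} (hk : 1 ≤ k) (hi : i < 2 ^ k) (hp : p < 2 ^ k) :
    cycleIndex k i (tau k i p) ≠ cycleIndex k i (tau k i ((p + 1) % 2 ^ k)) := by
  intro h
  have hpos : 0 < 2 ^ k := by positivity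
  have hs : (p + 1) % 2 ^ k < 2 ^ k := Nat.mod_lt _ hpos
  have h2 := tau_inj hi hp hs (eq_of_cycleIndex_eq (tau_lt hi hp) (tau_lt hi hs) h).1
  have h3 : 2 ^ 1 ≤ 2 ^ k := Nat.pow_le_pow_right (by norm_num) hk
  rw [succ_mod_eq hp] at h2
  split_ifs at h2 <;> omega

/-! ### The labelling of the edges by integer vectors -/

/-- The entry in column `l` of the label of the edge from `a` to `b`, for one of the two
orientations of every edge; for the other orientation, and for all edges not listed here, it is `0`.
The edges opposite to the base vertex in the positive and in the negative cycle of column `j` get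
`e_j` and `-e_j`. The edge `v_j^2 w_j^2` gets `-e_j`, which makes the labels around each triangle of
the digon add up to `0`. The edge from the centre of row `i` to a vertex `b` of its disc gets the
sum of the labels that one collects on the boundary of the disc from `v_1^1` up to `b`: the entries
of the row in the columns that come before `b`. Positions and columns are compared through `τ_i`
alone because it is an involution. -/
def preLabel (k a b l : ℕ) : ℤ :=
  if 4 * 2 ^ k < a then
    if 0 < b ∧ b ≤ 4 * 2 ^ k ∧
      tau k (a - 1 - 4 * 2 ^ k) l < tau k (a - 1 - 4 * 2 ^ k) ((b - 1) / 2 % 2 ^ k) + (b - 1) % 2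
    then hadamard k (a - 1 - 4 * 2 ^ k) l else 0
  else if b = a + 1 ∧ a % 2 = 1 ∧ a / 2 % 2 ^ k = l then (if a ≤ 2 * 2 ^ k then 1 else -1)
  else if b = a + 2 * 2 ^ k ∧ a % 2 = 0 ∧ 0 < a ∧ a / 2 = l + 1 ∧ a ≤ 2 * 2 ^ k then -1
  else 0

/-- The label of the oriented edge from `a` to `b`. -/
def label (R : Type*) [CommRing R] (k a b : ℕ) : Fin (2 ^ k) → R :=
  fun l => ((preLabel k a b l - preLabel k b a l : ℤ) : R)

variable {R : Type*} [CommRing R]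

theorem label_swap (k a b : ℕ) : label R k b a = -label R k a b := by
  funext l
  simp [label]

theorem label_zero_left {k u a : ℕ} (hu : u < 2 * 2 ^ k) (ha : a ≤ 1) :
    label R k 0 (v u a) = 0 := by
  funext l
  have h1 : preLabel k 0 (v u a) l = 0 := by
    simp [preLabel]
  have h2 : preLabel k (v u a) 0 l = 0 := by
    unfold v preLabel
    rw [if_neg (by omega), if_neg (by omega), if_neg (by omega)]
  simp [label, h1, h2]

theorem label_cycle {k u : ℕ} (hu : u < 2 * 2 ^ k) (l : Fin (2 ^ k)) :
    label R k (v u 0) (v u 1) l =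
      if u % 2 ^ k = l then (if u < 2 ^ k then 1 else -1) else 0 := by
  have h1 : preLabel k (v u 1) (v u 0) l = 0 := by
    unfold v preLabel
    rw [if_neg (by omega), if_neg (by omega), if_neg (by omega)]
  have h2 : preLabel k (v u 0) (v u 1) l =
      if u % 2 ^ k = l then (if u < 2 ^ k then 1 else -1) else 0 := by
    have e : (1 + 2 * u + 0) / 2 = u := by omega
    unfold v preLabel
    rw [if_neg (by omega), e]
    by_cases h : u % 2 ^ k = l
    · rw [if_pos ⟨by omega, by omega, h⟩, if_pos h]
      by_cases h3 : u < 2 ^ k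
      · rw [if_pos h3, if_pos (by omega)]
      · rw [if_neg h3, if_neg (by omega)]
    · rw [if_neg (fun h' => h h'.2.2), if_neg h, if_neg (by omega)]
  rw [label, h1, h2]
  split_ifs <;> simp

theorem label_rim {k u u' : ℕ} (hu : u < 2 * 2 ^ k) (hu' : u' < 2 * 2 ^ k) (h : u ≠ u') :
    label R k (v u 1) (v u' 0) = 0 := by
  funext l
  have h1 : preLabel k (v u 1) (v u' 0) l = 0 := by
    unfold v preLabel
    rw [if_neg (by omega), if_neg (by omega), if_neg (by omega)]
  have h2 : preLabel k (v u' 0) (v u 1) l = 0 := by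
    unfold v preLabel
    rw [if_neg (by omega), if_neg (by omega), if_neg (by omega)]
  simp [label, h1, h2]

theorem label_digon {k j : ℕ} (hj : j < 2 ^ k) :
    label R k (v j 0) (v (2 ^ k + j) 1) = 0 := by
  funext l
  have h1 : preLabel k (v j 0) (v (2 ^ k + j) 1) l = 0 := by
    unfold v preLabel
    rw [if_neg (by omega), if_neg (by omega), if_neg (by omega)]
  have h2 : preLabel k (v (2 ^ k + j) 1) (v j 0) l = 0 := by
    unfold v preLabel
    rw [if_neg (by omega), if_neg (by omega), if_neg (by omega)]
  simp [label, h1, h2]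

theorem label_digon' {k j : ℕ} (hj : j < 2 ^ k) (l : Fin (2 ^ k)) :
    label R k (v j 1) (v (2 ^ k + j) 1) l = if j = l then -1 else 0 := by
  have h1 : preLabel k (v (2 ^ k + j) 1) (v j 1) l = 0 := by
    unfold v preLabel
    rw [if_neg (by omega), if_neg (by omega), if_neg (by omega)]
  have h2 : preLabel k (v j 1) (v (2 ^ k + j) 1) l = if j = l then -1 else 0 := by
    unfold v preLabel
    rw [if_neg (by omega), if_neg (by omega)]
    by_cases h : j = l
    · rw [if_pos h, if_pos (by omega)]
    · rw [if_neg h, if_neg (by omega)]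
  rw [label, h1, h2]
  split_ifs <;> simp

theorem label_spoke {k i j a : ℕ} (hj : j < 2 ^ k) (ha : a ≤ 1)
    (l : Fin (2 ^ k)) :
    label R k (c k i) (v (cycleIndex k i j) a) l =
      if tau k i l < tau k i j + a then (hadamard k i l : R) else 0 := by
  have hu := cycleIndex_lt i hj
  have hm := cycleIndex_mod i hj
  generalize cycleIndex k i j = u at hu hm ⊢
  have h1 : preLabel k (v u a) (c k i) l = 0 := by
    unfold v c preLabel
    rw [if_neg (by omega), if_neg (by omega), if_neg (by omega)]
  have h2 : preLabel k (c k i) (v u a) l =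
      if tau k i l < tau k i j + a then hadamard k i l else 0 := by
    have e1 : 1 + 4 * 2 ^ k + i - 1 - 4 * 2 ^ k = i := by omega
    have e2 : (1 + 2 * u + a - 1) / 2 = u := by omega
    have e3 : (1 + 2 * u + a - 1) % 2 = a := by omega
    unfold v c preLabel
    rw [if_pos (by omega), e1, e2, e3, hm]
    by_cases h : tau k i l < tau k i j + a
    · rw [if_pos h, if_pos ⟨by omega, by omega, h⟩]
    · rw [if_neg h, if_neg (fun h' => h h'.2.2)]
  rw [label, h1, h2]
  split_ifs <;> simp

/-- The `i`-th row of the Hadamard matrix. -/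
def row (R : Type*) [CommRing R] (k : ℕ) (i : Fin (2 ^ k)) : Fin (2 ^ k) → R :=
  fun l => (hadamard k i l : R)

theorem label_triangle_spoke {k i p : ℕ} (hi : i < 2 ^ k) (hp : p < 2 ^ k) :
    label R k (c k i) (v (cycleIndex k i (tau k i p)) 0) +
      label R k (v (cycleIndex k i (tau k i p)) 0) (v (cycleIndex k i (tau k i p)) 1) +
      label R k (v (cycleIndex k i (tau k i p)) 1) (c k i) = 0 := by
  have ht := tau_lt hi hp
  funext l
  rw [label_swap k (c k i)]
  simp only [Pi.add_apply, Pi.neg_apply, Pi.zero_apply]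
  rw [label_spoke ht zero_le_one, label_spoke ht le_rfl, label_cycle (cycleIndex_lt i ht),
    cycleIndex_mod i ht, tau_tau hi hp]
  by_cases h : tau k i p = l
  · have hl : tau k i l = p := by rw [← h, tau_tau hi hp]
    rw [if_neg (by omega), if_pos h, if_pos (show tau k i l < p + 1 by omega), cycleIndex, h]
    rcases hadamard_eq_one_or k i l with h1 | h1 <;> simp [h1]
  · have hl : tau k i l ≠ p := fun h' => h (by rw [← h', tau_tau hi l.2])
    rw [if_neg h]
    by_cases h2 : tau k i l < p
    · rw [if_pos (by omega), if_pos (by omega)]; ring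
    · rw [if_neg (by omega), if_neg (by omega)]; ring

/-- The second triangle at the centre of row `i` has label `0`, except that the last one closes the
disc and has the label of the whole boundary of the disc, which is row `i`. -/
theorem label_triangle_spoke' {k i p : ℕ} (hk : 1 ≤ k) (hi : i < 2 ^ k) (hp : p < 2 ^ k) :
    label R k (c k i) (v (cycleIndex k i (tau k i p)) 1) +
      label R k (v (cycleIndex k i (tau k i p)) 1)
        (v (cycleIndex k i (tau k i ((p + 1) % 2 ^ k))) 0) +
      label R k (v (cycleIndex k i (tau k i ((p + 1) % 2 ^ k))) 0) (c k i) =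
    if p + 1 = 2 ^ k then row R k ⟨i, hi⟩ else 0 := by
  have ht := tau_lt hi hp
  have hs : (p + 1) % 2 ^ k < 2 ^ k := Nat.mod_lt _ (by positivity)
  have ht' := tau_lt hi hs
  rw [label_rim (cycleIndex_lt i ht) (cycleIndex_lt i ht') (cycleIndex_ne_succ hk hi hp),
    label_swap k (c k i)]
  funext l
  simp only [Pi.add_apply, Pi.neg_apply, Pi.zero_apply]
  rw [label_spoke ht le_rfl, label_spoke ht' zero_le_one, tau_tau hi hp, tau_tau hi hs,
    succ_mod_eq hp]
  have hl := tau_lt hi l.2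
  split_ifs with h1 h2 h3 h4 h5 <;> first | omega | simp [row]

end HMT

/-! ### Homology of `HMT(n)` in degrees `0` and `1` -/

namespace HMT

open PreAbstractSimplicialComplex

variable {R : Type*} [CommRing R]

/-- A chain from the base vertex to the vertex `a`: an edge, or for the centre of a disc a path of
two edges through `v_1^1`. -/
noncomputable def path (R : Type*) [CommRing R] (k a : ℕ) : (complex k).Chain R 1 :=
  if a = 0 then 0
  else if a ≤ 4 * 2 ^ k then edge R (complex k) 0 a
  else edge R (complex k) 0 (v 0 0) + edge R (complex k) (v 0 0) a

/-- The combination of the positive cycles with given coefficients. -/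
noncomputable def positiveCycles (R : Type*) [CommRing R] (k : ℕ) :
    (Fin (2 ^ k) → R) →ₗ[R] (complex k).Chain R 1 :=
  Fintype.linearCombination R fun j : Fin (2 ^ k) =>
    triangleCycle R (complex k) 0 (v j 0) (v j 1)

theorem path_v {k u a : ℕ} (hu : u < 2 * 2 ^ k) (ha : a ≤ 1) :
    path R k (v u a) = edge R (complex k) 0 (v u a) := by
  unfold path v
  rw [if_neg (by omega), if_pos (by omega)]

theorem path_c (k i : ℕ) :
    path R k (c k i) = edge R (complex k) 0 (v 0 0) + edge R (complex k) (v 0 0) (c k i) := by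
  unfold path
  rw [if_neg (by unfold c; omega), if_neg (by unfold c; omega)]

theorem v_ne {u u' a a' : ℕ} (ha : a ≤ 1) (ha' : a' ≤ 1) (h : u ≠ u' ∨ a ≠ a') :
    v u a ≠ v u' a' := by
  unfold v; omega

theorem v_ne_zero (u a : ℕ) : 0 ≠ v u a := by unfold v; omega

theorem c_ne_v {k u a : ℕ} (i : ℕ) (hu : u < 2 * 2 ^ k) (ha : a ≤ 1) : c k i ≠ v u a := by
  unfold c v; omega

theorem boundary_positiveCycles (k : ℕ) (m : Fin (2 ^ k) → R) :
    (complex k).boundary R 0 (positiveCycles R k m) = 0 := by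
  rw [positiveCycles, Fintype.linearCombination_apply, map_sum]
  refine Finset.sum_eq_zero fun j _ => ?_
  obtain ⟨h0, h1, h2⟩ := cycle_edges_mem (k := k) (u := j) (by omega) (by omega)
  rw [map_smul, triangleCycle, map_add, map_add, boundary_edge (v_ne_zero _ _) h0,
    boundary_edge (v_ne (by simp) (by simp) (by simp)) h2,
    boundary_edge (v_ne_zero _ _).symm (by rwa [Finset.pair_comm])]
  simp

theorem labelMap_positiveCycles (k : ℕ) (m : Fin (2 ^ k) → R) :
    labelMap (complex k) (label R k) (positiveCycles R k m) = m := by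
  rw [positiveCycles, Fintype.linearCombination_apply, map_sum]
  have key : ∀ j : Fin (2 ^ k), labelMap (complex k) (label R k)
      (triangleCycle R (complex k) 0 (v j 0) (v j 1)) = Pi.single j 1 := by
    intro j
    obtain ⟨h0, h1, h2⟩ := cycle_edges_mem (k := k) (u := j) (by omega) (by omega)
    rw [triangleCycle, map_add, map_add, labelMap_edge (label_swap k) (v_ne_zero _ _) h0,
      labelMap_edge (label_swap k) (v_ne (by simp) (by simp) (by simp)) h2,
      labelMap_edge (label_swap k) (v_ne_zero _ _).symm (by rwa [Finset.pair_comm]),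
      label_swap k 0, label_zero_left (by omega) (by simp), label_zero_left (by omega) (by simp)]
    funext l
    simp only [zero_add, neg_zero, add_zero, label_cycle (show (j : ℕ) < 2 * 2 ^ k by omega) l,
      Nat.mod_eq_of_lt j.2, if_pos j.2, Pi.single_apply, Fin.ext_iff, eq_comm]
  simp only [map_smul, key]
  funext l
  simp [Finset.sum_apply, Pi.single_apply]

/-- Modulo boundaries, the edge from `a` to `b` is the detour through the base vertex, completed by
the positive cycles that the label of the edge prescribes. -/
def IsReduced (R : Type*) [CommRing R] (k a b : ℕ) : Prop :=
  edge R (complex k) a b - (path R k b - path R k a) - positiveCycles R k (label R k a b) ∈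
    LinearMap.range ((complex k).boundary R 1)

theorem IsReduced.symm {k a b : ℕ} (h : IsReduced R k a b) : IsReduced R k b a := by
  have e : edge R (complex k) b a - (path R k a - path R k b) -
      positiveCycles R k (label R k b a) = -(edge R (complex k) a b - (path R k b - path R k a) -
        positiveCycles R k (label R k a b)) := by
    rw [edge_swap a b, label_swap k a b, map_neg]; abel
  rw [IsReduced, e]
  exact neg_mem h

/-- In a triangle with label `0`, two reduced edges make the third one reduced. -/
theorem IsReduced.of_triangle {k a b d : ℕ} (hab : a ≠ b) (had : a ≠ d) (hbd : b ≠ d)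
    (ht : {a, b, d} ∈ triangles k)
    (hl : label R k a b + label R k b d + label R k d a = 0)
    (h1 : IsReduced R k a b) (h2 : IsReduced R k b d) : IsReduced R k d a := by
  have h3 := triangleCycle_mem_range (R := R) hab had hbd
    (mem_faces_of_subset ht (by simp) subset_rfl)
  have hl' := congrArg (positiveCycles R k) hl
  rw [map_add, map_add, map_zero, add_eq_zero_iff_neg_eq] at hl'
  have h4 := sub_mem (sub_mem h3 h1) h2
  rw [IsReduced, ← hl']
  convert h4 using 1
  rw [triangleCycle]
  abel

theorem isReduced_zero {k u a : ℕ} (hu : u < 2 * 2 ^ k) (ha : a ≤ 1) :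
    IsReduced R k 0 (v u a) := by
  rw [IsReduced, label_zero_left hu ha, map_zero, path_v hu ha, path, if_pos rfl]
  simp

theorem isReduced_positive_cycle {k j : ℕ} (hj : j < 2 ^ k) :
    IsReduced R k (v j 0) (v j 1) := by
  have e : label R k (v j 0) (v j 1) = Pi.single (⟨j, hj⟩ : Fin (2 ^ k)) 1 := by
    funext l
    rw [label_cycle (by omega), Nat.mod_eq_of_lt hj, if_pos hj, Pi.single_apply]
    simp only [Fin.ext_iff, eq_comm]
  rw [IsReduced, e, positiveCycles, Fintype.linearCombination_apply_single, one_smul,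
    path_v (by omega) (by simp), path_v (by omega) (by simp), triangleCycle, edge_swap 0 (v j 1)]
  convert Submodule.zero_mem _ using 1
  abel

/-- One triangle of the digon after the other leads from the positive cycle to the negative one. -/
theorem isReduced_digon {k j : ℕ} (h1 : 1 ≤ j) (hj : j < 2 ^ k) :
    IsReduced R k (v j 0) (v (2 ^ k + j) 1) ∧ IsReduced R k (v j 1) (v (2 ^ k + j) 0) ∧
      IsReduced R k (v j 1) (v (2 ^ k + j) 1) ∧
      IsReduced R k (v (2 ^ k + j) 0) (v (2 ^ k + j) 1) := by
  obtain ⟨d1, d2, d3, d4⟩ := digon_mem h1 hj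
  have hu : j < 2 * 2 ^ k := by omega
  have hu' : 2 ^ k + j < 2 * 2 ^ k := by omega
  have hne : j ≠ 2 ^ k + j := by omega
  have z : ∀ {u a : ℕ}, u < 2 * 2 ^ k → a ≤ 1 → label R k (v u a) 0 = 0 := fun hu ha => by
    rw [label_swap, label_zero_left hu ha, neg_zero]
  have c1 : IsReduced R k (v j 0) (v (2 ^ k + j) 1) := by
    refine (IsReduced.of_triangle (a := v (2 ^ k + j) 1) (b := 0) (d := v j 0)
      (v_ne_zero _ _).symm (v_ne (by simp) (by simp) (by simp)) (v_ne_zero _ _) ?_ ?_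
      (isReduced_zero hu' (by simp)).symm (isReduced_zero hu (by simp)))
    · convert d1 using 1; ext; simp; tauto
    · rw [z hu' (by simp), label_zero_left hu (by simp), label_digon hj]; simp
  have c2 : IsReduced R k (v j 1) (v (2 ^ k + j) 0) := by
    refine (IsReduced.of_triangle (a := v (2 ^ k + j) 0) (b := 0) (d := v j 1)
      (v_ne_zero _ _).symm (v_ne (by simp) (by simp) (by simp)) (v_ne_zero _ _) ?_ ?_
      (isReduced_zero hu' (by simp)).symm (isReduced_zero hu (by simp)))
    · convert d4 using 1; ext; simp; tauto
    · rw [z hu' (by simp), label_zero_left hu (by simp), label_rim hu hu' hne]; simp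
  have c3 : IsReduced R k (v j 1) (v (2 ^ k + j) 1) := by
    refine (IsReduced.of_triangle (a := v (2 ^ k + j) 1) (b := v j 0) (d := v j 1)
      (v_ne (by simp) (by simp) (by simp)) (v_ne (by simp) (by simp) (Or.inl hne.symm))
      (v_ne (by simp) (by simp) (by simp)) ?_ ?_ c1.symm (isReduced_positive_cycle hj))
    · convert d2 using 1; ext; simp; tauto
    · rw [label_swap k (v j 0), label_digon hj]
      funext l
      simp only [Pi.add_apply, Pi.neg_apply, Pi.zero_apply]
      rw [label_cycle hu, label_digon' hj, Nat.mod_eq_of_lt hj, if_pos hj]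
      split_ifs <;> simp
  refine ⟨c1, c2, c3, IsReduced.of_triangle (a := v (2 ^ k + j) 1) (b := v j 1)
    (v_ne (by simp) (by simp) (Or.inl hne.symm)) (v_ne (by simp) (by simp) (by simp))
    (v_ne (by simp) (by simp) (by simp)) ?_ ?_ c3.symm c2⟩
  · convert d3 using 1; ext; simp; tauto
  · rw [label_rim hu hu' hne, label_swap k (v j 1)]
    funext l
    simp only [Pi.add_apply, Pi.neg_apply, Pi.zero_apply]
    rw [label_cycle hu', label_digon' hj, Nat.add_mod_left, Nat.mod_eq_of_lt hj,
      if_neg (show ¬ 2 ^ k + j < 2 ^ k by omega)]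
    split_ifs <;> simp

theorem isReduced_cycle {k u : ℕ} (hu : u < 2 * 2 ^ k) (hn : u ≠ 2 ^ k) :
    IsReduced R k (v u 0) (v u 1) := by
  by_cases h : u < 2 ^ k
  · exact isReduced_positive_cycle h
  · obtain ⟨j, rfl⟩ := Nat.exists_eq_add_of_le (not_lt.mp h)
    exact (isReduced_digon (by omega) (by omega)).2.2.2

/-- The triangle that shields off the base vertex reduces the edge opposite to it. -/
theorem isReduced_rim {k i p : ℕ} (hk : 1 ≤ k) (hi : i < 2 ^ k) (hp : p < 2 ^ k) :
    IsReduced R k (v (cycleIndex k i (tau k i p)) 1)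
      (v (cycleIndex k i (tau k i ((p + 1) % 2 ^ k))) 0) := by
  have hu := cycleIndex_lt i (tau_lt hi hp)
  have hu' := cycleIndex_lt i (tau_lt hi (Nat.mod_lt (p + 1) (by positivity)))
  have ht := rim_mem hi hp
  have hr := label_rim (R := R) hu hu' (cycleIndex_ne_succ hk hi hp)
  generalize cycleIndex k i (tau k i p) = u at *
  generalize cycleIndex k i (tau k i ((p + 1) % 2 ^ k)) = u' at *
  refine IsReduced.of_triangle (a := v u' 0) (b := 0) (v_ne_zero _ _).symm
    (v_ne (by simp) (by simp) (by simp)) (v_ne_zero _ _) ?_ ?_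
    (isReduced_zero hu' (by simp)).symm (isReduced_zero hu (by simp))
  · convert ht using 1; ext; simp; tauto
  · rw [hr, label_swap, label_zero_left hu' (by simp), label_zero_left hu (by simp)]; simp

/-- Along the boundary of its disc, starting from `v_1^1`, all edges at the centre are reduced. -/
theorem isReduced_spoke {k i p : ℕ} (hk : 1 ≤ k) (hi : i < 2 ^ k) (hp : p < 2 ^ k) :
    IsReduced R k (c k i) (v (cycleIndex k i (tau k i p)) 0) ∧
      IsReduced R k (c k i) (v (cycleIndex k i (tau k i p)) 1) := by
  have step : ∀ p, p < 2 ^ k → IsReduced R k (c k i) (v (cycleIndex k i (tau k i p)) 0) →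
      IsReduced R k (c k i) (v (cycleIndex k i (tau k i p)) 1) := by
    intro p hp h
    have hu := cycleIndex_lt i (tau_lt hi hp)
    exact (IsReduced.of_triangle (c_ne_v i hu (by simp)) (c_ne_v i hu (by simp))
      (v_ne (by simp) (by simp) (by simp)) (spoke_mem hi hp) (label_triangle_spoke hi hp) h
      (isReduced_cycle hu (cycleIndex_ne k i (tau_lt hi hp)))).symm
  suffices h : IsReduced R k (c k i) (v (cycleIndex k i (tau k i p)) 0) from ⟨h, step p hp h⟩
  induction p with
  | zero =>
    have hl : label R k (c k i) (v 0 0) = 0 := by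
      funext l
      have h := label_spoke (R := R) (i := i) (j := 0) (a := 0) (by positivity) (by simp) l
      rw [cycleIndex_zero_right, tau_zero] at h
      simp [h]
    rw [tau_zero, cycleIndex_zero_right, IsReduced, hl, map_zero, path_c,
      path_v (by positivity) (by simp), edge_swap (v 0 0) (c k i)]
    convert Submodule.zero_mem _ using 1
    abel
  | succ p ih =>
    have hp' : p < 2 ^ k := by omega
    have hs : (p + 1) % 2 ^ k = p + 1 := Nat.mod_eq_of_lt hp
    have hu := cycleIndex_lt i (tau_lt hi hp')
    have hu' := cycleIndex_lt i (tau_lt hi hp)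
    have ht := spoke_mem' hi hp'
    have hl := label_triangle_spoke' (R := R) hk hi hp'
    have hr := isReduced_rim (R := R) hk hi hp'
    rw [if_neg (by omega), hs] at hl
    rw [hs] at ht hr
    exact (IsReduced.of_triangle (c_ne_v i hu (by simp)) (c_ne_v i hu' (by simp))
      (v_ne (by simp) (by simp) (by simp)) ht hl (step p hp' (ih hp')) hr).symm

theorem isReduced_of_mem {k p q r a b : ℕ} (h1 : IsReduced R k p q) (h2 : IsReduced R k q r)
    (h3 : IsReduced R k p r) (hab : a ≠ b) (h : {a, b} ⊆ ({p, q, r} : Finset ℕ)) :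
    IsReduced R k a b := by
  simp only [Finset.insert_subset_iff, Finset.singleton_subset_iff, Finset.mem_insert,
    Finset.mem_singleton] at h
  rcases h with ⟨rfl | rfl | rfl, rfl | rfl | rfl⟩ <;>
    first | exact absurd rfl hab | assumption | exact IsReduced.symm ‹_›

theorem isReduced_of_mem_faces {k a b : ℕ} (hk : 1 ≤ k) (hab : a ≠ b)
    (h : {a, b} ∈ (complex k).faces) : IsReduced R k a b := by
  obtain ⟨-, t, ht, hs⟩ := h
  rcases mem_triangles_iff.mp ht with
    ⟨i, hi, p, hp, rfl | rfl | rfl⟩ | ⟨j, h1, hj, rfl | rfl | rfl | rfl⟩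
  · exact isReduced_of_mem (isReduced_zero (cycleIndex_lt i (tau_lt hi hp)) (by simp))
      (isReduced_rim hk hi hp) (isReduced_zero (cycleIndex_lt i (tau_lt hi
        (Nat.mod_lt (p + 1) (by positivity)))) (by simp)) hab hs
  · exact isReduced_of_mem (isReduced_spoke hk hi hp).1
      (isReduced_cycle (cycleIndex_lt i (tau_lt hi hp)) (cycleIndex_ne k i (tau_lt hi hp)))
      (isReduced_spoke hk hi hp).2 hab hs
  · exact isReduced_of_mem (isReduced_spoke hk hi hp).2 (isReduced_rim hk hi hp)
      (isReduced_spoke hk hi (Nat.mod_lt (p + 1) (by positivity))).1 hab hs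
  all_goals
    obtain ⟨d1, d2, d3, d4⟩ := isReduced_digon (R := R) h1 hj
    have z : ∀ a ≤ 1, IsReduced R k 0 (v j a) := fun a ha => isReduced_zero (by omega) ha
    have z' : ∀ a ≤ 1, IsReduced R k 0 (v (2 ^ k + j) a) := fun a ha => isReduced_zero (by omega) ha
  · exact isReduced_of_mem (z 0 (by simp)) d1 (z' 1 (by simp)) hab hs
  · exact isReduced_of_mem (isReduced_positive_cycle hj) d3 d1 hab hs
  · exact isReduced_of_mem d2 d4 d3 hab hs
  · exact isReduced_of_mem (z 1 (by simp)) d2 (z' 0 (by simp)) hab hs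

theorem labelMap_triangleCycle {k a b d : ℕ} (hab : a ≠ b) (had : a ≠ d) (hbd : b ≠ d)
    (ht : {a, b, d} ∈ triangles k) :
    labelMap (complex k) (label R k) (triangleCycle R (complex k) a b d) =
      label R k a b + label R k b d + label R k d a := by
  rw [triangleCycle, map_add, map_add, labelMap_edge (label_swap k) hab
    (mem_faces_of_subset ht (by simp) (by simp [Finset.insert_subset_iff])),
    labelMap_edge (label_swap k) hbd
    (mem_faces_of_subset ht (by simp) (by simp)),
    labelMap_edge (label_swap k) had.symm
    (mem_faces_of_subset ht (by simp) (by simp [Finset.insert_subset_iff]))]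

/-- The labels of the boundaries form the row lattice of the Hadamard matrix. -/
theorem map_labelMap_range_boundary {k : ℕ} (hk : 1 ≤ k) :
    (LinearMap.range ((complex k).boundary R 1)).map (labelMap (complex k) (label R k)) =
      Submodule.span R (Set.range (row R k)) := by
  set L := Submodule.span R (Set.range (row R k))
  apply le_antisymm
  · rintro _ ⟨_, ⟨y, rfl⟩, rfl⟩
    refine chain_mem_of_faceChain_mem
      (L.comap ((labelMap (complex k) (label R k)).comp ((complex k).boundary R 1))) ?_ y
    intro t ht hc
    rw [Submodule.mem_comap, LinearMap.comp_apply]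
    have key : ∀ a b d, a ≠ b → a ≠ d → b ≠ d → t = {a, b, d} →
        label R k a b + label R k b d + label R k d a ∈ L →
        labelMap (complex k) (label R k) ((complex k).boundary R 1 (faceChain R (complex k) 2 t))
          ∈ L := by
      rintro a b d hab had hbd rfl h
      rw [← labelMap_triangleCycle hab had hbd (mem_triangles_of_card ht hc)] at h
      rcases boundary_faceChain_triple (R := R) hab had hbd ht with h' | h' <;> rw [h']
      · exact h
      · rw [map_neg]; exact L.neg_mem h
    have key0 : ∀ a b d, a ≠ b → a ≠ d → b ≠ d → t = {a, b, d} →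
        label R k a b + label R k b d + label R k d a = 0 →
        labelMap (complex k) (label R k) ((complex k).boundary R 1 (faceChain R (complex k) 2 t))
          ∈ L := fun a b d hab had hbd ht h => key a b d hab had hbd ht (h ▸ L.zero_mem)
    rcases mem_triangles_iff.mp (mem_triangles_of_card ht hc) with
      ⟨i, hi, p, hp, h | h | h⟩ | ⟨j, h1, hj, h | h | h | h⟩
    · have hu := cycleIndex_lt i (tau_lt hi hp)
      have hu' := cycleIndex_lt i (tau_lt hi (Nat.mod_lt (p + 1) (by positivity)))
      refine key0 _ _ _ (v_ne_zero _ _) (v_ne_zero _ _) (v_ne (by simp) (by simp) (by simp)) h ?_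
      rw [label_rim hu hu' (cycleIndex_ne_succ hk hi hp), label_zero_left hu (by simp),
        label_swap k 0, label_zero_left hu' (by simp)]
      simp
    · have hu := cycleIndex_lt i (tau_lt hi hp)
      exact key0 _ _ _ (c_ne_v i hu (by simp)) (c_ne_v i hu (by simp))
        (v_ne (by simp) (by simp) (by simp)) h (label_triangle_spoke hi hp)
    · have hu := cycleIndex_lt i (tau_lt hi hp)
      have hu' := cycleIndex_lt i (tau_lt hi (Nat.mod_lt (p + 1) (by positivity)))
      refine key _ _ _ (c_ne_v i hu (by simp)) (c_ne_v i hu' (by simp))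
        (v_ne (by simp) (by simp) (by simp)) h ?_
      rw [label_triangle_spoke' hk hi hp]
      split_ifs
      · exact Submodule.subset_span ⟨_, rfl⟩
      · exact L.zero_mem
    all_goals
      have hu : j < 2 * 2 ^ k := by omega
      have hu' : 2 ^ k + j < 2 * 2 ^ k := by omega
      have hne : j ≠ 2 ^ k + j := by omega
    · refine key0 _ _ _ (v_ne_zero _ _) (v_ne_zero _ _) (v_ne (by simp) (by simp) (by simp)) h ?_
      rw [label_zero_left hu (by simp), label_digon hj, label_swap k 0,
        label_zero_left hu' (by simp)]
      simp
    · refine key0 _ _ _ (v_ne (by simp) (by simp) (by simp)) (v_ne (by simp) (by simp) (by simp))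
        (v_ne (by simp) (by simp) (Or.inl hne)) h ?_
      rw [label_swap k (v j 0), label_digon hj]
      funext l
      simp only [Pi.add_apply, Pi.neg_apply, Pi.zero_apply]
      rw [label_cycle hu, label_digon' hj, Nat.mod_eq_of_lt hj, if_pos hj]
      split_ifs <;> simp
    · refine key0 _ _ _ (v_ne (by simp) (by simp) (by simp))
        (v_ne (by simp) (by simp) (Or.inl hne)) (v_ne (by simp) (by simp) (by simp)) h ?_
      rw [label_rim hu hu' hne, label_swap k (v j 1)]
      funext l
      simp only [Pi.add_apply, Pi.neg_apply, Pi.zero_apply]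
      rw [label_cycle hu', label_digon' hj, Nat.add_mod_left, Nat.mod_eq_of_lt hj,
        if_neg (show ¬ 2 ^ k + j < 2 ^ k by omega)]
      split_ifs <;> simp
    · refine key0 _ _ _ (v_ne_zero _ _) (v_ne_zero _ _) (v_ne (by simp) (by simp) (by simp)) h ?_
      rw [label_zero_left hu (by simp), label_rim hu hu' hne, label_swap k 0,
        label_zero_left hu' (by simp)]
      simp
  · rw [Submodule.span_le]
    rintro _ ⟨⟨i, hi⟩, rfl⟩
    have hpos : 0 < 2 ^ k := by positivity
    have hp : 2 ^ k - 1 < 2 ^ k := by omega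
    have hu := cycleIndex_lt i (tau_lt hi hp)
    have hu' := cycleIndex_lt i (tau_lt hi (Nat.mod_lt (2 ^ k - 1 + 1) (by positivity)))
    have ht := spoke_mem' hi hp
    have h := label_triangle_spoke' (R := R) hk hi hp
    rw [if_pos (by omega), ← labelMap_triangleCycle (c_ne_v i hu (by simp)) (c_ne_v i hu' (by simp))
      (v_ne (by simp) (by simp) (by simp)) ht] at h
    exact ⟨_, triangleCycle_mem_range (c_ne_v i hu (by simp)) (c_ne_v i hu' (by simp))
      (v_ne (by simp) (by simp) (by simp)) (mem_faces_of_subset ht (by simp) subset_rfl), h⟩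

theorem boundary_path {k a : ℕ} (h : {a} ∈ (complex k).faces) :
    (complex k).boundary R 0 (path R k a) =
      faceChain R (complex k) 0 {a} - faceChain R (complex k) 0 {0} := by
  have hv : ∀ {u a : ℕ}, u < 2 * 2 ^ k → u ≠ 2 ^ k → a ≤ 1 →
      (complex k).boundary R 0 (path R k (v u a)) =
        faceChain R (complex k) 0 {v u a} - faceChain R (complex k) 0 {0} := by
    intro u a hu hn ha
    rw [path_v hu ha, boundary_edge (v_ne_zero _ _)]
    have := cycle_edges_mem hu hn
    interval_cases a
    · exact this.1
    · exact this.2.1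
  have h0 : (complex k).boundary R 0 (path R k 0) =
      faceChain R (complex k) 0 {0} - faceChain R (complex k) 0 {0} := by
    rw [path, if_pos rfl, map_zero, sub_self]
  have hc : ∀ i < 2 ^ k, (complex k).boundary R 0 (path R k (c k i)) =
      faceChain R (complex k) 0 {c k i} - faceChain R (complex k) 0 {0} := by
    intro i hi
    have hpos : 0 < 2 ^ k := by positivity
    have h1 := hv (u := 0) (a := 0) (by positivity) hpos.ne (by simp)
    rw [path_v (by positivity) (by simp)] at h1
    rw [path_c, map_add, h1, boundary_edge (c_ne_v i (by positivity) (by simp)).symm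
      (spoke_zero_mem hi)]
    abel
  obtain ⟨-, t, ht, hs⟩ := h
  rw [Finset.singleton_subset_iff] at hs
  rcases mem_triangles_iff.mp ht with
    ⟨i, hi, p, hp, rfl | rfl | rfl⟩ | ⟨j, h1, hj, rfl | rfl | rfl | rfl⟩ <;>
  [have hp' := Nat.mod_lt (p + 1) (show 0 < 2 ^ k by positivity);
    skip; have hp' := Nat.mod_lt (p + 1) (show 0 < 2 ^ k by positivity); skip; skip; skip; skip] <;>
  simp only [Finset.mem_insert, Finset.mem_singleton] at hs <;>
  rcases hs with rfl | rfl | rfl <;>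
  first
    | exact h0
    | exact hc i hi
    | exact hv (cycleIndex_lt i (tau_lt hi hp)) (cycleIndex_ne k i (tau_lt hi hp)) (by simp)
    | exact hv (cycleIndex_lt i (tau_lt hi hp')) (cycleIndex_ne k i (tau_lt hi hp')) (by simp)
    | exact hv (by omega) (by omega) (by simp)

theorem zero_mem_faces (k : ℕ) : {0} ∈ (complex k).faces :=
  mem_faces_of_subset (rim_mem (k := k) (i := 0) (p := 0) (by positivity) (by positivity))
    (by simp) (by simp)

theorem nonempty_homology_zero (R : Type*) [CommRing R] (k : ℕ) :
    Nonempty ((complex k).Homology R 0 ≃ₗ[R] R) :=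
  nonempty_homology_zero_equiv 0 (zero_mem_faces k) (path R k) fun _ h => boundary_path h

/-- `H_1` is the cokernel of the Hadamard matrix: the positive cycles generate, and the discs give
the rows as relations. -/
theorem nonempty_homology_one (R : Type*) [CommRing R] {k : ℕ} (hk : 1 ≤ k) :
    Nonempty ((complex k).Homology R 1 ≃ₗ[R]
      (Fin (2 ^ k) → R) ⧸ Submodule.span R (Set.range (row R k))) := by
  rw [← map_labelMap_range_boundary hk]
  exact nonempty_homology_one_equiv (path R k) (label R k) (label_swap k)
    (positiveCycles R k) (boundary_positiveCycles k) (labelMap_positiveCycles k)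
    fun a b hab h => isReduced_of_mem_faces hk hab h

end HMT

/-! ### The cokernel of the Hadamard matrix -/

namespace HMT

variable {R : Type*} [CommRing R]

/-- The positions of the digits `1` in a number below `2 ^ k`. -/
def digits (k : ℕ) (i : Fin (2 ^ k)) : Finset (Fin k) :=
  Finset.univ.filter fun b => (i : ℕ).testBit b

theorem digits_bijective (k : ℕ) : Function.Bijective (digits k) := by
  rw [Fintype.bijective_iff_injective_and_card]
  refine ⟨fun i j h => Fin.ext (Nat.eq_of_testBit_eq fun b => ?_), by
    rw [Fintype.card_fin, Fintype.card_finset, Fintype.card_fin]⟩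
  by_cases hb : b < k
  · have := congrArg (fun s => (⟨b, hb⟩ : Fin k) ∈ s) h
    rw [Bool.eq_iff_iff]
    simpa [digits] using this
  · have hk : 2 ^ k ≤ 2 ^ b := Nat.pow_le_pow_right (by norm_num) (not_lt.mp hb)
    rw [Nat.testBit_lt_two_pow (i.2.trans_le hk), Nat.testBit_lt_two_pow (j.2.trans_le hk)]

/-- The factorization `H = Z D Zᵀ` of the Hadamard matrix, where `Z` is the incidence matrix of the
inclusion of sets of digits and `D` is diagonal with entries `(-2) ^ |S|`: the binomial theorem for
`(-1) ^ |I ∩ J| = (-2 + 1) ^ |I ∩ J|`. -/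
theorem hadamard_eq_sum {k : ℕ} (i j : Fin (2 ^ k)) :
    hadamard k i j = ∑ S ∈ (digits k j).powerset, if S ⊆ digits k i then (-2) ^ S.card else 0 := by
  have h1 : hadamard k i j = (-1) ^ (digits k i ∩ digits k j).card := by
    rw [hadamard_eq_prod i.2 j.2, Finset.prod_ite, Finset.prod_const, Finset.prod_const_one,
      mul_one, digits, digits, ← Finset.filter_and]
  have h2 := Finset.sum_pow_mul_eq_add_pow (-2 : ℤ) 1 (digits k i ∩ digits k j)
  simp only [one_pow, mul_one] at h2
  rw [h1, show (-1 : ℤ) = -2 + 1 by norm_num, ← h2, ← Finset.sum_filter]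
  congr 1
  ext S
  simp only [Finset.mem_powerset, Finset.subset_inter_iff, Finset.mem_filter, and_comm]

/-- Summation over subsets. -/
def zeta (R : Type*) [CommRing R] (k : ℕ) :
    (Finset (Fin k) → R) →ₗ[R] (Finset (Fin k) → R) where
  toFun f T := ∑ S ∈ T.powerset, f S
  map_add' f g := by funext T; simp [Finset.sum_add_distrib]
  map_smul' r f := by funext T; simp [Finset.mul_sum]

theorem powerset_eq_insert_ssubsets {α : Type*} [DecidableEq α] (T : Finset α) :
    T.powerset = insert T T.ssubsets := by
  rw [Finset.ssubsets, Finset.insert_erase (Finset.mem_powerset_self T)]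

theorem zeta_bijective (k : ℕ) : Function.Bijective (zeta R k) := by
  constructor
  · rw [injective_iff_map_eq_zero]
    intro f hf
    funext T
    induction T using Finset.strongInduction with
    | H T ih =>
      have h : ∑ S ∈ T.powerset, f S = 0 := congrFun hf T
      rw [powerset_eq_insert_ssubsets, Finset.sum_insert (by simp),
        Finset.sum_eq_zero fun S hS => ih S (Finset.mem_ssubsets.mp hS), add_zero] at h
      exact h
  · rw [← LinearMap.range_eq_top]
    have key : ∀ T : Finset (Fin k), Pi.single T (1 : R) ∈ LinearMap.range (zeta R k) := by
      intro T
      induction T using WellFoundedGT.induction with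
      | ind T ih =>
        have e : zeta R k (Pi.single T 1) =
            Pi.single T 1 + ∑ U ∈ Finset.univ.filter (T < ·), Pi.single U (1 : R) := by
          funext U
          change ∑ S ∈ U.powerset, (Pi.single T 1 : Finset (Fin k) → R) S = _
          simp only [Pi.add_apply, Finset.sum_apply, Pi.single_apply, Finset.sum_ite_eq',
            Finset.sum_ite_eq, Finset.mem_powerset, Finset.mem_filter, Finset.mem_univ, true_and]
          by_cases h : U = T
          · subst h; simp
          · simp only [if_neg h, zero_add]
            exact if_congr ⟨fun h' => lt_of_le_of_ne h' (Ne.symm h), le_of_lt⟩ rfl rfl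
        rw [← sub_eq_iff_eq_add] at e
        rw [← e]
        exact sub_mem ⟨_, rfl⟩ (sum_mem fun U hU => ih U (Finset.mem_filter.mp hU).2)
    rw [eq_top_iff, ← (Pi.basisFun R (Finset (Fin k))).span_eq, Submodule.span_le]
    rintro _ ⟨T, rfl⟩
    rw [Pi.basisFun_apply]
    exact key T

/-- The vectors whose coordinate at `S` is divisible by `2 ^ |S|` are spanned by the rows of
`Z D`. -/
theorem pi_span_eq_span (k : ℕ) :
    Submodule.pi Set.univ (fun S : Finset (Fin k) => Ideal.span {(2 : R) ^ S.card}) =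
      Submodule.span R (Set.range fun T : Finset (Fin k) =>
        fun S => if S ⊆ T then (-2 : R) ^ S.card else 0) := by
  apply le_antisymm
  · intro f hf
    have key : ∀ T : Finset (Fin k), Pi.single T ((-2 : R) ^ T.card) ∈
        Submodule.span R (Set.range fun T : Finset (Fin k) =>
        fun S => if S ⊆ T then (-2 : R) ^ S.card else 0) := by
      intro T
      induction T using Finset.strongInduction with
      | H T ih =>
        have e : (fun S => if S ⊆ T then (-2 : R) ^ S.card else 0) =
            Pi.single T ((-2 : R) ^ T.card) +
              ∑ U ∈ T.ssubsets, Pi.single U ((-2 : R) ^ U.card) := by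
          funext S
          simp only [Pi.add_apply, Finset.sum_apply, Pi.single_apply, Finset.sum_ite_eq,
            Finset.mem_ssubsets]
          by_cases h : S = T
          · subst h; simp
          · simp only [if_neg h, zero_add]
            exact if_congr ⟨fun h' => lt_of_le_of_ne h' h, fun h' => h'.1⟩ rfl rfl
        rw [← sub_eq_iff_eq_add] at e
        rw [← e]
        exact sub_mem (Submodule.subset_span ⟨T, rfl⟩)
          (sum_mem fun U hU => ih U (Finset.mem_ssubsets.mp hU))
    rw [pi_eq_sum_univ f]
    refine sum_mem fun S _ => ?_
    obtain ⟨r, hr⟩ := Ideal.mem_span_singleton.mp (hf S (Set.mem_univ S))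
    have e : f S • (fun T => if S = T then (1 : R) else 0) =
        (r * (-1) ^ S.card) • Pi.single S ((-2 : R) ^ S.card) := by
      funext T
      simp only [Pi.smul_apply, Pi.single_apply, smul_eq_mul, hr, @eq_comm _ T S]
      split_ifs
      · rw [mul_one, mul_assoc, ← mul_pow, mul_comm]; norm_num
      · simp
    rw [e]
    exact Submodule.smul_mem _ _ (key S)
  · rw [Submodule.span_le]
    rintro _ ⟨T, rfl⟩ S -
    change (if S ⊆ T then (-2 : R) ^ S.card else 0) ∈ Ideal.span {(2 : R) ^ S.card}
    rw [Ideal.mem_span_singleton]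
    split_ifs
    · rw [neg_pow]; exact Dvd.intro_left _ rfl
    · exact dvd_zero _

/-- The elementary divisors of `H(2 ^ k)` are the numbers `2 ^ |S|`, for the subsets `S` of a set
of `k` elements. -/
theorem nonempty_coker_hadamard (R : Type*) [CommRing R] (k : ℕ) :
    Nonempty (((Fin (2 ^ k) → R) ⧸ Submodule.span R (Set.range (row R k))) ≃ₗ[R]
      ((S : Finset (Fin k)) → R ⧸ Ideal.span {(2 : R) ^ S.card})) := by
  let e : (Finset (Fin k) → R) ≃ₗ[R] (Fin (2 ^ k) → R) :=
    (LinearEquiv.ofBijective (zeta R k) (zeta_bijective k)).trans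
      (LinearEquiv.funCongrLeft R R (Equiv.ofBijective (digits k) (digits_bijective k)))
  have he : (Submodule.pi Set.univ fun S : Finset (Fin k) => Ideal.span {(2 : R) ^ S.card}).map
      (e : (Finset (Fin k) → R) →ₗ[R] (Fin (2 ^ k) → R)) =
      Submodule.span R (Set.range (row R k)) := by
    rw [pi_span_eq_span, Submodule.map_span, ← Set.range_comp,
      ← (digits_bijective k).surjective.range_comp]
    congr 2
    funext i l
    change ∑ S ∈ (digits k l).powerset, (if S ⊆ digits k i then (-2 : R) ^ S.card else 0) = _
    rw [row, hadamard_eq_sum]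
    push_cast
    rfl
  exact ⟨(Submodule.Quotient.equiv _ _ e he).symm.trans (Submodule.quotientPi _)⟩

theorem subsingleton_homology_one_rat {k : ℕ} (hk : 1 ≤ k) :
    Subsingleton ((complex k).Homology ℚ 1) := by
  obtain ⟨e⟩ := nonempty_homology_one ℚ hk
  obtain ⟨e'⟩ := nonempty_coker_hadamard ℚ k
  have : ∀ S : Finset (Fin k), Subsingleton (ℚ ⧸ Ideal.span {(2 : ℚ) ^ S.card}) := fun S => by
    rw [Ideal.Quotient.subsingleton_iff, Ideal.span_singleton_eq_top]
    exact (isUnit_iff_ne_zero.mpr two_ne_zero).pow _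
  exact (e.trans e').toEquiv.subsingleton

/-- The nonempty subsets of a set of `k` elements, sorted by cardinality. -/
noncomputable def subsetEquiv (k : ℕ) :
    {S : Finset (Fin k) // S.card ≠ 0} ≃ Σ j : Fin k, Fin (k.choose (j + 1)) :=
  have h (S : {S : Finset (Fin k) // S.card ≠ 0}) : S.1.card - 1 < k := by
    have := Finset.card_le_univ S.1
    rw [Fintype.card_fin] at this
    have := S.2
    omega
  (Equiv.sigmaFiberEquiv fun S => (⟨S.1.card - 1, h S⟩ : Fin k)).symm.trans
    (Equiv.sigmaCongrRight fun j => Fintype.equivFinOfCardEq (by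
      have hj (S : {S : Finset (Fin k) // S.card ≠ 0}) :
          (⟨S.1.card - 1, h S⟩ : Fin k) = j ↔ S.1.card = j + 1 := by
        have := S.2
        rw [Fin.ext_iff]
        dsimp only
        omega
      rw [Fintype.card_congr (β := {S : Finset (Fin k) // S.card = j + 1})
        ⟨fun S => ⟨S.1.1, (hj S.1).1 S.2⟩,
          fun S => ⟨⟨S.1, by rw [S.2]; omega⟩, (hj ⟨S.1, by rw [S.2]; omega⟩).2 S.2⟩,
          fun _ => rfl, fun _ => rfl⟩, Fintype.card_finset_len, Fintype.card_fin]))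

theorem card_of_subsetEquiv {k : ℕ} (S : {S : Finset (Fin k) // S.card ≠ 0}) :
    ((subsetEquiv k S).1 : ℕ) + 1 = S.1.card := by
  have := S.2
  change S.1.card - 1 + 1 = S.1.card
  omega

theorem nonempty_homology_one_int {k : ℕ} (hk : 1 ≤ k) :
    Nonempty ((complex k).Homology ℤ 1 ≃+
      ((j : Fin k) → Fin (k.choose (j + 1)) → ZMod (2 ^ ((j : ℕ) + 1)))) := by
  obtain ⟨e⟩ := nonempty_homology_one ℤ hk
  obtain ⟨e'⟩ := nonempty_coker_hadamard ℤ k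
  let A (S : Finset (Fin k)) : Type := ℤ ⧸ Ideal.span {(2 : ℤ) ^ S.card}
  have hA : ∀ S : Finset (Fin k), S.card = 0 → Subsingleton (A S) := fun S hS => by
    rw [Ideal.Quotient.subsingleton_iff, hS, pow_zero, Ideal.span_singleton_one]
  -- The empty set contributes the trivial group.
  let res : ((S : Finset (Fin k)) → A S) →ₗ[ℤ] ((S : {S : Finset (Fin k) // S.card ≠ 0}) → A S.1) :=
    LinearMap.pi fun S => LinearMap.proj S.1
  have hres : Function.Bijective res := by
    constructor
    · intro f g h
      funext S
      by_cases hS : S.card = 0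
      · exact (hA S hS).elim _ _
      · exact congrFun h ⟨S, hS⟩
    · intro g
      refine ⟨fun S => if hS : S.card ≠ 0 then g ⟨S, hS⟩ else 0, funext fun S => ?_⟩
      exact dif_pos S.2
  let z (σ : Σ j : Fin k, Fin (k.choose (j + 1))) :
      A ((subsetEquiv k).symm σ).1 ≃+ ZMod (2 ^ ((σ.1 : ℕ) + 1)) :=
    ((Ideal.quotEquivOfEq (by
      rw [← card_of_subsetEquiv, Equiv.apply_symm_apply]; push_cast; rfl)).trans
      (Int.quotientSpanNatEquivZMod (2 ^ ((σ.1 : ℕ) + 1)))).toAddEquiv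
  exact ⟨(e.trans e').toAddEquiv.trans ((LinearEquiv.ofBijective res hres).toAddEquiv.trans
    ((LinearEquiv.piCongrLeft' ℤ _ (subsetEquiv k)).toAddEquiv.trans
      ((AddEquiv.piCongrRight z).trans (LinearEquiv.piCurry ℤ
        fun (j : Fin k) (_ : Fin (k.choose (j + 1))) => ZMod (2 ^ ((j : ℕ) + 1))).toAddEquiv)))⟩

theorem card_homology_one_int {k : ℕ} (hk : 1 ≤ k) :
    Nat.card ((complex k).Homology ℤ 1) = (2 ^ k) ^ (2 ^ k / 2) := by
  obtain ⟨e⟩ := nonempty_homology_one ℤ hk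
  obtain ⟨e'⟩ := nonempty_coker_hadamard ℤ k
  have h1 : ∀ S : Finset (Fin k), Nat.card (ℤ ⧸ Ideal.span {(2 : ℤ) ^ S.card}) = 2 ^ S.card := by
    intro S
    have := Nat.card_congr (Int.quotientSpanNatEquivZMod (2 ^ S.card)).toEquiv
    rw [Nat.card_zmod] at this
    push_cast at this
    exact this
  have h2 : ∑ S : Finset (Fin k), S.card = k * 2 ^ (k - 1) := by
    rw [← Finset.powerset_univ, Finset.sum_powerset_apply_card fun m => m, Finset.card_univ,
      Fintype.card_fin, ← Nat.sum_range_mul_choose]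
    exact Finset.sum_congr rfl fun m _ => by rw [smul_eq_mul, mul_comm]
  rw [Nat.card_congr (e.trans e').toEquiv, Nat.card_pi, Finset.prod_congr rfl fun S _ => h1 S,
    Finset.prod_pow_eq_pow_sum, h2, ← pow_mul]
  congr 2
  obtain ⟨m, rfl⟩ := Nat.exists_eq_add_of_le' hk
  rw [pow_succ, Nat.mul_div_cancel _ two_pos, Nat.add_sub_cancel]

end HMT

/-! ### The face vector and the list of the facets -/

namespace HMT

open PreAbstractSimplicialComplex

theorem mem_flatMap_range_mul {α : Type*} {n : ℕ} {f : ℕ → ℕ → List α} {a : α} :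
    a ∈ (List.range (n * n)).flatMap (fun m => f (m / n) (m % n)) ↔
      ∃ i < n, ∃ p < n, a ∈ f i p := by
  rw [List.mem_flatMap]
  constructor
  · rintro ⟨m, hm, h⟩
    rw [List.mem_range] at hm
    have hn : 0 < n := Nat.pos_of_ne_zero (by rintro rfl; simp at hm)
    exact ⟨m / n, Nat.div_lt_of_lt_mul hm, m % n, Nat.mod_lt _ hn, h⟩
  · rintro ⟨i, hi, p, hp, h⟩
    have hn : 0 < n := by omega
    refine ⟨n * i + p, List.mem_range.mpr ?_, ?_⟩
    · calc n * i + p < n * i + n := by omega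
        _ = n * (i + 1) := by ring
        _ ≤ n * n := Nat.mul_le_mul_left n hi
    · rwa [Nat.mul_add_div hn, Nat.div_eq_of_lt hp, add_zero, Nat.mul_add_mod, Nat.mod_eq_of_lt hp]

theorem nodup_flatMap_range {α : Type*} {n : ℕ} {f : ℕ → List α} (h1 : ∀ j < n, (f j).Nodup)
    (h2 : ∀ j < n, ∀ j' < n, ∀ a ∈ f j, a ∈ f j' → j = j') :
    ((List.range n).flatMap f).Nodup := by
  rw [List.nodup_flatMap]
  refine ⟨fun j hj => h1 j (List.mem_range.mp hj), ?_⟩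
  rw [List.pairwise_iff_forall_sublist]
  intro j j' hs
  have hne : j ≠ j' := by
    have := List.nodup_range.sublist hs
    simpa using this
  have hj : j ∈ List.range n := hs.subset (by simp)
  have hj' : j' ∈ List.range n := hs.subset (by simp)
  exact fun a ha ha' => hne (h2 j (List.mem_range.mp hj) j' (List.mem_range.mp hj') a ha ha')

theorem nodup_flatMap_range_mul {α : Type*} {n : ℕ} {f : ℕ → ℕ → List α}
    (h1 : ∀ i < n, ∀ p < n, (f i p).Nodup)
    (h2 : ∀ i < n, ∀ p < n, ∀ i' < n, ∀ p' < n, ∀ a ∈ f i p, a ∈ f i' p' → i = i' ∧ p = p') :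
    ((List.range (n * n)).flatMap (fun m => f (m / n) (m % n))).Nodup := by
  rcases Nat.eq_zero_or_pos n with rfl | hn
  · simp
  refine nodup_flatMap_range (fun m hm => h1 _ (Nat.div_lt_of_lt_mul hm) _ (Nat.mod_lt _ hn))
    fun m hm m' hm' a ha ha' => ?_
  obtain ⟨e1, e2⟩ := h2 _ (Nat.div_lt_of_lt_mul hm) _ (Nat.mod_lt _ hn) _
    (Nat.div_lt_of_lt_mul hm') _ (Nat.mod_lt _ hn) a ha ha'
  rw [← Nat.div_add_mod m n, e1, e2, Nat.div_add_mod]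

theorem length_flatMap_range {α : Type*} {n r : ℕ} {f : ℕ → List α} (h : ∀ j, (f j).length = r) :
    ((List.range n).flatMap f).length = n * r := by
  simp [List.length_flatMap, h]

/-- What the cycles in two consecutive positions of the disc of row `i` satisfy. -/
theorem consecutive_cycles {k i p : ℕ} (hk : 1 ≤ k) (hi : i < 2 ^ k) (hp : p < 2 ^ k) :
    cycleIndex k i (tau k i p) < 2 * 2 ^ k ∧ cycleIndex k i (tau k i p) ≠ 2 ^ k ∧
    cycleIndex k i (tau k i ((p + 1) % 2 ^ k)) < 2 * 2 ^ k ∧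
    cycleIndex k i (tau k i ((p + 1) % 2 ^ k)) ≠ 2 ^ k ∧
    cycleIndex k i (tau k i p) ≠ cycleIndex k i (tau k i ((p + 1) % 2 ^ k)) ∧
    cycleIndex k i (tau k i p) ≠ 2 ^ k + cycleIndex k i (tau k i ((p + 1) % 2 ^ k)) ∧
    cycleIndex k i (tau k i ((p + 1) % 2 ^ k)) ≠ 2 ^ k + cycleIndex k i (tau k i p) := by
  have hp' : (p + 1) % 2 ^ k < 2 ^ k := Nat.mod_lt _ (by positivity)
  have ht := tau_lt hi hp
  have ht' := tau_lt hi hp'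
  have m := cycleIndex_mod i ht
  have m' := cycleIndex_mod i ht'
  have hne : tau k i p ≠ tau k i ((p + 1) % 2 ^ k) := fun h =>
    cycleIndex_ne_succ hk hi hp (congrArg _ h)
  refine ⟨cycleIndex_lt i ht, cycleIndex_ne k i ht, cycleIndex_lt i ht', cycleIndex_ne k i ht',
    cycleIndex_ne_succ hk hi hp, fun h => hne ?_, fun h => hne ?_⟩
  · rw [← m, h, Nat.add_mod_left, m']
  · rw [← m', h, Nat.add_mod_left, m]

theorem pos_eq_of_cycleIndex_eq {k i p p' : ℕ} (hi : i < 2 ^ k) (hp : p < 2 ^ k) (hp' : p' < 2 ^ k)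
    (h : cycleIndex k i (tau k i p) = cycleIndex k i (tau k i p')) : p = p' :=
  tau_inj hi hp hp' (eq_of_cycleIndex_eq (tau_lt hi hp) (tau_lt hi hp') h).1

theorem mem_of_triple_eq {a b d a' b' d' : ℕ} (h : ({a, b, d} : Finset ℕ) = {a', b', d'}) :
    (a = a' ∨ a = b' ∨ a = d') ∧ (b = a' ∨ b = b' ∨ b = d') ∧ (d = a' ∨ d = b' ∨ d = d') := by
  have h1 : a ∈ ({a', b', d'} : Finset ℕ) := h ▸ (by simp)
  have h2 : b ∈ ({a', b', d'} : Finset ℕ) := h ▸ (by simp)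
  have h3 : d ∈ ({a', b', d'} : Finset ℕ) := h ▸ (by simp)
  simp only [Finset.mem_insert, Finset.mem_singleton] at h1 h2 h3
  exact ⟨h1, h2, h3⟩

theorem mem_of_pair_eq {a b a' b' : ℕ} (h : ({a, b} : Finset ℕ) = {a', b'}) :
    (a = a' ∨ a = b') ∧ (b = a' ∨ b = b') := by
  have h1 : a ∈ ({a', b'} : Finset ℕ) := h ▸ (by simp)
  have h2 : b ∈ ({a', b'} : Finset ℕ) := h ▸ (by simp)
  simp only [Finset.mem_insert, Finset.mem_singleton] at h1 h2
  exact ⟨h1, h2⟩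

/-- The three facets in position `p` of the disc of row `i`. -/
def discFacets (k i p : ℕ) : List (ℕ × ℕ × ℕ) :=
  [(0, v (cycleIndex k i (tau k i p)) 1, v (cycleIndex k i (tau k i ((p + 1) % 2 ^ k))) 0),
    (c k i, v (cycleIndex k i (tau k i p)) 0, v (cycleIndex k i (tau k i p)) 1),
    (c k i, v (cycleIndex k i (tau k i p)) 1, v (cycleIndex k i (tau k i ((p + 1) % 2 ^ k))) 0)]

/-- The four facets of the digon of column `j + 1`. -/
def digonFacets (k j : ℕ) : List (ℕ × ℕ × ℕ) :=
  [(0, v (j + 1) 0, v (2 ^ k + (j + 1)) 1), (v (j + 1) 0, v (j + 1) 1, v (2 ^ k + (j + 1)) 1),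
    (v (j + 1) 1, v (2 ^ k + (j + 1)) 0, v (2 ^ k + (j + 1)) 1),
    (0, v (j + 1) 1, v (2 ^ k + (j + 1)) 0)]

/-- The facets of `HMT(2 ^ k)`, in the order in which the algorithm lists them. -/
def facetList (k : ℕ) : List (ℕ × ℕ × ℕ) :=
  (List.range (2 ^ k * 2 ^ k)).flatMap (fun m => discFacets k (m / 2 ^ k) (m % 2 ^ k)) ++
    (List.range (2 ^ k - 1)).flatMap (digonFacets k)

/-- The face with three given vertices. -/
def tripleFace (t : ℕ × ℕ × ℕ) : Finset ℕ := {t.1, t.2.1, t.2.2}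

theorem map_facetList (k : ℕ) : (facetList k).map tripleFace =
    (List.range (2 ^ k * 2 ^ k)).flatMap
      (fun m => (discFacets k (m / 2 ^ k) (m % 2 ^ k)).map tripleFace) ++
    (List.range (2 ^ k - 1)).flatMap (fun j => (digonFacets k j).map tripleFace) := by
  rw [facetList, List.map_append, List.map_flatMap, List.map_flatMap]

theorem exists_pos_iff {n : ℕ} {P : ℕ → Prop} :
    (∃ j, 1 ≤ j ∧ j < n ∧ P j) ↔ ∃ j < n - 1, P (j + 1) := by
  constructor
  · rintro ⟨j, h1, hj, h⟩
    exact ⟨j - 1, by omega, by rwa [Nat.sub_add_cancel h1]⟩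
  · rintro ⟨j, hj, h⟩
    exact ⟨j + 1, by omega, by omega, h⟩

theorem mem_map_facetList {k : ℕ} {s : Finset ℕ} :
    s ∈ (facetList k).map tripleFace ↔ s ∈ triangles k := by
  rw [map_facetList, List.mem_append,
    mem_flatMap_range_mul (f := fun i p => (discFacets k i p).map tripleFace), mem_triangles_iff,
    exists_pos_iff, List.mem_flatMap]
  simp only [discFacets, digonFacets, tripleFace, List.map_cons, List.map_nil, List.mem_cons,
    List.not_mem_nil, or_false, List.mem_range]

theorem nodup_map_facetList {k : ℕ} (hk : 1 ≤ k) : ((facetList k).map tripleFace).Nodup := by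
  rw [map_facetList, List.nodup_append]
  refine ⟨nodup_flatMap_range_mul (f := fun i p => (discFacets k i p).map tripleFace) ?_ ?_,
    nodup_flatMap_range ?_ ?_, ?_⟩
  · intro i hi p hp
    obtain ⟨a1, a2, a3, a4, a5, a6, a7⟩ := consecutive_cycles hk hi hp
    simp only [discFacets, tripleFace, List.map_cons, List.map_nil, List.nodup_cons, List.mem_cons,
      List.not_mem_nil, or_false, not_or, not_false_eq_true, List.nodup_nil, and_true, v, c]
    refine ⟨⟨?_, ?_⟩, ?_⟩ <;> intro h <;> have := mem_of_triple_eq h <;> omega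
  · intro i hi p hp i' hi' p' hp' s hs hs'
    obtain ⟨a1, a2, a3, a4, a5, a6, a7⟩ := consecutive_cycles hk hi hp
    obtain ⟨b1, b2, b3, b4, b5, b6, b7⟩ := consecutive_cycles hk hi' hp'
    -- A pair of cycles determines row and position, and so does a row with one cycle.
    have key1 := eq_of_consecutive hk hi hi' hp hp'
    have key2 : i = i' → cycleIndex k i (tau k i p) = cycleIndex k i' (tau k i' p') →
        i = i' ∧ p = p' := by
      rintro rfl h
      exact ⟨rfl, pos_eq_of_cycleIndex_eq hi hp hp' h⟩
    simp only [discFacets, tripleFace, List.map_cons, List.map_nil, List.mem_cons,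
      List.not_mem_nil, or_false, v, c] at hs hs'
    rcases hs with rfl | rfl | rfl <;> rcases hs' with h | h | h <;>
      have h' := mem_of_triple_eq h <;> omega
  · intro j hj
    simp only [digonFacets, tripleFace, List.map_cons, List.map_nil, List.nodup_cons, List.mem_cons,
      List.not_mem_nil, or_false, not_or, not_false_eq_true, List.nodup_nil, and_true, v]
    refine ⟨⟨?_, ?_, ?_⟩, ⟨?_, ?_⟩, ?_⟩ <;> intro h <;> have := mem_of_triple_eq h <;> omega
  · intro j hj j' hj' s hs hs'
    simp only [digonFacets, tripleFace, List.map_cons, List.map_nil, List.mem_cons,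
      List.not_mem_nil, or_false, v] at hs hs'
    rcases hs with rfl | rfl | rfl | rfl <;> rcases hs' with h | h | h | h <;>
      have h' := mem_of_triple_eq h <;> omega
  · intro s hs s' hs' e
    subst e
    rw [mem_flatMap_range_mul (f := fun i p => (discFacets k i p).map tripleFace)] at hs
    rw [List.mem_flatMap] at hs'
    obtain ⟨i, hi, p, hp, hs⟩ := hs
    obtain ⟨j, hj, hs'⟩ := hs'
    rw [List.mem_range] at hj
    obtain ⟨a1, a2, a3, a4, a5, a6, a7⟩ := consecutive_cycles hk hi hp
    simp only [discFacets, digonFacets, tripleFace, List.map_cons, List.map_nil, List.mem_cons,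
      List.not_mem_nil, or_false, v, c] at hs hs'
    rcases hs with rfl | rfl | rfl <;> rcases hs' with h | h | h | h <;>
      have h' := mem_of_triple_eq h <;> omega

theorem length_facetList (k : ℕ) :
    (facetList k).length = 3 * (2 ^ k) ^ 2 + 4 * 2 ^ k - 4 := by
  have hpos : 0 < 2 ^ k := by positivity
  rw [facetList, List.length_append, length_flatMap_range (r := 3) (fun _ => rfl),
    length_flatMap_range (r := 4) (fun _ => rfl), pow_two]
  omega

theorem card_of_mem_triangles {k : ℕ} (hk : 1 ≤ k) {t : Finset ℕ} (ht : t ∈ triangles k) :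
    t.card = 3 := by
  rw [Finset.card_eq_three]
  rcases mem_triangles_iff.mp ht with ⟨i, hi, p, hp, h⟩ | ⟨j, h1, hj, h⟩
  · obtain ⟨a1, a2, a3, a4, a5, a6, a7⟩ := consecutive_cycles hk hi hp
    unfold v c at h
    rcases h with rfl | rfl | rfl <;> exact ⟨_, _, _, by omega, by omega, by omega, rfl⟩
  · unfold v at h
    rcases h with rfl | rfl | rfl | rfl <;> exact ⟨_, _, _, by omega, by omega, by omega, rfl⟩

theorem maximal_iff_mem_triangles {k : ℕ} (hk : 1 ≤ k) {s : Finset ℕ} :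
    Maximal (· ∈ (complex k).faces) s ↔ s ∈ triangles k := by
  have hface : ∀ t ∈ triangles k, t ∈ (complex k).faces := fun t ht =>
    mem_faces_of_subset ht (Finset.card_pos.mp (by rw [card_of_mem_triangles hk ht]; norm_num))
      subset_rfl
  constructor
  · rintro ⟨⟨-, t, ht, hs⟩, hmax⟩
    rwa [Finset.Subset.antisymm hs (hmax (hface t ht) hs)]
  · intro hs
    refine ⟨hface s hs, ?_⟩
    rintro s' ⟨-, t, ht, hs'⟩ h
    refine (Finset.eq_of_subset_of_card_le h ?_).ge
    rw [card_of_mem_triangles hk hs, ← card_of_mem_triangles hk ht]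
    exact Finset.card_le_card hs'

theorem listsFacets {k : ℕ} (hk : 1 ≤ k) :
    ListsFacets ((facetList k).flatMap fun t => [t.1, t.2.1, t.2.2]) (complex k) :=
  ⟨facetList k, rfl, nodup_map_facetList hk, fun _ =>
    mem_map_facetList.trans (maximal_iff_mem_triangles hk).symm⟩

theorem hasDimension_two {k : ℕ} (hk : 1 ≤ k) : (complex k).HasDimension 2 := by
  refine ⟨?_, ?_⟩
  · rintro s ⟨-, t, ht, hs⟩
    exact (Finset.card_le_card hs).trans (card_le_of_mem_triangles ht)
  · have ht := rim_mem (k := k) (i := 0) (p := 0) (by positivity) (by positivity)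
    exact ⟨_, mem_faces_of_subset ht (by simp) subset_rfl, card_of_mem_triangles hk ht⟩

theorem _root_.PreAbstractSimplicialComplex.faceNumber_eq_length {V : Type*} [DecidableEq V]
    {K : PreAbstractSimplicialComplex V} {d : ℕ} {L : List (Finset V)} (hL : L.Nodup)
    (h : ∀ s, s ∈ L ↔ s ∈ K.faces ∧ s.card = d + 1) : K.faceNumber d = L.length := by
  rw [faceNumber, ← List.toFinset_card_of_nodup hL, ← Set.ncard_coe_finset]
  congr 1
  ext s
  simp [h]

theorem faceNumber_two {k : ℕ} (hk : 1 ≤ k) :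
    (complex k).faceNumber 2 = 3 * (2 ^ k) ^ 2 + 4 * 2 ^ k - 4 := by
  rw [faceNumber_eq_length (nodup_map_facetList hk), List.length_map, length_facetList]
  intro s
  rw [mem_map_facetList]
  refine ⟨fun h => ⟨(maximal_iff_mem_triangles hk).mpr h |>.1, card_of_mem_triangles hk h⟩,
    fun h => mem_triangles_of_card h.1 h.2⟩

/-- The three edges in position `p` of the disc of row `i` that are not in a cycle. -/
def discEdges (k i p : ℕ) : List (Finset ℕ) :=
  [{c k i, v (cycleIndex k i (tau k i p)) 0}, {c k i, v (cycleIndex k i (tau k i p)) 1},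
    {v (cycleIndex k i (tau k i p)) 1, v (cycleIndex k i (tau k i ((p + 1) % 2 ^ k))) 0}]

/-- The edges of the positive cycle of column `j`. -/
def cycleEdges (j : ℕ) : List (Finset ℕ) := [{0, v j 0}, {0, v j 1}, {v j 0, v j 1}]

/-- The edges of the negative cycle of column `j + 1` and the inner edges of its digon. -/
def digonEdges (k j : ℕ) : List (Finset ℕ) :=
  [{0, v (2 ^ k + (j + 1)) 0}, {0, v (2 ^ k + (j + 1)) 1},
    {v (2 ^ k + (j + 1)) 0, v (2 ^ k + (j + 1)) 1},
    {v (j + 1) 0, v (2 ^ k + (j + 1)) 1}, {v (j + 1) 1, v (2 ^ k + (j + 1)) 1},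
    {v (j + 1) 1, v (2 ^ k + (j + 1)) 0}]

/-- The edges of `HMT(2 ^ k)`. -/
def edgeList (k : ℕ) : List (Finset ℕ) :=
  (List.range (2 ^ k * 2 ^ k)).flatMap (fun m => discEdges k (m / 2 ^ k) (m % 2 ^ k)) ++
    ((List.range (2 ^ k)).flatMap cycleEdges ++ (List.range (2 ^ k - 1)).flatMap (digonEdges k))

theorem length_edgeList (k : ℕ) :
    (edgeList k).length = 3 * (2 ^ k) ^ 2 + 9 * 2 ^ k - 6 := by
  have hpos : 0 < 2 ^ k := by positivity
  rw [edgeList, List.length_append, List.length_append,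
    length_flatMap_range (r := 3) (fun _ => rfl), length_flatMap_range (r := 3) (fun _ => rfl),
    length_flatMap_range (r := 6) (fun _ => rfl), pow_two]
  omega

theorem nodup_edgeList {k : ℕ} (hk : 1 ≤ k) : (edgeList k).Nodup := by
  have hpos : 0 < 2 ^ k := by positivity
  rw [edgeList, List.nodup_append, List.nodup_append]
  refine ⟨nodup_flatMap_range_mul ?_ ?_,
    ⟨nodup_flatMap_range ?_ ?_, nodup_flatMap_range ?_ ?_, ?_⟩, ?_⟩
  · intro i hi p hp
    obtain ⟨a1, a2, a3, a4, a5, a6, a7⟩ := consecutive_cycles hk hi hp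
    simp only [discEdges, List.nodup_cons, List.mem_cons,
      List.not_mem_nil, or_false, not_or, not_false_eq_true, List.nodup_nil, and_true, v, c]
    refine ⟨⟨?_, ?_⟩, ?_⟩ <;> intro h <;> have := mem_of_pair_eq h <;> omega
  · intro i hi p hp i' hi' p' hp' s hs hs'
    obtain ⟨a1, a2, a3, a4, a5, a6, a7⟩ := consecutive_cycles hk hi hp
    obtain ⟨b1, b2, b3, b4, b5, b6, b7⟩ := consecutive_cycles hk hi' hp'
    -- A pair of cycles determines row and position, and so does a row with one cycle.
    have key1 := eq_of_consecutive hk hi hi' hp hp'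
    have key2 : i = i' → cycleIndex k i (tau k i p) = cycleIndex k i' (tau k i' p') →
        i = i' ∧ p = p' := by
      rintro rfl h
      exact ⟨rfl, pos_eq_of_cycleIndex_eq hi hp hp' h⟩
    simp only [discEdges, List.mem_cons, List.not_mem_nil, or_false, v, c] at hs hs'
    rcases hs with rfl | rfl | rfl <;> rcases hs' with h | h | h <;>
      have h' := mem_of_pair_eq h <;> omega
  · intro j hj
    simp only [cycleEdges, List.nodup_cons, List.mem_cons,
      List.not_mem_nil, or_false, not_or, not_false_eq_true, List.nodup_nil, and_true, v]
    refine ⟨⟨?_, ?_⟩, ?_⟩ <;> intro h <;> have := mem_of_pair_eq h <;> omega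
  · intro j hj j' hj' s hs hs'
    simp only [cycleEdges, List.mem_cons, List.not_mem_nil, or_false, v] at hs hs'
    rcases hs with rfl | rfl | rfl <;> rcases hs' with h | h | h <;>
      have h' := mem_of_pair_eq h <;> omega
  · intro j hj
    simp only [digonEdges, List.nodup_cons, List.mem_cons,
      List.not_mem_nil, or_false, not_or, not_false_eq_true, List.nodup_nil, and_true, v]
    refine ⟨⟨?_, ?_, ?_, ?_, ?_⟩, ⟨?_, ?_, ?_, ?_⟩, ⟨?_, ?_, ?_⟩, ⟨?_, ?_⟩, ?_⟩ <;> intro h <;>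
      have := mem_of_pair_eq h <;> omega
  · intro j hj j' hj' s hs hs'
    simp only [digonEdges, List.mem_cons, List.not_mem_nil, or_false, v] at hs hs'
    rcases hs with rfl | rfl | rfl | rfl | rfl | rfl <;>
      rcases hs' with h | h | h | h | h | h <;> have h' := mem_of_pair_eq h <;> omega
  · intro s hs s' hs' e
    subst e
    rw [List.mem_flatMap] at hs hs'
    obtain ⟨j, hj, hs⟩ := hs
    obtain ⟨j', hj', hs'⟩ := hs'
    rw [List.mem_range] at hj hj'
    simp only [digonEdges, cycleEdges, List.mem_cons, List.not_mem_nil, or_false, v] at hs hs'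
    rcases hs with rfl | rfl | rfl <;>
      rcases hs' with h | h | h | h | h | h <;> have h' := mem_of_pair_eq h <;> omega
  · intro s hs s' hs' e
    subst e
    rw [mem_flatMap_range_mul] at hs
    obtain ⟨i, hi, p, hp, hs⟩ := hs
    obtain ⟨a1, a2, a3, a4, a5, a6, a7⟩ := consecutive_cycles hk hi hp
    rw [List.mem_append, List.mem_flatMap, List.mem_flatMap] at hs'
    rcases hs' with ⟨j, hj, hs'⟩ | ⟨j, hj, hs'⟩ <;> rw [List.mem_range] at hj <;>
      simp only [discEdges, digonEdges, cycleEdges, List.mem_cons, List.not_mem_nil, or_false, v,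
        c] at hs hs'
    · rcases hs with rfl | rfl | rfl <;>
        rcases hs' with h | h | h <;> have h' := mem_of_pair_eq h <;> omega
    · rcases hs with rfl | rfl | rfl <;>
        rcases hs' with h | h | h | h | h | h <;> have h' := mem_of_pair_eq h <;> omega

theorem eq_pair_of_subset {a b d : ℕ} {s : Finset ℕ} (hs : s ⊆ {a, b, d}) (hc : s.card = 2) :
    s = {a, b} ∨ s = {a, d} ∨ s = {b, d} := by
  obtain ⟨x, y, hxy, rfl⟩ := Finset.card_eq_two.mp hc
  simp only [Finset.insert_subset_iff, Finset.singleton_subset_iff, Finset.mem_insert,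
    Finset.mem_singleton] at hs
  rcases hs with ⟨rfl | rfl | rfl, rfl | rfl | rfl⟩ <;>
    first | exact absurd rfl hxy | simp [Finset.pair_comm]

theorem mem_edgeList {k : ℕ} {s : Finset ℕ} : s ∈ edgeList k ↔
    (∃ i < 2 ^ k, ∃ p < 2 ^ k, s = {c k i, v (cycleIndex k i (tau k i p)) 0} ∨
      s = {c k i, v (cycleIndex k i (tau k i p)) 1} ∨
      s = {v (cycleIndex k i (tau k i p)) 1,
        v (cycleIndex k i (tau k i ((p + 1) % 2 ^ k))) 0}) ∨
    (∃ u < 2 * 2 ^ k, u ≠ 2 ^ k ∧ (s = {0, v u 0} ∨ s = {0, v u 1} ∨ s = {v u 0, v u 1})) ∨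
    ∃ j, 1 ≤ j ∧ j < 2 ^ k ∧ (s = {v j 0, v (2 ^ k + j) 1} ∨ s = {v j 1, v (2 ^ k + j) 1} ∨
      s = {v j 1, v (2 ^ k + j) 0}) := by
  have e : (∃ u < 2 * 2 ^ k, u ≠ 2 ^ k ∧ (s = {0, v u 0} ∨ s = {0, v u 1} ∨ s = {v u 0, v u 1})) ↔
      (∃ j < 2 ^ k, s ∈ cycleEdges j) ∨
      ∃ j, 1 ≤ j ∧ j < 2 ^ k ∧ (s = {0, v (2 ^ k + j) 0} ∨ s = {0, v (2 ^ k + j) 1} ∨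
        s = {v (2 ^ k + j) 0, v (2 ^ k + j) 1}) := by
    simp only [cycleEdges, List.mem_cons, List.not_mem_nil, or_false]
    constructor
    · rintro ⟨u, hu, hn, h⟩
      by_cases hu' : u < 2 ^ k
      · exact Or.inl ⟨u, hu', h⟩
      · obtain ⟨j, rfl⟩ := Nat.exists_eq_add_of_le (not_lt.mp hu')
        exact Or.inr ⟨j, by omega, by omega, h⟩
    · rintro (⟨j, hj, h⟩ | ⟨j, h1, hj, h⟩)
      · exact ⟨j, by omega, by omega, h⟩
      · exact ⟨2 ^ k + j, by omega, by omega, h⟩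
  rw [e, or_assoc, exists_pos_iff, exists_pos_iff, ← exists_or, edgeList, List.mem_append,
    List.mem_append, mem_flatMap_range_mul, List.mem_flatMap, List.mem_flatMap]
  simp only [discEdges, digonEdges, List.mem_cons, List.not_mem_nil, or_false, List.mem_range,
    ← and_or_left, or_assoc]

theorem mem_edgeList_iff {k : ℕ} (hk : 1 ≤ k) {s : Finset ℕ} :
    s ∈ edgeList k ↔ s ∈ (complex k).faces ∧ s.card = 1 + 1 := by
  constructor
  · rw [mem_edgeList]
    have key : ∀ a b, a ≠ b → s = {a, b} → ({a, b} : Finset ℕ) ∈ (complex k).faces →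
        s ∈ (complex k).faces ∧ s.card = 1 + 1 := by
      rintro a b hab rfl h
      exact ⟨h, Finset.card_pair hab⟩
    rintro (⟨i, hi, p, hp, h⟩ | ⟨u, hu, hn, h⟩ | ⟨j, h1, hj, h⟩)
    · have hu := cycleIndex_lt i (tau_lt hi hp)
      have t1 := spoke_mem hi hp
      have t2 := rim_mem hi hp
      rcases h with h | h | h
      · exact key _ _ (c_ne_v i hu (by simp)) h
          (mem_faces_of_subset t1 (by simp) (by simp [Finset.insert_subset_iff]))
      · exact key _ _ (c_ne_v i hu (by simp)) h
          (mem_faces_of_subset t1 (by simp) (by simp [Finset.insert_subset_iff]))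
      · exact key _ _ (v_ne (by simp) (by simp) (by simp)) h
          (mem_faces_of_subset t2 (by simp) (by simp))
    · obtain ⟨c1, c2, c3⟩ := cycle_edges_mem hu hn
      rcases h with h | h | h
      · exact key _ _ (v_ne_zero _ _) h c1
      · exact key _ _ (v_ne_zero _ _) h c2
      · exact key _ _ (v_ne (by simp) (by simp) (by simp)) h c3
    · obtain ⟨d1, d2, d3, d4⟩ := digon_mem h1 hj
      rcases h with h | h | h
      · exact key _ _ (v_ne (by simp) (by simp) (by simp)) h
          (mem_faces_of_subset d1 (by simp) (by simp))
      · exact key _ _ (v_ne (by simp) (by simp) (Or.inl (by omega))) h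
          (mem_faces_of_subset d3 (by simp) (by simp [Finset.insert_subset_iff]))
      · exact key _ _ (v_ne (by simp) (by simp) (by simp)) h
          (mem_faces_of_subset d4 (by simp) (by simp))
  · rintro ⟨⟨-, t, ht, hs⟩, hc⟩
    have kd : ∀ i < 2 ^ k, ∀ p < 2 ^ k, (s = {c k i, v (cycleIndex k i (tau k i p)) 0} ∨
        s = {c k i, v (cycleIndex k i (tau k i p)) 1} ∨
        s = {v (cycleIndex k i (tau k i p)) 1,
          v (cycleIndex k i (tau k i ((p + 1) % 2 ^ k))) 0}) → s ∈ edgeList k :=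
      fun i hi p hp h => mem_edgeList.mpr (Or.inl ⟨i, hi, p, hp, h⟩)
    have kc : ∀ u, u < 2 * 2 ^ k → u ≠ 2 ^ k →
        (s = {0, v u 0} ∨ s = {0, v u 1} ∨ s = {v u 0, v u 1}) → s ∈ edgeList k :=
      fun u hu hn h => mem_edgeList.mpr (Or.inr (Or.inl ⟨u, hu, hn, h⟩))
    rcases mem_triangles_iff.mp ht with ⟨i, hi, p, hp, h⟩ | ⟨j, h1, hj, h⟩
    · have hp' := Nat.mod_lt (p + 1) (show 0 < 2 ^ k by positivity)
      obtain ⟨a1, a2, a3, a4, -⟩ := consecutive_cycles hk hi hp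
      have e1 := kd i hi p hp
      have e2 := kd i hi _ hp'
      have e3 := kc _ a1 a2
      have e4 := kc _ a3 a4
      rcases h with rfl | rfl | rfl <;> rcases eq_pair_of_subset hs hc with h | h | h <;> tauto
    · have kg : (s = {v j 0, v (2 ^ k + j) 1} ∨ s = {v j 1, v (2 ^ k + j) 1} ∨
          s = {v j 1, v (2 ^ k + j) 0}) → s ∈ edgeList k :=
        fun h => mem_edgeList.mpr (Or.inr (Or.inr ⟨j, h1, hj, h⟩))
      have e3 := kc j (by omega) (by omega)
      have e4 := kc (2 ^ k + j) (by omega) (by omega)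
      rcases h with rfl | rfl | rfl | rfl <;> rcases eq_pair_of_subset hs hc with h | h | h <;>
        tauto

theorem faceNumber_one {k : ℕ} (hk : 1 ≤ k) :
    (complex k).faceNumber 1 = 3 * (2 ^ k) ^ 2 + 9 * 2 ^ k - 6 := by
  rw [faceNumber_eq_length (nodup_edgeList hk) fun _ => mem_edgeList_iff hk, length_edgeList]

theorem singleton_mem_faces_iff {k a : ℕ} (hk : 1 ≤ k) : {a} ∈ (complex k).faces ↔
    a < 5 * 2 ^ k + 1 ∧ a ≠ v (2 ^ k) 0 ∧ a ≠ v (2 ^ k) 1 := by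
  constructor
  · rintro ⟨-, t, ht, hs⟩
    rw [Finset.singleton_subset_iff] at hs
    rcases mem_triangles_iff.mp ht with ⟨i, hi, p, hp, h⟩ | ⟨j, h1, hj, h⟩
    · obtain ⟨a1, a2, a3, a4, -⟩ := consecutive_cycles hk hi hp
      rcases h with rfl | rfl | rfl <;>
        simp only [Finset.mem_insert, Finset.mem_singleton, v, c] at hs ⊢ <;> omega
    · rcases h with rfl | rfl | rfl | rfl <;>
        simp only [Finset.mem_insert, Finset.mem_singleton, v] at hs ⊢ <;> omega
  · rintro ⟨h1, h2, h3⟩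
    rcases Nat.eq_zero_or_pos a with rfl | h0
    · exact zero_mem_faces k
    by_cases h4 : a ≤ 4 * 2 ^ k
    · obtain ⟨c1, c2, -⟩ := cycle_edges_mem (k := k) (u := (a - 1) / 2) (by omega)
        (by unfold v at h2 h3; omega)
      have ha : a = v ((a - 1) / 2) 0 ∨ a = v ((a - 1) / 2) 1 := by unfold v; omega
      rcases ha with ha | ha <;> rw [ha]
      · exact singleton_mem_faces c1 (by simp)
      · exact singleton_mem_faces c2 (by simp)
    · have ha : a = c k (a - 1 - 4 * 2 ^ k) := by unfold c; omega
      have hi : a - 1 - 4 * 2 ^ k < 2 ^ k := by omega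
      rw [ha]
      exact singleton_mem_faces (spoke_zero_mem hi) (by simp)

theorem faceNumber_zero {k : ℕ} (hk : 1 ≤ k) : (complex k).faceNumber 0 = 5 * 2 ^ k - 1 := by
  have e : {s : Finset ℕ | s ∈ (complex k).faces ∧ s.card = 0 + 1} = (fun a : ℕ => {a}) ''
      ((Finset.range (5 * 2 ^ k + 1) \ {v (2 ^ k) 0, v (2 ^ k) 1} : Finset ℕ) : Set ℕ) := by
    ext s
    simp only [Set.mem_ofPred_eq, Set.mem_image, Finset.mem_coe, Finset.mem_sdiff,
      Finset.mem_range, Finset.mem_insert, Finset.mem_singleton, not_or,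
      ← singleton_mem_faces_iff hk, zero_add, Finset.card_eq_one]
    constructor
    · rintro ⟨h, a, rfl⟩
      exact ⟨a, h, rfl⟩
    · rintro ⟨a, h, rfl⟩
      exact ⟨h, a, rfl⟩
  rw [faceNumber, e, Set.ncard_image_of_injective _ Finset.singleton_injective,
    Set.ncard_coe_finset, Finset.card_sdiff_of_subset, Finset.card_range,
    Finset.card_pair (v_ne (by simp) (by simp) (by simp))]
  · omega
  · have : 0 < 2 ^ k := by positivity
    simp only [Finset.insert_subset_iff, Finset.singleton_subset_iff, Finset.mem_range, v]
    omega

/-! ### Homology in degrees at least `2` -/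

theorem isEmpty_simplex (k : ℕ) {d : ℕ} (hd : 3 ≤ d) : IsEmpty ((complex k).Simplex d) := by
  constructor
  rintro ⟨s, ⟨-, t, ht, hs⟩, hc⟩
  have := (Finset.card_le_card hs).trans (card_le_of_mem_triangles ht)
  omega

theorem _root_.PreAbstractSimplicialComplex.subsingleton_homology_of_cycles_eq_bot {V : Type*}
    [LinearOrder V] {R : Type*} [CommRing R] {K : PreAbstractSimplicialComplex V} {d : ℕ}
    (h : K.cycles R d = ⊥) : Subsingleton (K.Homology R d) := by
  have : Subsingleton (K.cycles R d) := by rw [h]; infer_instance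
  exact inferInstanceAs
    (Subsingleton (Subquotient (K.cycles R d) (LinearMap.range (K.boundary R d))))

theorem finrank_chain (k d : ℕ) [Finite ((complex k).Simplex d)] :
    Module.finrank ℚ ((complex k).Chain ℚ d) = (complex k).faceNumber d := by
  have := Fintype.ofFinite ((complex k).Simplex d)
  have h : Module.finrank ℚ ((complex k).Simplex d →₀ ℚ) = Nat.card ((complex k).Simplex d) := by
    rw [Module.finrank_finsupp_self, Nat.card_eq_fintype_card]
  exact h

/-- The rational boundary map in degree `2` is injective: as `H_0` has rank one and `H_1` vanishes,
the dimension of its kernel is `f_2 - f_1 + f_0 - 1 = 0`. -/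
theorem ker_boundary_one_rat {k : ℕ} (hk : 1 ≤ k) :
    LinearMap.ker ((complex k).boundary ℚ 1) = ⊥ := by
  have hpos : 0 < 2 ^ k := by positivity
  have f0 : (complex k).faceNumber 0 = _ := faceNumber_zero hk
  have f1 : (complex k).faceNumber 1 = _ := faceNumber_one hk
  have f2 : (complex k).faceNumber 2 = _ := faceNumber_two hk
  have hsq : 0 < (2 ^ k) ^ 2 := by positivity
  generalize (2 ^ k) ^ 2 = N at *
  have fin : ∀ d, 0 < (complex k).faceNumber d → Finite ((complex k).Simplex d) := fun d hd =>
    (Set.finite_of_ncard_pos hd).to_subtype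
  have := fin 0 (by rw [f0]; omega)
  have := fin 1 (by rw [f1]; omega)
  have := fin 2 (by rw [f2]; omega)
  have r0 : Module.finrank ℚ (LinearMap.range ((complex k).boundary ℚ 0)) +
      Module.finrank ℚ (LinearMap.ker ((complex k).boundary ℚ 0)) = (complex k).faceNumber 1 :=
    (LinearMap.finrank_range_add_finrank_ker _).trans (finrank_chain k 1)
  have r1 : Module.finrank ℚ (LinearMap.range ((complex k).boundary ℚ 1)) +
      Module.finrank ℚ (LinearMap.ker ((complex k).boundary ℚ 1)) = (complex k).faceNumber 2 :=
    (LinearMap.finrank_range_add_finrank_ker _).trans (finrank_chain k 2)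
  obtain ⟨ε⟩ := nonempty_homology_zero ℚ k
  have h0 : 1 + Module.finrank ℚ (LinearMap.range ((complex k).boundary ℚ 0)) =
      (complex k).faceNumber 0 := by
    have h := Submodule.finrank_quotient_add_finrank
      ((LinearMap.range ((complex k).boundary ℚ 0)).submoduleOf ((complex k).cycles ℚ 0))
    have hq : Module.finrank ℚ (Subquotient ((complex k).cycles ℚ 0)
        (LinearMap.range ((complex k).boundary ℚ 0))) = 1 :=
      ε.finrank_eq.trans (Module.finrank_self ℚ)
    rw [hq, (Submodule.submoduleOfEquivOfLe
      ((complex k).range_boundary_le_cycles ℚ 0)).finrank_eq] at h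
    exact h.trans ((finrank_top ℚ _).trans (finrank_chain k 0))
  have h1 : LinearMap.range ((complex k).boundary ℚ 1) =
      LinearMap.ker ((complex k).boundary ℚ 0) := by
    refine le_antisymm ((complex k).range_boundary_le_cycles ℚ 1) fun z hz => ?_
    have hs := subsingleton_homology_one_rat hk
    let B := (LinearMap.range ((complex k).boundary ℚ 1)).submoduleOf ((complex k).cycles ℚ 1)
    have hz' : B.mkQ ⟨z, hz⟩ = 0 := Subsingleton.elim (α := (complex k).Homology ℚ 1) _ _
    rw [Submodule.mkQ_apply, Submodule.Quotient.mk_eq_zero] at hz'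
    exact hz'
  have h2 : Module.finrank ℚ (LinearMap.range ((complex k).boundary ℚ 1)) =
      Module.finrank ℚ (LinearMap.ker ((complex k).boundary ℚ 0)) := by
    rw [h1]
  rw [← Submodule.finrank_eq_zero (R := ℚ)]
  omega

/-- Integral chains embed into rational chains, so the integral boundary map is injective as
well. -/
theorem ker_boundary_one_int {k : ℕ} (hk : 1 ≤ k) :
    LinearMap.ker ((complex k).boundary ℤ 1) = ⊥ := by
  let ι (d : ℕ) : (complex k).Chain ℤ d →+ (complex k).Chain ℚ d :=
    Finsupp.mapRange.addMonoidHom (Int.castAddHom ℚ)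
  have hι : ∀ z, (complex k).boundary ℚ 1 (ι 2 z) = ι 1 ((complex k).boundary ℤ 1 z) := by
    intro z
    induction z using Finsupp.induction_linear with
    | zero => simp
    | add y z hy hz => simp only [map_add, hy, hz]
    | single s r =>
      simp only [ι, boundary, Finsupp.mapRange.addMonoidHom_apply, Finsupp.mapRange_single,
        Finsupp.linearCombination_single, Finset.smul_sum, Finsupp.smul_single,
        Finsupp.mapRange_finsetSum]
      exact Finset.sum_congr rfl fun u _ => by simp
  rw [LinearMap.ker_eq_bot']
  intro z hz
  have h1 : ι 2 z ∈ LinearMap.ker ((complex k).boundary ℚ 1) := by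
    rw [LinearMap.mem_ker, hι, hz, map_zero]
  rw [ker_boundary_one_rat hk, Submodule.mem_bot] at h1
  exact Finsupp.mapRange_injective _ Int.cast_zero Int.cast_injective
    (h1.trans (map_zero (ι 2)).symm)

theorem subsingleton_homology {R : Type*} [CommRing R] {k : ℕ}
    (h : LinearMap.ker ((complex k).boundary R 1) = ⊥) {d : ℕ} (hd : 2 ≤ d) :
    Subsingleton ((complex k).Homology R d) := by
  obtain ⟨d, rfl⟩ := Nat.exists_eq_add_of_le' hd
  refine subsingleton_homology_of_cycles_eq_bot ?_
  cases d with
  | zero => exact h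
  | succ d =>
    have := isEmpty_simplex k (d := d + 1 + 2) (by omega)
    exact Subsingleton.elim _ _

theorem isRationallyAcyclic {k : ℕ} (hk : 1 ≤ k) : (complex k).IsRationallyAcyclic := by
  refine ⟨nonempty_homology_zero ℚ k, fun d hd => ?_⟩
  rcases hd.eq_or_lt with rfl | hd
  · exact subsingleton_homology_one_rat hk
  · exact subsingleton_homology (ker_boundary_one_rat hk) hd

end HMT

/-! ### Running times of programs for the word RAM -/

namespace WordRAM

/-- With word bound `B`, the program `P` started in `s` halts after at most `T` steps in a
configuration that satisfies `Q`. -/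
def Runs (B : ℕ) (P : Program) (s : State) (T : ℕ) (Q : State → Prop) : Prop :=
  ∃ t s', t ≤ T ∧ Exec B P s t s' ∧ Q s'

theorem State.reg_setReg (s : State) (x a y : ℕ) :
    (s.setReg x a).reg y = if y = x then a else s.reg y := by
  simp [State.setReg, Function.update_apply]

theorem State.mem_setReg (s : State) (x a : ℕ) : (s.setReg x a).mem = s.mem := rfl

theorem State.out_setReg (s : State) (x a : ℕ) : (s.setReg x a).out = s.out := rfl

theorem State.reg_setMem (s : State) (x a : ℕ) : (s.setMem x a).reg = s.reg := rfl

theorem State.mem_setMem (s : State) (x a y : ℕ) :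
    (s.setMem x a).mem y = if y = x then a else s.mem y := by
  simp [State.setMem, Function.update_apply]

/-- Append `a` to the output. -/
def State.append (s : State) (a : ℕ) : State := { s with out := s.out ++ [a] }

theorem State.reg_append (s : State) (a : ℕ) : (s.append a).reg = s.reg := rfl

theorem State.mem_append (s : State) (a : ℕ) : (s.append a).mem = s.mem := rfl

theorem State.out_append (s : State) (a : ℕ) : (s.append a).out = s.out ++ [a] := rfl

variable {B T T' : ℕ} {P P' : Program} {s : State} {Q Q' : State → Prop}

theorem Runs.seq (h : Runs B P s T Q) (h' : ∀ s', Q s' → Runs B P' s' T' Q') :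
    Runs B (.seq P P') s (T + T') Q' := by
  obtain ⟨t, s', ht, he, hq⟩ := h
  obtain ⟨t', s'', ht', he', hq'⟩ := h' s' hq
  exact ⟨t + t', s'', add_le_add ht ht', he.seq he', hq'⟩

theorem Runs.arith {x y z : ℕ} {op : Op} (a : ℕ) (ha : op.eval (s.reg y) (s.reg z) = a)
    (hB : a ≤ B) (h : Q (s.setReg x a)) : Runs B (.arith x op y z) s 1 Q := by
  subst ha
  exact ⟨1, _, le_rfl, .arith x op y z s hB, h⟩

theorem Runs.const_seq {x : ℕ} (a : ℕ) (hB : a ≤ B) (h : Runs B P (s.setReg x a) T Q) :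
    Runs B (.seq (.const x a) P) s (T + 1) Q := by
  obtain ⟨t, s', ht, he, hq⟩ := h
  exact ⟨1 + t, s', by omega, (Exec.const x a s hB).seq he, hq⟩

theorem Runs.arith_seq {x y z : ℕ} {op : Op} (a : ℕ) (ha : op.eval (s.reg y) (s.reg z) = a)
    (hB : a ≤ B) (h : Runs B P (s.setReg x a) T Q) :
    Runs B (.seq (.arith x op y z) P) s (T + 1) Q := by
  subst ha
  obtain ⟨t, s', ht, he, hq⟩ := h
  exact ⟨1 + t, s', by omega, (Exec.arith x op y z s hB).seq he, hq⟩

theorem Runs.load_seq {x y : ℕ} (a : ℕ) (ha : s.mem (s.reg y) = a)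
    (h : Runs B P (s.setReg x a) T Q) : Runs B (.seq (.load x y) P) s (T + 1) Q := by
  subst ha
  obtain ⟨t, s', ht, he, hq⟩ := h
  exact ⟨1 + t, s', by omega, (Exec.load x y s).seq he, hq⟩

theorem Runs.store_seq {x y : ℕ} (b a : ℕ) (hb : s.reg x = b) (ha : s.reg y = a)
    (h : Runs B P (s.setMem b a) T Q) : Runs B (.seq (.store x y) P) s (T + 1) Q := by
  subst ha hb
  obtain ⟨t, s', ht, he, hq⟩ := h
  exact ⟨1 + t, s', by omega, (Exec.store x y s).seq he, hq⟩

theorem Runs.write_seq {x : ℕ} (a : ℕ) (ha : s.reg x = a) (h : Runs B P (s.append a) T Q) :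
    Runs B (.seq (.write x) P) s (T + 1) Q := by
  subst ha
  obtain ⟨t, s', ht, he, hq⟩ := h
  exact ⟨1 + t, s', by omega, (Exec.write x s).seq he, hq⟩

/-- A loop whose `m`-th pass leads from the invariant `I m` to `I (m + 1)`, and which stops after
`N` passes. -/
theorem Runs.loop {x N : ℕ} (I : ℕ → State → Prop)
    (hstep : ∀ m < N, ∀ s, I m s → s.reg x ≠ 0 ∧ Runs B P s T (I (m + 1)))
    (hend : ∀ s, I N s → s.reg x = 0) (h0 : I 0 s) :
    Runs B (.loop x P) s (N * (T + 1) + 1) (I N) := by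
  have key : ∀ d m s, m + d = N → I m s → Runs B (.loop x P) s (d * (T + 1) + 1) (I N) := by
    intro d
    induction d with
    | zero =>
      intro m s hm hI
      obtain rfl : m = N := by omega
      exact ⟨1, s, by omega, by constructor; exact hend s hI, hI⟩
    | succ d ih =>
      intro m s hm hI
      obtain ⟨hx, t, s', ht, he, hI'⟩ := hstep m (by omega) s hI
      obtain ⟨t', s'', ht', he', hq⟩ := ih (m + 1) s' (by omega) hI'
      refine ⟨t + t' + 1, s'', ?_, .loop_step hx he he', hq⟩
      rw [Nat.succ_mul]
      omega
  exact key N 0 s (zero_add N) h0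

/-- Every number of the output takes a step to write. -/
theorem Exec.length_out_le {t : ℕ} {s' : State} (h : Exec B P s t s') :
    s'.out.length ≤ s.out.length + t := by
  induction h with
  | write x s => simp
  | seq _ _ ih ih' => omega
  | ite_true _ _ ih => omega
  | ite_false _ _ ih => omega
  | loop_step _ _ _ ih ih' => omega
  | _ => simp [State.setReg, State.setMem]

end WordRAM

/-! ### The algorithm -/

namespace HMT

open WordRAM

/-- The entry in row `i` and column `j` of the table that the algorithm starts with: it encodes the
sum of `i` and `j` in binary without carry, and the sign of the entry of the Hadamard matrix. -/
def tableEntry (k i j : ℕ) : ℕ := 2 * (i ^^^ j) + if hadamard k i j = 1 then 0 else 1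

/-- The entry in row `i` and column `j` in terms of the entry in row `i / 2` and column `j / 2`. -/
theorem tableEntry_eq {k i j : ℕ} (hi : i < 2 ^ k) (hj : j < 2 ^ k) :
    tableEntry k i j = (tableEntry k (i / 2) (j / 2) / 2 * 2 + (i + j) % 2) * 2 +
      (tableEntry k (i / 2) (j / 2) + i * j) % 2 := by
  have h1 : (i ^^^ j) / 2 = i / 2 ^^^ j / 2 := Nat.xor_div_two
  have h2 : (i ^^^ j) % 2 = (i + j) % 2 := by
    rw [Nat.xor_mod_two_eq]
  have h3 := hadamard_eq_one_or k (i / 2) (j / 2)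
  have h4 : i * j % 2 = if i % 2 = 1 ∧ j % 2 = 1 then 1 else 0 := by
    rcases Nat.mod_two_eq_zero_or_one i with h | h <;>
      rcases Nat.mod_two_eq_zero_or_one j with h' | h' <;> simp [Nat.mul_mod, h, h']
  unfold tableEntry
  rw [hadamard_eq_div_two hi hj, ← h1]
  generalize i * j = q at *
  generalize i ^^^ j = e at *
  split_ifs at h4 with h5
  · rw [if_pos h5]
    rcases h3 with h3 | h3 <;> simp [h3] <;> omega
  · rw [if_neg h5]
    rcases h3 with h3 | h3 <;> simp [h3] <;> omega

/-- Compute the constants. -/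
def setup : Program :=
  .seq (.const 1 1) <| .seq (.const 2 2) <| .seq (.arith 3 .mul 0 0) <| .seq (.arith 4 .mul 2 0) <|
  .seq (.arith 12 .add 4 4) <| .seq (.arith 12 .add 12 1) <| .seq (.const 13 0) <|
  .arith 14 .sub 0 1

/-- Fill one entry of the first table, by `tableEntry_eq`. -/
def tableBody : Program :=
  .seq (.arith 7 .div 5 0) <| .seq (.arith 8 .mod 5 0) <| .seq (.arith 9 .div 7 2) <|
  .seq (.arith 9 .mul 9 0) <| .seq (.arith 10 .div 8 2) <| .seq (.arith 9 .add 9 10) <|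
  .seq (.load 9 9) <| .seq (.arith 10 .mul 7 8) <| .seq (.arith 10 .add 9 10) <|
  .seq (.arith 10 .mod 10 2) <| .seq (.arith 7 .add 7 8) <| .seq (.arith 7 .mod 7 2) <|
  .seq (.arith 9 .div 9 2) <| .seq (.arith 9 .mul 9 2) <| .seq (.arith 9 .add 9 7) <|
  .seq (.arith 9 .mul 9 2) <| .seq (.arith 9 .add 9 10) <| .seq (.store 5 9) <|
  .seq (.arith 5 .add 5 1) <| .arith 6 .sub 3 5

/-- The contents of the registers that stay constant. Of the others, register `5` counts the passes
of a loop, register `6` holds the number of passes that are left, and the registers `7` to `11`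
serve intermediate results. -/
structure Constants (n : ℕ) (s : State) : Prop where
  r0 : s.reg 0 = n
  r1 : s.reg 1 = 1
  r2 : s.reg 2 = 2
  r3 : s.reg 3 = n * n
  r4 : s.reg 4 = 2 * n
  r12 : s.reg 12 = 4 * n + 1
  r13 : s.reg 13 = 0
  r14 : s.reg 14 = n - 1

/-- The invariant of the loop that fills the first table. -/
structure TableInv (k n m : ℕ) (s : State) : Prop where
  const : Constants n s
  r5 : s.reg 5 = m
  r6 : s.reg 6 = n * n - m
  mem : ∀ a, s.mem a = if a < m then tableEntry k (a / n) (a % n) else 0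
  out : s.out = []

theorem tableEntry_lt {k i j : ℕ} (hi : i < 2 ^ k) (hj : j < 2 ^ k) :
    tableEntry k i j < 2 * 2 ^ k := by
  have : i ^^^ j < 2 ^ k := Nat.xor_lt_two_pow hi hj
  unfold tableEntry
  split_ifs <;> omega

theorem runs_tableBody {k n B m : ℕ} (hn : n = 2 ^ k) (hB : 16 * (n * n) ≤ B) (hm : m < n * n)
    {s : State} (h : TableInv k n m s) :
    s.reg 6 ≠ 0 ∧ Runs B tableBody s 20 (TableInv k n (m + 1)) := by
  have hn0 : 0 < n := by rw [hn]; positivity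
  obtain ⟨⟨h0, h1, h2, h3, h4, h12, h13, h14⟩, h5, h6, hmem, hout⟩ := h
  refine ⟨by omega, ?_⟩
  obtain ⟨i, hi⟩ : ∃ i, m / n = i := ⟨_, rfl⟩
  obtain ⟨j, hj⟩ : ∃ j, m % n = j := ⟨_, rfl⟩
  have hi' : i < n := by rw [← hi]; exact Nat.div_lt_of_lt_mul hm
  have hj' : j < n := by rw [← hj]; exact Nat.mod_lt _ hn0
  have hmij : i * n + j = m := by rw [← hi, ← hj]; exact Nat.div_add_mod' m n
  have b1 : n ≤ n * n := Nat.le_mul_self n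
  have b2 : i * j ≤ n * n := Nat.mul_le_mul hi'.le hj'.le
  have b3 : i / 2 * n ≤ i * n := Nat.mul_le_mul_right n (Nat.div_le_self i 2)
  have ha : s.mem (i / 2 * n + j / 2) = tableEntry k (i / 2) (j / 2) := by
    rw [hmem]
    split_ifs with h
    · congr 1
      · rw [mul_comm, Nat.mul_add_div hn0, Nat.div_eq_of_lt (show j / 2 < n by omega), add_zero]
      · rw [mul_comm, Nat.mul_add_mod, Nat.mod_eq_of_lt (show j / 2 < n by omega)]
    · -- Only the first pass reads the entry that it is about to write, namely the right entry `0`.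
      have hi0 : i = 0 := by
        by_contra hi0
        have : (i / 2 + 1) * n ≤ i * n := Nat.mul_le_mul_right n (by omega)
        rw [add_mul] at this
        omega
      subst hi0
      obtain rfl : j = 0 := by omega
      simp [tableEntry, hadamard_zero_left]
  have hlt : tableEntry k (i / 2) (j / 2) < 2 * n := by
    rw [hn] at hi' hj' ⊢
    exact tableEntry_lt (by omega) (by omega)
  have hres := tableEntry_eq (k := k) (i := i) (j := j) (by omega) (by omega)
  generalize tableEntry k (i / 2) (j / 2) = a at *
  unfold tableBody
  refine Runs.arith_seq i (by simp [Op.eval, h5, h0, hi]) (by omega) ?_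
  refine Runs.arith_seq j (by simp [Op.eval, State.reg_setReg, h5, h0, hj]) (by omega) ?_
  refine Runs.arith_seq (i / 2) (by simp [Op.eval, State.reg_setReg, h2]) (by omega) ?_
  refine Runs.arith_seq (i / 2 * n) (by simp [Op.eval, State.reg_setReg, h0]) (by omega) ?_
  refine Runs.arith_seq (j / 2) (by simp [Op.eval, State.reg_setReg, h2]) (by omega) ?_
  refine Runs.arith_seq (i / 2 * n + j / 2) (by simp [Op.eval, State.reg_setReg]) (by omega) ?_
  refine Runs.load_seq a (by simp [State.reg_setReg, State.mem_setReg, ha]) ?_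
  refine Runs.arith_seq (i * j) (by simp [Op.eval, State.reg_setReg]) (by omega) ?_
  refine Runs.arith_seq (a + i * j) (by simp [Op.eval, State.reg_setReg]) (by omega) ?_
  refine Runs.arith_seq ((a + i * j) % 2) (by simp [Op.eval, State.reg_setReg, h2]) (by omega) ?_
  refine Runs.arith_seq (i + j) (by simp [Op.eval, State.reg_setReg]) (by omega) ?_
  refine Runs.arith_seq ((i + j) % 2) (by simp [Op.eval, State.reg_setReg, h2]) (by omega) ?_
  refine Runs.arith_seq (a / 2) (by simp [Op.eval, State.reg_setReg, h2]) (by omega) ?_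
  refine Runs.arith_seq (a / 2 * 2) (by simp [Op.eval, State.reg_setReg, h2]) (by omega) ?_
  refine Runs.arith_seq (a / 2 * 2 + (i + j) % 2) (by simp [Op.eval, State.reg_setReg])
    (by omega) ?_
  refine Runs.arith_seq ((a / 2 * 2 + (i + j) % 2) * 2) (by simp [Op.eval, State.reg_setReg, h2])
    (by omega) ?_
  refine Runs.arith_seq (tableEntry k i j) (by simp [Op.eval, State.reg_setReg, hres])
    (by omega) ?_
  refine Runs.store_seq m (tableEntry k i j) (by simp [State.reg_setReg, h5])
    (by simp [State.reg_setReg]) ?_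
  refine Runs.arith_seq (m + 1) (by simp [Op.eval, State.reg_setReg, State.reg_setMem, h5, h1])
    (by omega) ?_
  refine Runs.arith (n * n - (m + 1)) (by simp [Op.eval, State.reg_setReg, State.reg_setMem, h3])
    (by omega) ?_
  constructor
  · constructor <;> simp [State.reg_setReg, State.reg_setMem, *]
  · simp [State.reg_setReg]
  · simp [State.reg_setReg]
  · intro b
    simp only [State.mem_setReg, State.mem_setMem]
    by_cases hb : b = m
    · rw [if_pos hb, if_pos (by omega), hb, hi, hj]
    · rw [if_neg hb, hmem]
      exact if_congr (by omega) rfl rfl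
  · exact hout

/-- Fill one entry of the second table, by `tau_eq_tableEntry` and `cycleIndex_eq_tableEntry`. The
second table begins at the address `n ^ 2`. -/
def vertexBody : Program :=
  .seq (.arith 7 .div 5 0) <| .seq (.arith 8 .mod 5 0) <| .seq (.arith 9 .mod 8 2) <|
  .seq (.arith 10 .div 7 2) <| .seq (.arith 10 .mul 10 9) <| .seq (.arith 10 .mul 10 0) <|
  .seq (.arith 11 .div 8 2) <| .seq (.arith 10 .add 10 11) <| .seq (.load 10 10) <|
  .seq (.arith 10 .div 10 2) <| .seq (.arith 10 .mul 10 2) <| .seq (.arith 10 .add 10 9) <|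
  .seq (.arith 7 .mul 7 0) <| .seq (.arith 7 .add 7 10) <| .seq (.load 7 7) <|
  .seq (.arith 7 .mod 7 2) <| .seq (.arith 7 .mul 7 0) <| .seq (.arith 10 .add 10 7) <|
  .seq (.arith 10 .mul 10 2) <| .seq (.arith 10 .add 10 1) <| .seq (.arith 7 .add 3 5) <|
  .seq (.store 7 10) <| .seq (.arith 5 .add 5 1) <| .arith 6 .sub 3 5

/-- The vertex `x_{ij}^1` for `j = τ_i^p`. -/
def vertexEntry (k i p : ℕ) : ℕ := v (cycleIndex k i (tau k i p)) 0

/-- The invariant of the loop that fills the second table. -/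
structure VertexInv (k n m : ℕ) (s : State) : Prop where
  const : Constants n s
  r5 : s.reg 5 = m
  r6 : s.reg 6 = n * n - m
  mem : ∀ a < n * n, s.mem a = tableEntry k (a / n) (a % n)
  mem' : ∀ a < m, s.mem (n * n + a) = vertexEntry k (a / n) (a % n)
  out : s.out = []

/-- Multiplication by `p % 2` merges the two parities of `p`: in row `0`, the table gives
`p / 2`. -/
theorem tau_eq_tableEntry {k i p : ℕ} (hi : i < 2 ^ k) (hp : p < 2 ^ k) :
    tau k i p = tableEntry k (i / 2 * (p % 2)) (p / 2) / 2 * 2 + p % 2 := by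
  have h : tableEntry k (i / 2 * (p % 2)) (p / 2) / 2 = (i / 2 * (p % 2)) ^^^ (p / 2) := by
    unfold tableEntry
    split_ifs <;> omega
  rw [h, tau_eq hi hp]
  rcases Nat.mod_two_eq_zero_or_one p with h' | h'
  · rw [if_pos h', h', mul_zero, Nat.zero_xor]
    omega
  · rw [if_neg (by omega), h', mul_one, Nat.xor_comm]
    omega

theorem cycleIndex_eq_tableEntry (k i j : ℕ) :
    cycleIndex k i j = j + tableEntry k i j % 2 * 2 ^ k := by
  unfold cycleIndex tableEntry
  split_ifs
  · rw [show (2 * (i ^^^ j) + 0) % 2 = 0 by omega]; ring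
  · rw [show (2 * (i ^^^ j) + 1) % 2 = 1 by omega]; ring

theorem div_and_mod_of_lt {n i j : ℕ} (hj : j < n) : (i * n + j) / n = i ∧ (i * n + j) % n = j := by
  have hn : 0 < n := by omega
  rw [mul_comm, Nat.mul_add_div hn, Nat.div_eq_of_lt hj, Nat.mul_add_mod, Nat.mod_eq_of_lt hj]
  simp

theorem mul_add_lt {n i j : ℕ} (hi : i < n) (hj : j < n) : i * n + j < n * n := by
  have : (i + 1) * n ≤ n * n := Nat.mul_le_mul_right n hi
  rw [add_mul] at this
  omega

theorem runs_vertexBody {k n B m : ℕ} (hn : n = 2 ^ k) (hB : 16 * (n * n) ≤ B) (hm : m < n * n)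
    {s : State} (h : VertexInv k n m s) :
    s.reg 6 ≠ 0 ∧ Runs B vertexBody s 24 (VertexInv k n (m + 1)) := by
  have hn0 : 0 < n := by rw [hn]; positivity
  obtain ⟨⟨h0, h1, h2, h3, h4, h12, h13, h14⟩, h5, h6, hmem, hmem', hout⟩ := h
  refine ⟨by omega, ?_⟩
  obtain ⟨i, hi⟩ : ∃ i, m / n = i := ⟨_, rfl⟩
  obtain ⟨p, hp⟩ : ∃ p, m % n = p := ⟨_, rfl⟩
  have hi' : i < n := by rw [← hi]; exact Nat.div_lt_of_lt_mul hm
  have hp' : p < n := by rw [← hp]; exact Nat.mod_lt _ hn0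
  have b1 : n ≤ n * n := Nat.le_mul_self n
  have hq : i / 2 * (p % 2) < n := by
    rcases Nat.mod_two_eq_zero_or_one p with h | h <;> rw [h] <;> omega
  have hp2 : p / 2 < n := by omega
  have b2 := mul_add_lt hq hp2
  have ht : tau k i p < n := by rw [hn] at hi' hp' ⊢; exact tau_lt hi' hp'
  have b3 := mul_add_lt hi' ht
  have ha : s.mem (i / 2 * (p % 2) * n + p / 2) = tableEntry k (i / 2 * (p % 2)) (p / 2) := by
    rw [hmem _ b2, (div_and_mod_of_lt hp2).1, (div_and_mod_of_lt hp2).2]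
  have hb : s.mem (i * n + tau k i p) = tableEntry k i (tau k i p) := by
    rw [hmem _ b3, (div_and_mod_of_lt ht).1, (div_and_mod_of_lt ht).2]
  have hta := tau_eq_tableEntry (k := k) (i := i) (p := p) (by omega) (by omega)
  have hc := cycleIndex_eq_tableEntry k i (tau k i p)
  have hcl : cycleIndex k i (tau k i p) < 2 * n := by
    rw [hn] at ht ⊢; exact cycleIndex_lt i ht
  have hv : cycleIndex k i (tau k i p) * 2 + 1 = vertexEntry k i p := by
    rw [vertexEntry, v]; ring
  have hlt : tableEntry k (i / 2 * (p % 2)) (p / 2) < 2 * n := by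
    rw [hn] at hq hp2 ⊢
    exact tableEntry_lt hq hp2
  rw [← hn] at hc
  generalize tableEntry k (i / 2 * (p % 2)) (p / 2) = a at *
  generalize tau k i p = t at *
  have hbl : tableEntry k i t < 2 * n := by
    rw [hn] at hi' ht ⊢
    exact tableEntry_lt hi' ht
  generalize tableEntry k i t = b at *
  generalize cycleIndex k i t = u at *
  unfold vertexBody
  refine Runs.arith_seq i (by simp [Op.eval, h5, h0, hi]) (by omega) ?_
  refine Runs.arith_seq p (by simp [Op.eval, State.reg_setReg, h5, h0, hp]) (by omega) ?_
  refine Runs.arith_seq (p % 2) (by simp [Op.eval, State.reg_setReg, h2]) (by omega) ?_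
  refine Runs.arith_seq (i / 2) (by simp [Op.eval, State.reg_setReg, h2]) (by omega) ?_
  refine Runs.arith_seq (i / 2 * (p % 2)) (by simp [Op.eval, State.reg_setReg]) (by omega) ?_
  refine Runs.arith_seq (i / 2 * (p % 2) * n) (by simp [Op.eval, State.reg_setReg, h0])
    (by omega) ?_
  refine Runs.arith_seq (p / 2) (by simp [Op.eval, State.reg_setReg, h2]) (by omega) ?_
  refine Runs.arith_seq (i / 2 * (p % 2) * n + p / 2) (by simp [Op.eval, State.reg_setReg])
    (by omega) ?_
  refine Runs.load_seq a (by simp [State.reg_setReg, State.mem_setReg, ha]) ?_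
  refine Runs.arith_seq (a / 2) (by simp [Op.eval, State.reg_setReg, h2]) (by omega) ?_
  refine Runs.arith_seq (a / 2 * 2) (by simp [Op.eval, State.reg_setReg, h2]) (by omega) ?_
  refine Runs.arith_seq t (by simp [Op.eval, State.reg_setReg, hta]) (by omega) ?_
  refine Runs.arith_seq (i * n) (by simp [Op.eval, State.reg_setReg, h0]) (by omega) ?_
  refine Runs.arith_seq (i * n + t) (by simp [Op.eval, State.reg_setReg]) (by omega) ?_
  refine Runs.load_seq b (by simp [State.reg_setReg, State.mem_setReg, hb]) ?_
  refine Runs.arith_seq (b % 2) (by simp [Op.eval, State.reg_setReg, h2]) (by omega) ?_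
  refine Runs.arith_seq (b % 2 * n) (by simp [Op.eval, State.reg_setReg, h0]) (by omega) ?_
  refine Runs.arith_seq u (by simp [Op.eval, State.reg_setReg, hc]) (by omega) ?_
  refine Runs.arith_seq (u * 2) (by simp [Op.eval, State.reg_setReg, h2]) (by omega) ?_
  refine Runs.arith_seq (vertexEntry k i p) (by simp [Op.eval, State.reg_setReg, h1, hv])
    (by omega) ?_
  refine Runs.arith_seq (n * n + m) (by simp [Op.eval, State.reg_setReg, h3, h5]) (by omega) ?_
  refine Runs.store_seq (n * n + m) (vertexEntry k i p) (by simp [State.reg_setReg])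
    (by simp [State.reg_setReg]) ?_
  refine Runs.arith_seq (m + 1) (by simp [Op.eval, State.reg_setReg, State.reg_setMem, h5, h1])
    (by omega) ?_
  refine Runs.arith (n * n - (m + 1)) (by simp [Op.eval, State.reg_setReg, State.reg_setMem, h3])
    (by omega) ?_
  constructor
  · constructor <;> simp [State.reg_setReg, State.reg_setMem, *]
  · simp [State.reg_setReg]
  · simp [State.reg_setReg]
  · intro b hb
    simp only [State.mem_setReg, State.mem_setMem]
    rw [if_neg (by omega), hmem b hb]
  · intro b hb
    simp only [State.mem_setReg, State.mem_setMem]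
    by_cases hbm : b = m
    · rw [if_pos (by omega), hbm, hi, hp]
    · rw [if_neg (by omega), hmem' b (by omega)]
  · exact hout

/-- List the three facets in one position of a disc. -/
def discBody : Program :=
  .seq (.arith 7 .div 5 0) <| .seq (.arith 8 .add 12 7) <| .seq (.arith 9 .add 3 5) <|
  .seq (.load 9 9) <| .seq (.arith 10 .add 9 1) <| .seq (.arith 11 .add 5 1) <|
  .seq (.arith 11 .mod 11 0) <| .seq (.arith 7 .mul 7 0) <| .seq (.arith 7 .add 7 11) <|
  .seq (.arith 7 .add 3 7) <| .seq (.load 7 7) <|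
  .seq (.write 13) <| .seq (.write 10) <| .seq (.write 7) <|
  .seq (.write 8) <| .seq (.write 9) <| .seq (.write 10) <|
  .seq (.write 8) <| .seq (.write 10) <| .seq (.write 7) <|
  .seq (.arith 5 .add 5 1) <| .arith 6 .sub 3 5

/-- The numbers that encode a list of triples. -/
def encode (L : List (ℕ × ℕ × ℕ)) : List ℕ := L.flatMap fun t => [t.1, t.2.1, t.2.2]

theorem encode_append (L L' : List (ℕ × ℕ × ℕ)) : encode (L ++ L') = encode L ++ encode L' :=
  List.flatMap_append

/-- The invariant of the loop that lists the facets of the discs. -/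
structure DiscInv (k n m : ℕ) (s : State) : Prop where
  const : Constants n s
  r5 : s.reg 5 = m
  r6 : s.reg 6 = n * n - m
  mem : ∀ a < n * n, s.mem (n * n + a) = vertexEntry k (a / n) (a % n)
  out : s.out = encode ((List.range m).flatMap fun m => discFacets k (m / n) (m % n))

theorem runs_discBody {k n B m : ℕ} (hn : n = 2 ^ k) (hB : 16 * (n * n) ≤ B) (hm : m < n * n)
    {s : State} (h : DiscInv k n m s) :
    s.reg 6 ≠ 0 ∧ Runs B discBody s 22 (DiscInv k n (m + 1)) := by
  have hn0 : 0 < n := by rw [hn]; positivity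
  obtain ⟨⟨h0, h1, h2, h3, h4, h12, h13, h14⟩, h5, h6, hmem, hout⟩ := h
  refine ⟨by omega, ?_⟩
  obtain ⟨i, hi⟩ : ∃ i, m / n = i := ⟨_, rfl⟩
  obtain ⟨p, hp⟩ : ∃ p, m % n = p := ⟨_, rfl⟩
  have hi' : i < n := by rw [← hi]; exact Nat.div_lt_of_lt_mul hm
  have hp' : p < n := by rw [← hp]; exact Nat.mod_lt _ hn0
  obtain ⟨q, hq⟩ : ∃ q, (p + 1) % n = q := ⟨_, rfl⟩
  have hq' : q < n := by rw [← hq]; exact Nat.mod_lt _ hn0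
  have hmq : (m + 1) % n = q := by rw [← hq, ← hp, Nat.mod_add_mod]
  have b1 : n ≤ n * n := Nat.le_mul_self n
  have b2 := mul_add_lt hi' hq'
  have ha : s.mem (n * n + m) = vertexEntry k i p := by rw [hmem m hm, hi, hp]
  have hb : s.mem (n * n + (i * n + q)) = vertexEntry k i q := by
    rw [hmem _ b2, (div_and_mod_of_lt hq').1, (div_and_mod_of_lt hq').2]
  have hout' : encode ((List.range (m + 1)).flatMap fun m => discFacets k (m / n) (m % n)) =
      s.out ++ [0, vertexEntry k i p + 1, vertexEntry k i q, 4 * n + 1 + i, vertexEntry k i p,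
        vertexEntry k i p + 1, 4 * n + 1 + i, vertexEntry k i p + 1, vertexEntry k i q] := by
    rw [List.range_succ, List.flatMap_append, encode_append, hout]
    congr 1
    simp only [List.flatMap_cons, List.flatMap_nil, List.append_nil, discFacets, encode, hi, hp,
      ← hn, hq, vertexEntry, List.cons_append, List.nil_append, c]
    rw [add_comm 1 (4 * n)]
    rfl
  have hal : vertexEntry k i p < 4 * n := by
    have := cycleIndex_lt i (tau_lt (k := k) (i := i) (p := p) (by omega) (by omega))
    unfold vertexEntry v
    omega
  generalize vertexEntry k i p = a at *
  generalize vertexEntry k i q = b at *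
  unfold discBody
  refine Runs.arith_seq i (by simp [Op.eval, h5, h0, hi]) (by omega) ?_
  refine Runs.arith_seq (4 * n + 1 + i) (by simp [Op.eval, State.reg_setReg, h12]) (by omega) ?_
  refine Runs.arith_seq (n * n + m) (by simp [Op.eval, State.reg_setReg, h3, h5]) (by omega) ?_
  refine Runs.load_seq a (by simp [State.reg_setReg, State.mem_setReg, ha]) ?_
  refine Runs.arith_seq (a + 1) (by simp [Op.eval, State.reg_setReg, h1]) (by omega) ?_
  refine Runs.arith_seq (m + 1) (by simp [Op.eval, State.reg_setReg, h5, h1]) (by omega) ?_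
  refine Runs.arith_seq q (by simp [Op.eval, State.reg_setReg, h0, hmq]) (by omega) ?_
  refine Runs.arith_seq (i * n) (by simp [Op.eval, State.reg_setReg, h0]) (by omega) ?_
  refine Runs.arith_seq (i * n + q) (by simp [Op.eval, State.reg_setReg]) (by omega) ?_
  refine Runs.arith_seq (n * n + (i * n + q)) (by simp [Op.eval, State.reg_setReg, h3])
    (by omega) ?_
  refine Runs.load_seq b (by simp [State.reg_setReg, State.mem_setReg, hb]) ?_
  refine Runs.write_seq 0 (by simp [State.reg_setReg, h13]) ?_
  refine Runs.write_seq (a + 1) (by simp [State.reg_setReg, State.reg_append]) ?_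
  refine Runs.write_seq b (by simp [State.reg_setReg, State.reg_append]) ?_
  refine Runs.write_seq (4 * n + 1 + i) (by simp [State.reg_setReg, State.reg_append]) ?_
  refine Runs.write_seq a (by simp [State.reg_setReg, State.reg_append]) ?_
  refine Runs.write_seq (a + 1) (by simp [State.reg_setReg, State.reg_append]) ?_
  refine Runs.write_seq (4 * n + 1 + i) (by simp [State.reg_setReg, State.reg_append]) ?_
  refine Runs.write_seq (a + 1) (by simp [State.reg_setReg, State.reg_append]) ?_
  refine Runs.write_seq b (by simp [State.reg_setReg, State.reg_append]) ?_
  refine Runs.arith_seq (m + 1) (by simp [Op.eval, State.reg_setReg, State.reg_append, h5, h1])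
    (by omega) ?_
  refine Runs.arith (n * n - (m + 1)) (by simp [Op.eval, State.reg_setReg, State.reg_append, h3])
    (by omega) ?_
  constructor
  · constructor <;> simp [State.reg_setReg, State.reg_append, *]
  · simp [State.reg_setReg]
  · simp [State.reg_setReg]
  · exact hmem
  · rw [hout']
    simp [State.out_setReg, State.out_append]

/-- List the four facets of a digon. The count goes up first, as the digons belong to the columns
from `1` on. -/
def digonBody : Program :=
  .seq (.arith 5 .add 5 1) <| .seq (.arith 7 .mul 5 2) <| .seq (.arith 7 .add 7 1) <|
  .seq (.arith 8 .add 7 1) <| .seq (.arith 9 .add 7 4) <| .seq (.arith 10 .add 8 4) <|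
  .seq (.write 13) <| .seq (.write 7) <| .seq (.write 10) <|
  .seq (.write 7) <| .seq (.write 8) <| .seq (.write 10) <|
  .seq (.write 8) <| .seq (.write 9) <| .seq (.write 10) <|
  .seq (.write 13) <| .seq (.write 8) <| .seq (.write 9) <|
  .arith 6 .sub 14 5

/-- The invariant of the loop that lists the facets of the digons. -/
structure DigonInv (k n m : ℕ) (s : State) : Prop where
  const : Constants n s
  r5 : s.reg 5 = m
  r6 : s.reg 6 = n - 1 - m
  out : s.out = encode ((List.range (n * n)).flatMap (fun m => discFacets k (m / n) (m % n)) ++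
    (List.range m).flatMap (digonFacets k))

theorem runs_digonBody {k n B m : ℕ} (hn : n = 2 ^ k) (hB : 16 * (n * n) ≤ B) (hm : m < n - 1)
    {s : State} (h : DigonInv k n m s) :
    s.reg 6 ≠ 0 ∧ Runs B digonBody s 19 (DigonInv k n (m + 1)) := by
  obtain ⟨⟨h0, h1, h2, h3, h4, h12, h13, h14⟩, h5, h6, hout⟩ := h
  refine ⟨by omega, ?_⟩
  have b1 : n ≤ n * n := Nat.le_mul_self n
  obtain ⟨a, ha⟩ : ∃ a, (m + 1) * 2 + 1 = a := ⟨_, rfl⟩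
  have hout' : encode ((List.range (n * n)).flatMap (fun m => discFacets k (m / n) (m % n)) ++
      (List.range (m + 1)).flatMap (digonFacets k)) = s.out ++ [0, a, a + 1 + 2 * n,
        a, a + 1, a + 1 + 2 * n, a + 1, a + 2 * n, a + 1 + 2 * n, 0, a + 1, a + 2 * n] := by
    rw [List.range_succ, List.flatMap_append, ← List.append_assoc, encode_append, hout]
    congr 1
    simp only [List.flatMap_cons, List.flatMap_nil, List.append_nil, digonFacets, encode, v,
      ← hn, List.cons_append, List.nil_append, List.cons.injEq, and_true, true_and]
    omega
  unfold digonBody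
  refine Runs.arith_seq (m + 1) (by simp [Op.eval, h5, h1]) (by omega) ?_
  refine Runs.arith_seq ((m + 1) * 2) (by simp [Op.eval, State.reg_setReg, h2]) (by omega) ?_
  refine Runs.arith_seq a (by simp [Op.eval, State.reg_setReg, h1, ha]) (by omega) ?_
  refine Runs.arith_seq (a + 1) (by simp [Op.eval, State.reg_setReg, h1]) (by omega) ?_
  refine Runs.arith_seq (a + 2 * n) (by simp [Op.eval, State.reg_setReg, h4]) (by omega) ?_
  refine Runs.arith_seq (a + 1 + 2 * n) (by simp [Op.eval, State.reg_setReg, h4]) (by omega) ?_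
  refine Runs.write_seq 0 (by simp [State.reg_setReg, h13]) ?_
  refine Runs.write_seq a (by simp [State.reg_setReg, State.reg_append]) ?_
  refine Runs.write_seq (a + 1 + 2 * n) (by simp [State.reg_setReg, State.reg_append]) ?_
  refine Runs.write_seq a (by simp [State.reg_setReg, State.reg_append]) ?_
  refine Runs.write_seq (a + 1) (by simp [State.reg_setReg, State.reg_append]) ?_
  refine Runs.write_seq (a + 1 + 2 * n) (by simp [State.reg_setReg, State.reg_append]) ?_
  refine Runs.write_seq (a + 1) (by simp [State.reg_setReg, State.reg_append]) ?_
  refine Runs.write_seq (a + 2 * n) (by simp [State.reg_setReg, State.reg_append]) ?_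
  refine Runs.write_seq (a + 1 + 2 * n) (by simp [State.reg_setReg, State.reg_append]) ?_
  refine Runs.write_seq 0 (by simp [State.reg_setReg, State.reg_append, h13]) ?_
  refine Runs.write_seq (a + 1) (by simp [State.reg_setReg, State.reg_append]) ?_
  refine Runs.write_seq (a + 2 * n) (by simp [State.reg_setReg, State.reg_append]) ?_
  refine Runs.arith (n - 1 - (m + 1))
    (by simp [Op.eval, State.reg_setReg, State.reg_append, h14]) (by omega) ?_
  constructor
  · constructor <;> simp [State.reg_setReg, State.reg_append, *]
  · simp [State.reg_setReg, State.reg_append]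
  · simp [State.reg_setReg]
  · rw [hout']
    simp [State.out_setReg, State.out_append]

/-- Start a count of `n ^ 2` passes. -/
def resetSquare : Program := .seq (.const 5 0) (.arith 6 .add 3 5)

/-- Start a count of `n - 1` passes. -/
def resetPred : Program := .seq (.const 5 0) (.arith 6 .add 14 5)

/-- The program that lists the facets. Its tables have an entry for every number `m = n * i + j`
that encodes a row `i` and a column or position `j`. The first table is filled with the numbers
`tableEntry`. With their help the vertices `x_{ij}^1`, `j = τ_i^p`, are stored in a second table.
Then the facets of the discs and those of the digons are listed. -/
def facetProgram : Program :=
  .seq setup <| .seq resetSquare <| .seq (.loop 6 tableBody) <| .seq resetSquare <|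
  .seq (.loop 6 vertexBody) <| .seq resetSquare <| .seq (.loop 6 discBody) <|
  .seq resetPred <| .loop 6 digonBody

theorem runs_setup {n B : ℕ} (hn : 1 ≤ n) (hB : 16 * (n * n) ≤ B) :
    Runs B setup (initial n) 8 fun s => Constants n s ∧ (∀ a, s.mem a = 0) ∧ s.out = [] := by
  have b1 : n ≤ n * n := Nat.le_mul_self n
  unfold setup
  refine Runs.const_seq 1 (by omega) ?_
  refine Runs.const_seq 2 (by omega) ?_
  refine Runs.arith_seq (n * n) (by simp [Op.eval, State.reg_setReg, initial]) (by omega) ?_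
  refine Runs.arith_seq (2 * n) (by simp [Op.eval, State.reg_setReg, initial]) (by omega) ?_
  refine Runs.arith_seq (4 * n) (by simp [Op.eval, State.reg_setReg]; omega) (by omega) ?_
  refine Runs.arith_seq (4 * n + 1) (by simp [Op.eval, State.reg_setReg]) (by omega) ?_
  refine Runs.const_seq 0 (by omega) ?_
  refine Runs.arith (n - 1) (by simp [Op.eval, State.reg_setReg, initial]) (by omega) ?_
  refine ⟨?_, fun _ => rfl, rfl⟩
  constructor <;> simp [State.reg_setReg, initial]

theorem runs_resetSquare {n B : ℕ} (hB : 16 * (n * n) ≤ B) {s : State} (h : Constants n s)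
    {Q : State → Prop} (hQ : ∀ s', Constants n s' → s'.reg 5 = 0 → s'.reg 6 = n * n →
      s'.mem = s.mem → s'.out = s.out → Q s') : Runs B resetSquare s 2 Q := by
  obtain ⟨h0, h1, h2, h3, h4, h12, h13, h14⟩ := h
  refine Runs.const_seq 0 (by omega) ?_
  refine Runs.arith (n * n) (by simp [Op.eval, State.reg_setReg, h3]) (by omega) ?_
  refine hQ _ ?_ ?_ ?_ rfl rfl
  · constructor <;> simp [State.reg_setReg, *]
  · simp [State.reg_setReg]
  · simp [State.reg_setReg]

theorem runs_resetPred {n B : ℕ} (hB : 16 * (n * n) ≤ B) {s : State} (h : Constants n s)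
    {Q : State → Prop} (hQ : ∀ s', Constants n s' → s'.reg 5 = 0 → s'.reg 6 = n - 1 →
      s'.mem = s.mem → s'.out = s.out → Q s') : Runs B resetPred s 2 Q := by
  obtain ⟨h0, h1, h2, h3, h4, h12, h13, h14⟩ := h
  have b1 : n ≤ n * n := Nat.le_mul_self n
  refine Runs.const_seq 0 (by omega) ?_
  refine Runs.arith (n - 1) (by simp [Op.eval, State.reg_setReg, h14]) (by omega) ?_
  refine hQ _ ?_ ?_ ?_ rfl rfl
  · constructor <;> simp [State.reg_setReg, *]
  · simp [State.reg_setReg]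
  · simp [State.reg_setReg]

theorem runs_facetProgram {k n B : ℕ} (hn : n = 2 ^ k) (hB : 16 * (n * n) ≤ B) :
    Runs B facetProgram (initial n)
      (8 + (2 + (n * n * 21 + 1 + (2 + (n * n * 25 + 1 + (2 + (n * n * 23 + 1 +
        (2 + ((n - 1) * 20 + 1))))))))) fun s => s.out = encode (facetList k) := by
  have hn0 : 0 < n := by rw [hn]; positivity
  refine (runs_setup hn0 hB).seq fun s h => ?_
  refine Runs.seq (runs_resetSquare hB h.1 (Q := TableInv k n 0) ?_) fun s h => ?_
  · intro s' hc h5 h6 hm ho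
    exact ⟨hc, h5, h6, fun a => by rw [hm, h.2.1]; simp, by rw [ho, h.2.2]⟩
  refine Runs.seq (Runs.loop (TableInv k n) (fun m hm s h => runs_tableBody hn hB hm h)
    (fun s h => by rw [h.r6, Nat.sub_self]) h) fun s h => ?_
  refine Runs.seq (runs_resetSquare hB h.const (Q := VertexInv k n 0) ?_) fun s h => ?_
  · intro s' hc h5 h6 hm ho
    exact ⟨hc, h5, h6, fun a ha => by rw [hm, h.mem, if_pos ha], fun a ha => by omega,
      by rw [ho, h.out]⟩
  refine Runs.seq (Runs.loop (VertexInv k n) (fun m hm s h => runs_vertexBody hn hB hm h)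
    (fun s h => by rw [h.r6, Nat.sub_self]) h) fun s h => ?_
  refine Runs.seq (runs_resetSquare hB h.const (Q := DiscInv k n 0) ?_) fun s h => ?_
  · intro s' hc h5 h6 hm ho
    exact ⟨hc, h5, h6, fun a ha => by rw [hm, h.mem' a ha], by rw [ho, h.out]; rfl⟩
  refine Runs.seq (Runs.loop (DiscInv k n) (fun m hm s h => runs_discBody hn hB hm h)
    (fun s h => by rw [h.r6, Nat.sub_self]) h) fun s h => ?_
  refine Runs.seq (runs_resetPred hB h.const (Q := DigonInv k n 0) ?_) fun s h => ?_
  · intro s' hc h5 h6 hm ho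
    exact ⟨hc, h5, h6, by rw [ho, h.out]; simp⟩
  obtain ⟨t, s', ht, he, h'⟩ := Runs.loop (B := B) (DigonInv k n)
    (fun m hm s h => runs_digonBody hn hB hm h) (fun s h => by rw [h.r6, Nat.sub_self]) h
  refine ⟨t, s', ht, he, ?_⟩
  change s'.out = _
  rw [h'.out, facetList, hn]

/-- The lower bound for the running time comes from the number of vertices that have to be written.
All numbers that occur are at most `16 n ^ 2`, hence at most `n ^ 6`. -/
theorem exists_computes {k : ℕ} (hk : 1 ≤ k) : ∃ t,
    Computes ((2 ^ k) ^ 6) facetProgram (2 ^ k) t (encode (facetList k)) ∧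
      (2 ^ k) ^ 2 ≤ t ∧ t ≤ 120 * (2 ^ k) ^ 2 := by
  obtain ⟨n, hn⟩ : ∃ n, n = 2 ^ k := ⟨_, rfl⟩
  have h2 : 2 ≤ n := by rw [hn]; exact (Nat.pow_le_pow_right two_pos hk : 2 ^ 1 ≤ 2 ^ k)
  have hB : 16 * (n * n) ≤ n ^ 6 := by
    calc 16 * (n * n) = 2 ^ 4 * n ^ 2 := by ring
      _ ≤ n ^ 4 * n ^ 2 := Nat.mul_le_mul_right _ (Nat.pow_le_pow_left h2 4)
      _ = n ^ 6 := by ring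
  obtain ⟨t, s, ht, he, ho⟩ := runs_facetProgram hn hB
  have b1 : n ≤ n * n := Nat.le_mul_self n
  have hl := he.length_out_le
  have hlen : (encode (facetList k)).length = 3 * (facetList k).length := by
    simp [encode, List.length_flatMap, mul_comm]
  rw [ho, hlen, length_facetList] at hl
  rw [← hn] at hl ⊢
  refine ⟨t, ⟨s, he, ho⟩, ?_, ?_⟩
  · have : (initial n).out.length = 0 := rfl
    rw [pow_two] at hl ⊢
    omega
  · -- As `1 ≤ n ≤ n ^ 2`, the passes of the four loops and the constants add up to less than this.
    rw [pow_two]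
    omega

theorem card_torsion {k : ℕ} (hk : 1 ≤ k) :
    AddCommGroup.torsion ((complex k).Homology ℤ 1) = ⊤ ∧
      Nat.card (AddCommGroup.torsion ((complex k).Homology ℤ 1)) = (2 ^ k) ^ (2 ^ k / 2) := by
  have hc := card_homology_one_int hk
  have : Finite ((complex k).Homology ℤ 1) :=
    Nat.finite_of_card_ne_zero (by rw [hc]; positivity)
  have ht : AddCommGroup.torsion ((complex k).Homology ℤ 1) = ⊤ :=
    (AddSubgroup.eq_top_iff' _).mpr fun x => isOfFinAddOrder_of_finite x
  refine ⟨ht, ?_⟩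
  rw [ht, ← hc]
  exact Nat.card_congr AddSubgroup.topEquiv.toEquiv

theorem logb_card_torsion_isTheta :
    (fun k : ℕ => Real.logb 2 (Nat.card (AddCommGroup.torsion ((complex k).Homology ℤ 1))))
      =Θ[atTop] fun k : ℕ => (2 : ℝ) ^ k * Real.logb 2 ((2 : ℝ) ^ k) := by
  have h : (fun k : ℕ =>
      Real.logb 2 (Nat.card (AddCommGroup.torsion ((complex k).Homology ℤ 1)))) =ᶠ[atTop]
      fun k : ℕ => (1 / 2 : ℝ) * ((2 : ℝ) ^ k * Real.logb 2 ((2 : ℝ) ^ k)) := by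
    filter_upwards [eventually_ge_atTop 1] with k hk
    obtain ⟨m, rfl⟩ := Nat.exists_eq_add_of_le' hk
    rw [(card_torsion hk).2, pow_succ 2 m, Nat.mul_div_cancel _ two_pos]
    push_cast
    rw [Real.logb_pow]
    push_cast
    rw [pow_succ]
    ring
  exact h.trans_isTheta ((isTheta_refl _ _).const_mul_left (by norm_num))

end HMT

theorem mainTheorem1 :
    (∀ k : ℕ, 1 ≤ k →
      (HMT.complex k).HasDimension 2 ∧
      (HMT.complex k).IsRationallyAcyclic ∧
      (HMT.complex k).faceNumber 0 = 5 * 2 ^ k - 1 ∧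
      (HMT.complex k).faceNumber 1 = 3 * (2 ^ k) ^ 2 + 9 * 2 ^ k - 6 ∧
      (HMT.complex k).faceNumber 2 = 3 * (2 ^ k) ^ 2 + 4 * 2 ^ k - 4 ∧
      Nonempty ((HMT.complex k).Homology ℤ 0 ≃+ ℤ) ∧
      Nonempty ((HMT.complex k).Homology ℤ 1 ≃+
        ((j : Fin k) → Fin (k.choose (j + 1)) → ZMod (2 ^ ((j : ℕ) + 1)))) ∧
      (∀ d, 2 ≤ d → Subsingleton ((HMT.complex k).Homology ℤ d)) ∧
      AddCommGroup.torsion ((HMT.complex k).Homology ℤ 1) = ⊤ ∧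
      Nat.card (AddCommGroup.torsion ((HMT.complex k).Homology ℤ 1)) =
        (2 ^ k) ^ (2 ^ k / 2)) ∧
    ((fun k : ℕ => Real.logb 2 (Nat.card (AddCommGroup.torsion ((HMT.complex k).Homology ℤ 1))))
      =Θ[atTop] fun k : ℕ => (2 : ℝ) ^ k * Real.logb 2 ((2 : ℝ) ^ k)) ∧
    (∃ (P : WordRAM.Program) (a : ℕ) (time : ℕ → ℕ),
      (∀ k : ℕ, 1 ≤ k → ∃ out : List ℕ,
        WordRAM.Computes ((2 ^ k) ^ a) P (2 ^ k) (time k) out ∧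
          ListsFacets out (HMT.complex k)) ∧
      (fun k : ℕ => (time k : ℝ)) =Θ[atTop] fun k : ℕ => ((2 : ℝ) ^ k) ^ 2) := by
  refine ⟨fun k hk => ?_, HMT.logb_card_torsion_isTheta, HMT.facetProgram, 6, ?_⟩
  · exact ⟨HMT.hasDimension_two hk, HMT.isRationallyAcyclic hk, HMT.faceNumber_zero hk,
      HMT.faceNumber_one hk, HMT.faceNumber_two hk,
      (HMT.nonempty_homology_zero ℤ k).map LinearEquiv.toAddEquiv,
      HMT.nonempty_homology_one_int hk,
      fun _ hd => HMT.subsingleton_homology (HMT.ker_boundary_one_int hk) hd,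
      HMT.card_torsion hk⟩
  · choose time htime using fun k : {k : ℕ // 1 ≤ k} => HMT.exists_computes k.2
    refine ⟨fun k => if hk : 1 ≤ k then time ⟨k, hk⟩ else 0, fun k hk => ?_, ?_⟩
    · dsimp only
      rw [dif_pos hk]
      exact ⟨_, (htime ⟨k, hk⟩).1, HMT.listsFacets hk⟩
    · constructor
      · refine IsBigO.of_bound 120 ?_
        filter_upwards [eventually_ge_atTop 1] with k hk
        rw [dif_pos hk, Real.norm_natCast, Real.norm_of_nonneg (by positivity)]
        exact_mod_cast (htime ⟨k, hk⟩).2.2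
      · refine IsBigO.of_bound 1 ?_
        filter_upwards [eventually_ge_atTop 1] with k hk
        rw [dif_pos hk, Real.norm_natCast, Real.norm_of_nonneg (by positivity), one_mul]
        exact_mod_cast (htime ⟨k, hk⟩).2.1
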